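/- All graphs are finite and simple. The odd girth of a graph is the length of a shortest odd cycle in it, and is $\infty$ if there is no odd cycle. For $k \ge 3$, the $k$-wheel is the graph consisting of a cycle of length $k$ and one additional vertex adjacent to every vertex of the cycle; an odd wheel is (a graph isomorphic to) a $k$-wheel with $k \ge 3$ odd. A t-contraction of a graph is the operation of choosing a vertex $v$ whose set of neighbours is stable (pairwise non-adjacent), and contracting all edges incident with $v$ (loops and parallel edges being suppressed). A graph $H$ is a t-minor of a graph $G$ if, up to isomorphism, $H$ is obtained from $G$ by a finite sequence of vertex deletions and t-contractions. **Theorem.** Every graph with odd girth at least $11$ that contains no odd wheel as a t-minor is $199049$-colourable. -/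

import Mathlib

universe u

namespace SimpleGraph

/-- The odd girth: the length of a shortest cycle of odd length, and `⊤` if there is none. -/
noncomputable def oddGirth {V : Type u} (G : SimpleGraph V) : ℕ∞ :=
  ⨅ (a : V) (w : G.Walk a a) (_ : w.IsCycle) (_ : Odd w.length), (w.length : ℕ∞)

theorem le_oddGirth {V : Type u} {G : SimpleGraph V} {n : ℕ∞} :
    n ≤ G.oddGirth ↔ ∀ (a : V) (w : G.Walk a a), w.IsCycle → Odd w.length → n ≤ w.length := by
  simp only [oddGirth, le_iInf_iff]

/-- The `k`-wheel: the cycle of length `k` on the vertices `some i`, together with the centre `none`,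
which is adjacent to every vertex of the cycle. It is meant for `3 ≤ k`. -/
def wheelGraph (k : ℕ) : SimpleGraph (Option (Fin k)) where
  Adj
    | none, none => False
    | none, some _ => True
    | some _, none => True
    | some i, some j => (cycleGraph k).Adj i j
  symm := ⟨by rintro (_ | i) (_ | j) h <;> first | exact h | exact SimpleGraph.Adj.symm h⟩
  loopless := ⟨by rintro (_ | i) h <;> first | exact h | exact (cycleGraph k).irrefl h⟩

/-- An odd wheel is a graph isomorphic to the `k`-wheel for some odd `k ≥ 3`. -/
def IsOddWheel {V : Type u} (G : SimpleGraph V) : Prop :=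
  ∃ k : ℕ, 3 ≤ k ∧ Odd k ∧ Nonempty (G ≃g wheelGraph k)

open Classical in
/-- The map that sends every neighbour of `v` to `v` and fixes all other vertices. -/
noncomputable def starCollapse {V : Type u} (G : SimpleGraph V) (v : V) (x : V) :
    {y : V // ¬ G.Adj v y} :=
  if h : G.Adj v x then ⟨v, G.irrefl⟩ else ⟨x, h⟩

/-- The simple graph obtained from `G` by contracting all edges incident with `v`. The closed
neighbourhood of `v` becomes one vertex, which is again called `v`; two distinct vertices are
adjacent if some edge of `G` joins their preimages (so loops and parallel edges are suppressed). -/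
def contractStar {V : Type u} (G : SimpleGraph V) (v : V) : SimpleGraph {y : V // ¬ G.Adj v y} where
  Adj a b := a ≠ b ∧ ∃ x y : V, G.Adj x y ∧ G.starCollapse v x = a ∧ G.starCollapse v y = b
  symm := ⟨by
    rintro a b ⟨hne, x, y, h, hx, hy⟩
    exact ⟨hne.symm, y, x, h.symm, hy, hx⟩⟩
  loopless := ⟨fun _ h => h.1 rfl⟩

/-- `H.IsTMinor G`: up to isomorphism, `H` arises from `G` by a finite sequence of deletions of a
vertex and of t-contractions. A t-contraction contracts all edges incident with a vertex whose
set of neighbours is stable. -/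
inductive IsTMinor {W : Type u} (H : SimpleGraph W) : {V : Type u} → SimpleGraph V → Prop
  | of_iso {V : Type u} {G : SimpleGraph V} (e : H ≃g G) : IsTMinor H G
  | of_delete {V : Type u} {G : SimpleGraph V} (v : V)
      (h : IsTMinor H (G.induce {x | x ≠ v})) : IsTMinor H G
  | of_contract {V : Type u} {G : SimpleGraph V} (v : V) (hv : G.IsIndepSet (G.neighborSet v))
      (h : IsTMinor H (G.contractStar v)) : IsTMinor H G

end SimpleGraph

/-! ### Models of t-minors -/

namespace SimpleGraph

/-! Odd wheels are found from an odd induced cycle (the rim) and a disjoint connected bipartite set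
(the hub) of which only one class `B` sees the rim. Contracting the stars of the other class `A`
turns the hub into a single vertex, and the rim is marked where it sees `B`. If two disjoint odd
arcs of the rim have marked ends, then the rest of the rim supplies a third, and contracting stars
of unmarked rim vertices leaves an odd wheel with at least three spokes
(`exists_tmodel_markedWheel`, `hasOddWheel_of_hub`).

Hubs come from breadth-first search. For a rim in level `m + 1`, the parent of a rim vertex is
called its letter. A few letters at pairwise distance at least three can be joined through the
levels above by a connected set in which each letter sees its own parent only. A minimal connected
set through at most ten terminals is bipartite: each vertex of an odd hole would be the entry of a
terminal of its own, and an odd hole has at least eleven vertices (`exists_connOn_bipartite`,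
`Levelling.exists_link`). Letters whose parents lie in one class of the link can join the other
class, and the hub then sees the rim through these letters.

The parities are controlled by free choices. A set of large chromatic number, attached to a vertex
`x`, contains a path from `x` that passes an odd hole by either of its two arcs and leads to a
smaller attached set whose chromatic number is still large (`Att.exists_block`). The hole consists
of a horizontal edge of a levelling, as near to the root as possible, and two tree paths from its
ends to a common ancestor. Repetition gives a rope through several holes, with pairs of marked
vertices at odd distance and with all letters far from each other (`Att.exists_rope`). A rim through
three of the holes carries five marks. Three of the five letters are joined to the same class of a
link; the free arcs make the positions of these three alternate in parity and the rim odd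
(`Levelling.hasOddWheel_of_marks`).

It remains to close the rope to a cycle inside one level. To this end the rope is built in a level
of a levelling of a connected set `H` which itself lies in a level of an outer levelling. The outer
levelling provides the hub, the inner one closes the rim. The rope ends at a set `E` of large
chromatic number. The vertices of `E` whose inner letters see a given hole of the rope need few
colours, and so do those whose letters miss the arcs of a hole but see the rope on both sides of it;
otherwise there is an odd wheel (`Levelling.colOn_hole`, `Levelling.colOn_dense`). So some vertex of
`E` has a letter `p` that sees no arc and sees the rope on at most one side of each of the first
three holes. If `p` sees an early stem, this contact and the end of the rope close the rim. If not,
a path through the upper inner levels leads from `p` to the start of the rope. -/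

theorem starCollapse_of_adj {V : Type u} {G : SimpleGraph V} {v x : V} (h : G.Adj v x) :
    G.starCollapse v x = ⟨v, G.irrefl⟩ := by
  simp [starCollapse, h]

theorem starCollapse_of_not_adj {V : Type u} {G : SimpleGraph V} {v x : V} (h : ¬ G.Adj v x) :
    G.starCollapse v x = ⟨x, h⟩ := by
  simp [starCollapse, h]

/-- Isomorphic graphs have isomorphic t-contractions. -/
def contractStarIso {V V' : Type u} {G : SimpleGraph V} {G' : SimpleGraph V'} (e : G ≃g G')
    (v : V) : G.contractStar v ≃g G'.contractStar (e v) where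
  toEquiv := e.toEquiv.subtypeEquiv (fun a => by simp [e.map_adj_iff])
  map_rel_iff' := by
    have key : ∀ x, G'.starCollapse (e v) (e x) =
        (e.toEquiv.subtypeEquiv (fun a => by simp [e.map_adj_iff]) :
          {y : V // ¬ G.Adj v y} ≃ {y : V' // ¬ G'.Adj (e v) y}) (G.starCollapse v x) := by
      intro x
      by_cases h : G.Adj v x
      · rw [starCollapse_of_adj h, starCollapse_of_adj (e.map_adj_iff.2 h)]; rfl
      · rw [starCollapse_of_not_adj h, starCollapse_of_not_adj (fun h' => h (e.map_adj_iff.1 h'))]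
        rfl
    intro a b
    constructor
    · rintro ⟨hne, x, y, hxy, hx, hy⟩
      obtain ⟨x, rfl⟩ := e.surjective x
      obtain ⟨y, rfl⟩ := e.surjective y
      rw [key] at hx hy
      refine ⟨fun h => hne (by rw [h]), x, y, e.map_adj_iff.1 hxy, ?_, ?_⟩
      · exact Equiv.injective _ hx
      · exact Equiv.injective _ hy
    · rintro ⟨hne, x, y, hxy, hx, hy⟩
      refine ⟨fun h => hne (Equiv.injective _ h), e x, e y, e.map_adj_iff.2 hxy, ?_, ?_⟩
      · rw [key, hx]
      · rw [key, hy]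

theorem IsTMinor.trans_iso {W V : Type u} {H : SimpleGraph W} {G : SimpleGraph V}
    (h : H.IsTMinor G) : ∀ {V' : Type u} {G' : SimpleGraph V'}, (G ≃g G') → H.IsTMinor G' := by
  induction h with
  | of_iso e => intro V' G' f; exact .of_iso (e.trans f)
  | @of_delete V G v h ih =>
    intro V' G' f
    refine .of_delete (f v) (ih ⟨f.toEquiv.subtypeEquiv (fun a => by simp), ?_⟩)
    intro a b
    simp [f.map_adj_iff]
  | @of_contract V G v hv h ih =>
    intro V' G' f
    refine .of_contract (f v) ?_ (ih (contractStarIso f v))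
    intro x hx y hy hne hxy
    obtain ⟨x, rfl⟩ := f.surjective x
    obtain ⟨y, rfl⟩ := f.surjective y
    exact hv (f.map_adj_iff.1 hx) (f.map_adj_iff.1 hy) (fun h => hne (by rw [h]))
      (f.map_adj_iff.1 hxy)

theorem IsTMinor.trans {W K V : Type u} {H : SimpleGraph W} {L : SimpleGraph K}
    {G : SimpleGraph V} (h₁ : H.IsTMinor L) (h₂ : L.IsTMinor G) : H.IsTMinor G := by
  induction h₂ with
  | of_iso e => exact h₁.trans_iso e
  | of_delete v _ ih => exact .of_delete v ih
  | of_contract v hv _ ih => exact .of_contract v hv ih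

/-- A t-minor model of `H` in `G`: the fibres of `φ` are the branch sets, each of them bipartite with
the vertices of `A` on one side, which are the centres of the contractions. -/
structure TModel {W V : Type*} (H : SimpleGraph W) (G : SimpleGraph V) (φ : V → Option W)
    (A : Set V) : Prop where
  surj : ∀ w, ∃ v, φ v = some w ∧ v ∉ A
  conn : ∀ w (P : V → Prop), (∃ u, φ u = some w ∧ P u) →
    (∀ a b, G.Adj a b → φ a = some w → φ b = some w → P a → P b) → ∀ v, φ v = some w → P v
  closed : ∀ v ∈ A, ∀ w, φ v = some w → ∀ u, G.Adj u v → φ u ≠ none → φ u = some w ∧ u ∉ A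
  stable : ∀ u v w, u ∉ A → v ∉ A → φ u = some w → φ v = some w → ¬ G.Adj u v
  adj : ∀ w w', w ≠ w' → (H.Adj w w' ↔ ∃ u v, G.Adj u v ∧ φ u = some w ∧ φ v = some w')

theorem TModel.delete {W V : Type*} {H : SimpleGraph W} {G : SimpleGraph V} {φ : V → Option W}
    {A : Set V} (h : TModel H G φ A) {x : V} (hx : φ x = none) :
    TModel H (G.induce {y | y ≠ x}) (fun y => φ y.1) {y | y.1 ∈ A} where
  surj w := by
    obtain ⟨v, hv, hA⟩ := h.surj w
    exact ⟨⟨v, fun e => by simp_all⟩, hv, hA⟩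
  conn := by
    rintro w P ⟨u, hu, hPu⟩ hstep ⟨v, hvx⟩ hv
    have := h.conn w (fun y => ∀ hy : y ≠ x, P ⟨y, hy⟩) ⟨u.1, hu, fun _ => hPu⟩
      (fun a b hab ha hb hP hbx => hstep ⟨a, fun e => by simp_all⟩ ⟨b, hbx⟩ hab ha hb (hP _)) v hv
    exact this hvx
  closed := by
    rintro ⟨v, hvx⟩ hv w hw ⟨u, hux⟩ huv hu
    exact h.closed v hv w hw u huv hu
  stable := by
    rintro ⟨u, hux⟩ ⟨v, hvx⟩ w hu hv h1 h2 huv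
    exact h.stable u v w hu hv h1 h2 huv
  adj w w' hne := by
    rw [h.adj w w' hne]
    constructor
    · rintro ⟨u, v, huv, hu, hv⟩
      exact ⟨⟨u, fun e => by simp_all⟩, ⟨v, fun e => by simp_all⟩, huv, hu, hv⟩
    · rintro ⟨u, v, huv, hu, hv⟩
      exact ⟨u, v, huv, hu, hv⟩

/-- By `closed` the neighbours of a centre `a` lie in its own branch set and outside `A`, so the
collapse of the star respects `φ`. The merged vertex keeps the name `a` but changes sides: it is no
centre any more. -/
theorem TModel.contract {W V : Type u} {H : SimpleGraph W} {G : SimpleGraph V} {φ : V → Option W}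
    {A : Set V} (h : TModel H G φ A) (hφ : ∀ x, φ x ≠ none) {a : V} (ha : a ∈ A) :
    TModel H (G.contractStar a) (fun y => φ y.1) {y | y.1 ∈ A ∧ y.1 ≠ a} := by
  obtain ⟨w₀, hw₀⟩ := Option.ne_none_iff_exists'.1 (hφ a)
  have hnb : ∀ u, G.Adj a u → φ u = some w₀ ∧ u ∉ A := fun u hu =>
    h.closed a ha w₀ hw₀ u hu.symm (hφ u)
  have hc : ∀ x, φ (G.starCollapse a x).1 = φ x := by
    intro x
    by_cases hx : G.Adj a x
    · rw [starCollapse_of_adj hx, (hnb x hx).1, hw₀]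
    · rw [starCollapse_of_not_adj hx]
  have hcs : ∀ y : {y : V // ¬ G.Adj a y}, G.starCollapse a y.1 = y := fun y =>
    starCollapse_of_not_adj y.2
  have hA : ∀ x (hx : x ∈ A), G.starCollapse a x = ⟨x, fun h => (hnb x h).2 hx⟩ := fun x hx =>
    starCollapse_of_not_adj _
  refine ⟨?_, ?_, ?_, ?_, ?_⟩
  · intro w
    obtain ⟨v, hv, hvA⟩ := h.surj w
    refine ⟨G.starCollapse a v, by rw [hc, hv], ?_⟩
    rintro ⟨h1, h2⟩
    by_cases hx : G.Adj a v
    · exact h2 (by rw [starCollapse_of_adj hx])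
    · rw [starCollapse_of_not_adj hx] at h1
      exact hvA h1
  · rintro w P ⟨u, hu, hPu⟩ hstep v hv
    have := h.conn w (fun y => P (G.starCollapse a y)) ⟨u.1, hu, by rwa [hcs]⟩ ?_ v.1 hv
    · rwa [hcs] at this
    · intro x y hxy hx hy hP
      by_cases he : G.starCollapse a x = G.starCollapse a y
      · rwa [← he]
      · exact hstep _ _ ⟨he, x, y, hxy, rfl, rfl⟩ (by simp only [hc, hx]) (by simp only [hc, hy]) hP
  · rintro v ⟨hvA, hva⟩ w hw u ⟨hne, x, y, hxy, hx, hy⟩ -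
    have hyv : y = v.1 := by
      by_cases hy' : G.Adj a y
      · rw [starCollapse_of_adj hy'] at hy
        exact absurd (by rw [← hy]) hva
      · rw [starCollapse_of_not_adj hy'] at hy
        rw [← hy]
    subst hyv
    obtain ⟨h1, h2⟩ := h.closed v.1 hvA w hw x hxy (hφ x)
    refine ⟨by rw [← hx, hc, h1], ?_⟩
    rintro ⟨h3, h4⟩
    rw [← hx] at h3 h4
    by_cases hx' : G.Adj a x
    · exact h4 (by rw [starCollapse_of_adj hx'])
    · rw [starCollapse_of_not_adj hx'] at h3
      exact h2 h3
  · rintro u v w hu hv hφu hφv ⟨hne, x, y, hxy, hx, hy⟩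
    have hxw : φ x = some w := by rw [← hc, hx, hφu]
    have hyw : φ y = some w := by rw [← hc, hy, hφv]
    -- An end `x` in `A` would be its own image, hence equal to `a`; then the other end of the edge
    -- collapses onto the same vertex.
    have aux : ∀ x y u v, u ≠ v → G.Adj x y → G.starCollapse a x = u → G.starCollapse a y = v →
        ¬ (u.1 ∈ A ∧ u.1 ≠ a) → x ∉ A := by
      intro x y u v hne hxy hx hy hu hxA
      rw [hA x hxA] at hx
      subst hx
      have : x = a := by by_contra hc; exact hu ⟨hxA, hc⟩
      subst this
      rw [starCollapse_of_adj hxy] at hy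
      exact hne hy
    exact h.stable x y w (aux x y u v hne hxy hx hy hu)
      (aux y x v u hne.symm hxy.symm hy hx hv) hxw hyw hxy
  · intro w w' hne
    rw [h.adj w w' hne]
    constructor
    · rintro ⟨u, v, huv, hu, hv⟩
      refine ⟨G.starCollapse a u, G.starCollapse a v, ⟨fun e => hne ?_, u, v, huv, rfl, rfl⟩,
        by rw [hc, hu], by rw [hc, hv]⟩
      have := hc u
      rw [e, hc, hu, hv] at this
      simpa using this.symm
    · rintro ⟨u, v, ⟨_, x, y, hxy, hx, hy⟩, hu, hv⟩
      exact ⟨x, y, hxy, by rw [← hc, hx, hu], by rw [← hc, hy, hv]⟩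

/-- Vertices outside all branch sets are deleted, then the stars of the centres are contracted one
by one. Without centres, a branch set is both connected and stable, hence a single vertex, and the
model is an isomorphism. -/
theorem TModel.isTMinor {W : Type u} {H : SimpleGraph W} : ∀ {V : Type u} [Finite V]
    {G : SimpleGraph V} {φ : V → Option W} {A : Set V}, TModel H G φ A → H.IsTMinor G := by
  suffices ∀ n : ℕ, ∀ {V : Type u} [Finite V] {G : SimpleGraph V} {φ : V → Option W} {A : Set V},
      Nat.card V ≤ n → TModel H G φ A → H.IsTMinor G from
    fun {_ _ _ _ _} h => this _ le_rfl h
  intro n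
  induction n with
  | zero =>
    intro V _ G φ A hn h
    have : IsEmpty V := (Finite.card_eq_zero_iff (α := V)).1 (by omega)
    have : IsEmpty W := ⟨fun w => IsEmpty.false (h.surj w).choose⟩
    exact .of_iso ⟨Equiv.equivOfIsEmpty _ _, fun {a} => isEmptyElim a⟩
  | succ n ih =>
    intro V _ G φ A hn h
    by_cases h1 : ∃ x, φ x = none
    · obtain ⟨x, hx⟩ := h1
      refine .of_delete x (ih ?_ (h.delete hx))
      have := Finite.card_subtype_lt (p := fun y => y ∈ {y : V | y ≠ x}) (x := x) (by simp)
      change Nat.card {y : V // y ∈ {y : V | y ≠ x}} ≤ n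
      omega
    push Not at h1
    have hnb : ∀ a ∈ A, ∀ u, G.Adj a u → φ u = φ a ∧ u ∉ A := by
      intro a ha u hu
      obtain ⟨w₀, hw₀⟩ := Option.ne_none_iff_exists'.1 (h1 a)
      rw [hw₀]
      exact h.closed a ha w₀ hw₀ u hu.symm (h1 u)
    by_cases h2 : ∃ a, a ∈ A
    · obtain ⟨a, ha⟩ := h2
      obtain ⟨w₀, hw₀⟩ := Option.ne_none_iff_exists'.1 (h1 a)
      obtain ⟨b, hb, hbA⟩ := h.surj w₀
      -- The connected branch set of `a` also has a vertex outside `A`, so `a` is not isolated and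
      -- its contraction lowers the number of vertices.
      have hadj : ∃ u, G.Adj a u := by
        by_contra hno
        push Not at hno
        have := h.conn w₀ (fun y => y = a) ⟨a, hw₀, rfl⟩
          (fun x y hxy _ _ hx => absurd (hx ▸ hxy) (hno y)) b hb
        exact hbA (this ▸ ha)
      obtain ⟨u, hu⟩ := hadj
      refine .of_contract a ?_ (ih ?_ (h.contract h1 ha))
      · intro x hx y hy _
        have hx' := hnb a ha x hx
        have hy' := hnb a ha y hy
        exact h.stable x y w₀ hx'.2 hy'.2 (hx'.1.trans hw₀) (hy'.1.trans hw₀)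
      · have := Finite.card_subtype_lt (p := fun y => ¬ G.Adj a y) (x := u) (by simpa using hu)
        omega
    · push Not at h2
      choose f hf using fun x => Option.ne_none_iff_exists'.1 (h1 x)
      have hinj : Function.Injective f := by
        intro x y hxy
        refine (h.conn (f x) (fun z => z = x) ⟨x, hf x, rfl⟩ ?_ y (by rw [hf, hxy])).symm
        intro a b hab ha hb _
        exact absurd hab (h.stable a b _ (h2 a) (h2 b) ha hb)
      have hsurj : Function.Surjective f := by
        intro w
        obtain ⟨v, hv, -⟩ := h.surj w
        exact ⟨v, by simpa [hf] using hv⟩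
      refine .of_iso (RelIso.symm ⟨Equiv.ofBijective f ⟨hinj, hsurj⟩, ?_⟩)
      intro x y
      change H.Adj (f x) (f y) ↔ G.Adj x y
      by_cases hxy : x = y
      · subst hxy; simp
      · rw [h.adj _ _ (fun e => hxy (hinj e))]
        constructor
        · rintro ⟨u, v, huv, hu, hv⟩
          rw [hf] at hu hv
          rw [← hinj (Option.some_injective _ hu), ← hinj (Option.some_injective _ hv)]
          exact huv
        · intro hxy
          exact ⟨x, y, hxy, hf x, hf y⟩

end SimpleGraph
namespace SimpleGraph

/-! ### Induced paths and induced cycles as lists of vertices -/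

section Lists

variable {V : Type u} {G : SimpleGraph V}

/-- `l` lists the vertices of an induced path of `G` in order. -/
def IndPath (G : SimpleGraph V) : List V → Prop
  | [] => True
  | x :: l => (∀ b ∈ l, x ≠ b ∧ (G.Adj x b ↔ l.head? = some b)) ∧ IndPath G l

/-- The only edge between the disjoint lists joins the end of the first to the start of the second. -/
def Link (G : SimpleGraph V) (l₁ l₂ : List V) : Prop :=
  ∀ a ∈ l₁, ∀ b ∈ l₂, a ≠ b ∧ (G.Adj a b ↔ l₁.getLast? = some a ∧ l₂.head? = some b)

/-- The only edges between the disjoint lists are the two that close them to a cycle. -/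
def CycLink (G : SimpleGraph V) (l₁ l₂ : List V) : Prop :=
  ∀ a ∈ l₁, ∀ b ∈ l₂, a ≠ b ∧ (G.Adj a b ↔ (l₁.getLast? = some a ∧ l₂.head? = some b) ∨
    (l₁.head? = some a ∧ l₂.getLast? = some b))

/-- `l` lists the vertices of an induced cycle of `G` in cyclic order. -/
def IndCyc (G : SimpleGraph V) : List V → Prop
  | [] => False
  | x :: l => 2 ≤ l.length ∧ IndPath G l ∧ CycLink G [x] l

theorem indPath_singleton (x : V) : IndPath G [x] := by simp [IndPath]

theorem indPath_cons {x : V} {l : List V} : IndPath G (x :: l) ↔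
    (∀ b ∈ l, x ≠ b ∧ (G.Adj x b ↔ l.head? = some b)) ∧ IndPath G l := Iff.rfl

theorem IndPath.nodup : ∀ {l : List V}, IndPath G l → l.Nodup
  | [], _ => List.nodup_nil
  | _ :: _, h => List.nodup_cons.2 ⟨fun hx => (h.1 _ hx).1 rfl, h.2.nodup⟩

/-- The tool for cutting and gluing induced paths: apart from the two pieces, only the edges across
the cut matter. -/
theorem indPath_append : ∀ {l₁ l₂ : List V},
    IndPath G (l₁ ++ l₂) ↔ IndPath G l₁ ∧ IndPath G l₂ ∧ Link G l₁ l₂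
  | [], l₂ => by simp [IndPath, Link]
  | [x], l₂ => by
    simp only [List.cons_append, List.nil_append, indPath_cons, Link, List.mem_singleton,
      forall_eq, List.getLast?_singleton, true_and]
    constructor
    · rintro ⟨h1, h2⟩
      exact ⟨⟨by simp, trivial⟩, h2, h1⟩
    · rintro ⟨-, h2, h1⟩
      exact ⟨h1, h2⟩
  | x :: y :: l, l₂ => by
    have ih := indPath_append (l₁ := y :: l) (l₂ := l₂)
    rw [List.cons_append, indPath_cons, ih, indPath_cons]
    have hlast : (x :: y :: l).getLast? = (y :: l).getLast? := by simp [List.getLast?_cons_cons]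
    constructor
    · rintro ⟨h1, h2, h3, h4⟩
      refine ⟨⟨fun b hb => ?_, h2⟩, h3, ?_⟩
      · have := h1 b (List.mem_append_left _ hb)
        simpa using this
      · intro a ha b hb
        rw [hlast]
        rcases List.mem_cons.1 ha with rfl | ha
        · have h5 := h1 b (List.mem_append_right _ hb)
          refine ⟨h5.1, ?_⟩
          rw [h5.2]
          constructor
          · intro h
            simp only [List.cons_append, List.head?_cons, Option.some.injEq] at h
            subst h
            exact absurd rfl (h4 y (by simp) y hb).1
          · rintro ⟨h, -⟩
            have := List.mem_of_mem_getLast? (l := y :: l) h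
            exact absurd rfl (h1 a (List.mem_append_left _ this)).1
        · exact h4 a ha b hb
    · rintro ⟨⟨h1, h2⟩, h3, h4⟩
      refine ⟨?_, h2, h3, ?_⟩
      · intro b hb
        rcases List.mem_append.1 hb with hb | hb
        · simpa using h1 b hb
        · have h5 := h4 x (by simp) b hb
          refine ⟨h5.1, ?_⟩
          rw [h5.2, hlast]
          constructor
          · rintro ⟨h, -⟩
            have := List.mem_of_mem_getLast? (l := y :: l) h
            exact absurd rfl (h1 x this).1
          · intro h
            simp only [List.cons_append, List.head?_cons, Option.some.injEq] at h
            subst h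
            exact absurd rfl (h4 y (by simp) y hb).1
      · intro a ha b hb
        have := h4 a (List.mem_cons_of_mem _ ha) b hb
        rwa [hlast] at this

theorem Link.reverse {l₁ l₂ : List V} (h : Link G l₁ l₂) : Link G l₂.reverse l₁.reverse := by
  intro a ha b hb
  have := h b (by simpa using hb) a (by simpa using ha)
  refine ⟨this.1.symm, ?_⟩
  rw [G.adj_comm, this.2]
  simp [and_comm]

theorem CycLink.symm {l₁ l₂ : List V} (h : CycLink G l₁ l₂) : CycLink G l₂ l₁ := by
  intro a ha b hb
  have := h b hb a ha
  refine ⟨this.1.symm, ?_⟩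
  rw [G.adj_comm, this.2]
  tauto

theorem IndPath.reverse : ∀ {l : List V}, IndPath G l → IndPath G l.reverse
  | [], _ => trivial
  | x :: l, h => by
    have h' : IndPath G ([x] ++ l) := h
    rw [indPath_append] at h'
    rw [List.reverse_cons, indPath_append]
    exact ⟨h'.2.1.reverse, indPath_singleton x, by simpa using h'.2.2.reverse⟩

/-- A cycle may be opened at any vertex: the right-hand side is symmetric in the two pieces, whereas
`IndCyc` singles out the first vertex. -/
theorem indCyc_append {l₁ l₂ : List V} (h₁ : l₁ ≠ []) (h₂ : l₂ ≠ []) : IndCyc G (l₁ ++ l₂) ↔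
    3 ≤ (l₁ ++ l₂).length ∧ IndPath G l₁ ∧ IndPath G l₂ ∧ CycLink G l₁ l₂ := by
  obtain ⟨x, l, rfl⟩ := List.exists_cons_of_ne_nil h₁
  rcases l with _ | ⟨y, l⟩
  · simp only [List.cons_append, List.nil_append, IndCyc, List.length_cons]
    have := indPath_singleton (G := G) x
    constructor
    · rintro ⟨a, b, c⟩; exact ⟨by omega, this, b, c⟩
    · rintro ⟨a, -, b, c⟩; exact ⟨by omega, b, c⟩
  have hlast : (x :: y :: l).getLast? = (y :: l).getLast? := by simp [List.getLast?_cons_cons]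
  have hlast' : (y :: l ++ l₂).getLast? = l₂.getLast? := by
    rw [List.getLast?_append_of_ne_nil _ h₂]
  rw [List.cons_append, IndCyc, indPath_append, indPath_cons]
  constructor
  · rintro ⟨h3, ⟨h4, h5, h6⟩, h7⟩
    refine ⟨by simpa using h3, ⟨fun b hb => ?_, h4⟩, h5, ?_⟩
    · have := h7 x (by simp) b (List.mem_append_left _ hb)
      refine ⟨this.1, ?_⟩
      rw [this.2, hlast']
      have : l₂.getLast? ≠ some b := fun h =>
        (h6 b hb b (List.mem_of_mem_getLast? h)).1 rfl
      simp [this]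
    · intro a ha b hb
      rw [hlast]
      rcases List.mem_cons.1 ha with rfl | ha
      · have h8 := h7 a (by simp) b (List.mem_append_right _ hb)
        refine ⟨h8.1, ?_⟩
        rw [h8.2, hlast']
        have h9 : y ≠ b := (h6 y (by simp) b hb).1
        have h10 : (y :: l).getLast? ≠ some a := fun h =>
          (h7 a (by simp) a (List.mem_append_left _ (List.mem_of_mem_getLast? h))).1 rfl
        simp [h9, h10]
      · have h8 := h6 a ha b hb
        refine ⟨h8.1, ?_⟩
        have h9 : x ≠ a := (h7 x (by simp) a (List.mem_append_left _ ha)).1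
        rw [h8.2]
        simp [h9]
  · rintro ⟨h3, ⟨h4, h5⟩, h6, h7⟩
    have hL : Link G (y :: l) l₂ := by
      intro a ha b hb
      have h8 := h7 a (List.mem_cons_of_mem _ ha) b hb
      have h9 : x ≠ a := (h4 a ha).1
      refine ⟨h8.1, ?_⟩
      rw [h8.2, hlast]
      simp [h9]
    refine ⟨by simpa using h3, ⟨h5, h6, hL⟩, ?_⟩
    intro a ha b hb
    obtain rfl := List.mem_singleton.1 ha
    rw [hlast']
    rcases List.mem_append.1 hb with hb | hb
    · have h8 := h4 b hb
      refine ⟨h8.1, ?_⟩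
      have : l₂.getLast? ≠ some b := fun h =>
        (hL b hb b (List.mem_of_mem_getLast? h)).1 rfl
      rw [h8.2]
      simp [this]
    · have h8 := h7 a (by simp) b hb
      refine ⟨h8.1, ?_⟩
      have h9 : y ≠ b := (hL y (by simp) b hb).1
      have h10 : (y :: l).getLast? ≠ some a := fun h =>
        (h4 a (List.mem_of_mem_getLast? h)).1 rfl
      rw [h8.2, hlast]
      simp [h9, h10]

theorem IndCyc.three_le {l : List V} (h : IndCyc G l) : 3 ≤ l.length := by
  rcases l with _ | ⟨x, l⟩
  · exact h.elim
  · have := h.1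
    simp; omega

theorem IndCyc.rotate {l₁ l₂ : List V} (h : IndCyc G (l₁ ++ l₂)) : IndCyc G (l₂ ++ l₁) := by
  rcases eq_or_ne l₁ [] with rfl | h1
  · simpa using h
  rcases eq_or_ne l₂ [] with rfl | h2
  · simpa using h
  rw [indCyc_append h1 h2] at h
  rw [indCyc_append h2 h1]
  exact ⟨by simpa [add_comm] using h.1, h.2.2.1, h.2.1, h.2.2.2.symm⟩

theorem IndPath.getElem : ∀ {l : List V}, IndPath G l → ∀ {i j : ℕ} (hij : i < j)
    (hj : j < l.length), l[i] ≠ l[j] ∧ (G.Adj l[i] l[j] ↔ j = i + 1)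
  | [], _, _, _, _, hj => by simp at hj
  | x :: l, h, 0, j + 1, _, hj => by
    have hj' : j < l.length := by simpa using hj
    have := h.1 l[j] (List.getElem_mem hj')
    refine ⟨this.1, ?_⟩
    rw [List.getElem_cons_zero, List.getElem_cons_succ, this.2, List.head?_eq_getElem?,
      List.getElem?_eq_getElem (by omega), Option.some_inj, h.2.nodup.getElem_inj_iff]
    omega
  | x :: l, h, i + 1, j + 1, hij, hj => by
    have hj' : j < l.length := by simpa using hj
    have := h.2.getElem (show i < j by omega) hj'
    simpa using this

theorem IndCyc.getElem {l : List V} (h : IndCyc G l) {i j : ℕ} (hij : i < j)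
    (hj : j < l.length) :
    l[i] ≠ l[j] ∧ (G.Adj l[i] l[j] ↔ j = i + 1 ∨ (i = 0 ∧ j + 1 = l.length)) := by
  rcases l with _ | ⟨x, l⟩
  · exact h.elim
  obtain ⟨h1, h2, h3⟩ := h
  obtain ⟨j, rfl⟩ : ∃ k, j = k + 1 := ⟨j - 1, by omega⟩
  have hj' : j < l.length := by simpa using hj
  rcases i with _ | i
  · have := h3 x (by simp) l[j] (List.getElem_mem hj')
    refine ⟨this.1, ?_⟩
    have e1 : l.head? = some l[0] := by
      rw [List.head?_eq_getElem?, List.getElem?_eq_getElem (by omega)]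
    have e2 : l.getLast? = some l[l.length - 1] := by
      rw [List.getLast?_eq_getElem?, List.getElem?_eq_getElem (by omega)]
    rw [List.getElem_cons_zero, List.getElem_cons_succ, this.2, e1, e2]
    simp only [List.getLast?_singleton, List.head?_cons, true_and, Option.some_inj,
      h2.nodup.getElem_inj_iff, List.length_cons]
    omega
  · have := h2.getElem (show i < j by omega) hj'
    simpa using this

theorem IndCyc.nodup {l : List V} (h : IndCyc G l) : l.Nodup := by
  rcases l with _ | ⟨x, l⟩
  · exact h.elim
  · exact List.nodup_cons.2 ⟨fun hx => (h.2.2 x (by simp) x hx).1 rfl, h.2.1.nodup⟩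

end Lists

end SimpleGraph
namespace SimpleGraph

/-! ### Wheels with a hub that sees only some vertices of the rim -/

/-- The cycle of length `n` together with a hub `none` adjacent to the positions in `X`. -/
def markedWheel (n : ℕ) (X : ℕ → Prop) : SimpleGraph (Option (Fin n)) where
  Adj
    | none, none => False
    | none, some i => X i
    | some i, none => X i
    | some i, some j => i ≠ j ∧ (j.val = (i.val + 1) % n ∨ i.val = (j.val + 1) % n)
  symm := ⟨by
    rintro (_ | i) (_ | j) h
    · exact h
    · exact h
    · exact h
    · exact ⟨h.1.symm, h.2.symm⟩⟩
  loopless := ⟨by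
    rintro (_ | i) h
    · exact h
    · exact h.1 rfl⟩

theorem cycleGraph_adj_iff_mod {k : ℕ} (hk : 2 ≤ k) {a b : Fin k} :
    (cycleGraph k).Adj a b ↔ b.val = (a.val + 1) % k ∨ a.val = (b.val + 1) % k := by
  have key : ∀ a b : Fin k, (a - b).val = 1 ↔ a.val = (b.val + 1) % k := by
    intro a b
    have ha := a.isLt
    have hb := b.isLt
    rw [Fin.sub_def]
    simp only
    have e1 : (b.val + 1) % k = if b.val + 1 = k then 0 else b.val + 1 := by
      split_ifs with h
      · rw [h, Nat.mod_self]
      · exact Nat.mod_eq_of_lt (by omega)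
    rw [e1]
    by_cases hab : b.val ≤ a.val
    · rw [show k - b.val + a.val = (a.val - b.val) + k by omega, Nat.add_mod_right,
        Nat.mod_eq_of_lt (by omega)]
      split_ifs <;> omega
    · rw [Nat.mod_eq_of_lt (by omega)]
      split_ifs <;> omega
  rw [cycleGraph_adj', key, key, or_comm]

open Classical in
/-- Greedy segments of a marked cycle: the class of a position (`true` for the side that keeps its
contacts with the hub) and the index of its segment. -/
noncomputable def segment (X : ℕ → Prop) : ℕ → Bool × ℕ
  | 0 => (true, 0)
  | i + 1 => if X (i + 1) then (true, (segment X i).2 + (if (segment X i).1 then 1 else 0))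
      else (!(segment X i).1, (segment X i).2)

section Segment

variable {X : ℕ → Prop}

theorem segment_true {i : ℕ} (h : i = 0 ∨ X i) : (segment X i).1 = true := by
  rcases i with _ | i
  · rfl
  · have := h.resolve_left (by omega)
    simp [segment, this]

theorem segment_succ (i : ℕ) :
    ((segment X i).1 = false ∧ (segment X (i + 1)).1 = true ∧
      (segment X (i + 1)).2 = (segment X i).2) ∨
    ((segment X i).1 = true ∧ (segment X (i + 1)).1 = false ∧
      (segment X (i + 1)).2 = (segment X i).2) ∨
    ((segment X i).1 = true ∧ (segment X (i + 1)).1 = true ∧ X (i + 1) ∧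
      (segment X (i + 1)).2 = (segment X i).2 + 1) := by
  by_cases h : X (i + 1) <;> cases h' : (segment X i).1 <;> simp [segment, h, h']

theorem segment_mono {i j : ℕ} (h : i ≤ j) : (segment X i).2 ≤ (segment X j).2 := by
  induction h with
  | refl => rfl
  | @step m _ ih =>
    change _ ≤ (segment X (m + 1)).2
    rcases segment_succ (X := X) m with h | h | h <;> omega

/-- Each step changes exactly one of the two summands, and by one, so their sum follows the parity
of the position. -/
theorem segment_parity (i : ℕ) :
    ((segment X i).2 + (if (segment X i).1 then 0 else 1)) % 2 = i % 2 := by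
  induction i with
  | zero => rfl
  | succ i ih =>
    rcases segment_succ (X := X) i with ⟨h1, h2, h3⟩ | ⟨h1, h2, h3⟩ | ⟨h1, h2, -, h3⟩ <;>
      simp only [h1, h2, h3, if_true, if_false, Bool.false_eq_true] at ih ⊢ <;> omega

theorem segment_parity_of_mem {i : ℕ} (h : i = 0 ∨ X i) : (segment X i).2 % 2 = i % 2 := by
  have := segment_parity (X := X) i
  rwa [segment_true h] at this

/-- The witness is the first position of segment `j`. Unless it is 0, it is a mark, and its
predecessor belongs to segment `j - 1`. -/
theorem exists_segment_eq {n j : ℕ} (hj : j ≤ (segment X n).2) :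
    ∃ i ≤ n, (segment X i).2 = j ∧ (segment X i).1 = true ∧ (i = 0 ∨ X i) ∧
      (1 ≤ j → ∃ i', i = i' + 1 ∧ (segment X i').2 + 1 = j) := by
  induction n with
  | zero =>
    have : j = 0 := by simpa [segment] using hj
    exact ⟨0, le_rfl, this.symm ▸ rfl, rfl, .inl rfl, by omega⟩
  | succ n ih =>
    by_cases h : j ≤ (segment X n).2
    · obtain ⟨i, hi, h'⟩ := ih h
      exact ⟨i, by omega, h'⟩
    · rcases segment_succ (X := X) n with ⟨h1, h2, h3⟩ | ⟨h1, h2, h3⟩ | ⟨h1, h2, h4, h3⟩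
      · omega
      · omega
      · exact ⟨n + 1, le_rfl, by omega, h2, .inr h4, fun _ => ⟨n, rfl, by omega⟩⟩

end Segment

/-- A marked wheel with three disjoint odd arcs between marks contracts to an odd wheel. -/
theorem exists_tmodel_markedWheel {n : ℕ} {X : ℕ → Prop} (hn : Odd n) (h0 : X 0) {b c d : ℕ}
    (hb : X b) (hbo : Odd b) (hbc : b ≤ c) (hc : X c) (hd : X d) (hcd : Odd (d - c))
    (hdn : d < n) :
    ∃ k, 3 ≤ k ∧ Odd k ∧ ∃ φ A, TModel (wheelGraph k) (markedWheel n X) φ A := by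
  classical
  -- Position `n` is position 0 again, which is marked.
  let Y : ℕ → Prop := fun i => X i ∨ i = n
  have hYX : ∀ i, i < n → (Y i ↔ X i) := fun i hi => by simp only [Y]; constructor <;> grind
  set s := segment Y with hs
  obtain ⟨k, hk⟩ : ∃ k, k = (s n).2 := ⟨_, rfl⟩
  have hsn : (s n).1 = true := segment_true (.inr (.inr rfl))
  have hkodd : Odd k := by
    have := segment_parity_of_mem (X := Y) (i := n) (.inr (.inr rfl))
    rw [Nat.odd_iff] at hn ⊢
    rw [hk, hs, this, hn]
  -- At marks the index of the segment has the parity of the position. So it is at least 1 at `b`,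
  -- it grows between `c` and `d`, and its final value `k` is odd.
  have hk3 : 3 ≤ k := by
    have eb := segment_parity_of_mem (X := Y) (i := b) (.inr (.inl hb))
    have ec := segment_parity_of_mem (X := Y) (i := c) (.inr (.inl hc))
    have ed := segment_parity_of_mem (X := Y) (i := d) (.inr (.inl hd))
    rw [Nat.odd_iff] at hbo hcd hkodd
    have m1 := segment_mono (X := Y) hbc
    have m2 := segment_mono (X := Y) (show c ≤ d by omega)
    have m3 := segment_mono (X := Y) hdn.le
    rw [← hs] at *
    omega
  have hn0 : 0 < n := by omega
  have hkpos : 0 < k := by omega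
  -- The segment with index `k` contains position `n`, that is, position 0; the reduction modulo `k`
  -- identifies it with segment 0.
  let φ : Option (Fin n) → Option (Option (Fin k)) := fun v =>
    some (v.map fun i : Fin n => ⟨(s i).2 % k, Nat.mod_lt _ hkpos⟩)
  let vt : ℕ → Option (Fin n) := fun m => some ⟨m % n, Nat.mod_lt _ hn0⟩
  have hvt : ∀ m, m ≤ n → φ (vt m) = some (some ⟨(s m).2 % k, Nat.mod_lt _ hkpos⟩) := by
    intro m hm
    rcases hm.lt_or_eq with hm | rfl
    · simp [φ, vt, Nat.mod_eq_of_lt hm]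
    · simp [φ, vt, hs, segment, hk]
  have hcls : ∀ m, m ≤ n → (s (m % n)).1 = (s m).1 := by
    intro m hm
    rcases hm.lt_or_eq with hm | rfl
    · rw [Nat.mod_eq_of_lt hm]
    · rw [Nat.mod_self, hsn]; rfl
  have hXv : ∀ m, m ≤ n → (m = 0 ∨ Y m) → X (m % n) := by
    intro m hm h
    rcases hm.lt_or_eq with hm | rfl
    · rw [Nat.mod_eq_of_lt hm]
      rcases h with rfl | h
      · exact h0
      · exact (hYX m hm).1 h
    · rwa [Nat.mod_self]
  have hn3 : 3 ≤ n := by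
    rcases hbo with ⟨x, hx⟩; rcases hcd with ⟨y, hy⟩; rcases hn with ⟨z, hz⟩; omega
  have hvadj : ∀ m, m < n → (markedWheel n X).Adj (vt m) (vt (m + 1)) := by
    intro m hm
    refine ⟨?_, .inl ?_⟩
    · rw [Ne, Fin.ext_iff]
      simp only [Nat.mod_eq_of_lt hm]
      rcases (show m + 1 ≤ n by omega).lt_or_eq with h | h
      · rw [Nat.mod_eq_of_lt h]; omega
      · rw [h, Nat.mod_self]; omega
    · simp only [Nat.mod_eq_of_lt hm]
  have hvsurj : ∀ i : Fin n, some i = vt i := by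
    intro i
    simp only [vt, Nat.mod_eq_of_lt i.isLt]
  have hvadj' : ∀ i j : Fin n, (markedWheel n X).Adj (some i) (some j) →
      ∃ m < n, (some i = vt m ∧ some j = vt (m + 1)) ∨ (some j = vt m ∧ some i = vt (m + 1)) := by
    rintro i j ⟨-, h | h⟩
    · exact ⟨i, i.isLt, .inl ⟨hvsurj i, by simp only [vt, Option.some_inj, Fin.ext_iff]; exact h⟩⟩
    · exact ⟨j, j.isLt, .inr ⟨hvsurj j, by simp only [vt, Option.some_inj, Fin.ext_iff]; exact h⟩⟩
  have hle : ∀ m, m ≤ n → (s m).2 ≤ k := fun m hm => hk ▸ segment_mono (X := Y) hm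
  have hmodk : ∀ t, t ≤ k → t % k = if t = k then 0 else t := by
    intro t ht
    split_ifs with h
    · rw [h, Nat.mod_self]
    · exact Nat.mod_eq_of_lt (by omega)
  -- The centres are the rim positions of class `false`. They are unmarked, and their two neighbours
  -- on the rim have class `true` and lie in the same segment.
  refine ⟨k, hk3, hkodd, φ, {v | ∃ i : Fin n, v = some i ∧ (s i).1 = false}, ?_, ?_, ?_, ?_, ?_⟩
  · rintro (_ | j)
    · exact ⟨none, rfl, by rintro ⟨i, h, -⟩; simp at h⟩
    · obtain ⟨i, hi, h1, h2, -⟩ := exists_segment_eq (X := Y) (n := n) (j := j) (by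
        have := j.isLt; rw [← hs]; omega)
      refine ⟨vt i, ?_, ?_⟩
      · rw [hvt i hi]
        simp only [Option.some_inj, Fin.ext_iff]
        rw [hs, h1, Nat.mod_eq_of_lt j.isLt]
      · rintro ⟨i', h, h'⟩
        simp only [vt, Option.some_inj] at h
        rw [← h] at h'
        simp only at h'
        rw [hcls i hi, hs, h2] at h'
        exact absurd h' (by simp)
  · intro w P hu hstep
    have hstep' : ∀ a b, (markedWheel n X).Adj a b → φ a = some w → φ b = some w →
        (P a ↔ P b) := fun a b hab ha hb =>
      ⟨hstep a b hab ha hb, hstep b a hab.symm hb ha⟩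
    obtain ⟨u, hu, hPu⟩ := hu
    rcases w with _ | w
    · intro v hv
      have e1 : u = none := by
        simpa [φ] using hu
      have e2 : v = none := by
        simpa [φ] using hv
      rwa [e2, ← e1]
    have chain : ∀ d m, m + d ≤ n → (s m).2 % k = w → (s (m + d)).2 = (s m).2 →
        (P (vt m) ↔ P (vt (m + d))) := by
      intro d
      induction d with
      | zero => intro m _ _ _; rfl
      | succ d ih =>
        intro m hm hw he
        have m1 := segment_mono (X := Y) (show m ≤ m + d by omega)
        have m2 := segment_mono (X := Y) (show m + d ≤ m + (d + 1) by omega)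
        rw [← hs] at m1 m2
        have e : (s (m + d)).2 = (s m).2 := by omega
        rw [ih m (by omega) hw e]
        apply hstep'
        · exact hvadj (m + d) (by omega)
        · rw [hvt _ (by omega)]; simp only [Option.some_inj, Fin.ext_iff]; rw [e, hw]
        · rw [hvt _ (by omega)]; simp only [Option.some_inj, Fin.ext_iff]; rw [he, hw]
    have chain' : ∀ m m', m ≤ n → m' ≤ n → (s m).2 % k = w → (s m').2 = (s m).2 →
        (P (vt m) ↔ P (vt m')) := by
      intro m m' hm hm' hw he
      rcases le_total m m' with h | h
      · obtain ⟨d, rfl⟩ := Nat.exists_eq_add_of_le h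
        exact chain d m hm' hw he
      · obtain ⟨d, rfl⟩ := Nat.exists_eq_add_of_le h
        exact (chain d m' hm (by rw [he, hw]) he.symm).symm
    have hvt0 : vt n = vt 0 := by simp [vt]
    have hs0 : (s 0).2 = 0 := rfl
    have chain0 : ∀ m, m ≤ n → (s m).2 % k = w → w.val = 0 → (P (vt m) ↔ P (vt 0)) := by
      intro m hm hw hw0
      have h1 := hmodk _ (hle m hm)
      split_ifs at h1 with h2
      · rw [← hvt0]
        exact chain' m n hm le_rfl hw (by omega)
      · exact chain' m 0 hm (by omega) hw (by omega)
    intro v hv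
    obtain ⟨m, hm, rfl⟩ : ∃ m < n, v = vt m := by
      rcases v with _ | i
      · simp [φ] at hv
      · exact ⟨i, i.isLt, hvsurj i⟩
    obtain ⟨m', hm', rfl⟩ : ∃ m < n, u = vt m := by
      rcases u with _ | i
      · simp [φ] at hu
      · exact ⟨i, i.isLt, hvsurj i⟩
    rw [hvt _ hm.le] at hv
    rw [hvt _ hm'.le] at hu
    simp only [Option.some_inj, Fin.ext_iff] at hv hu
    by_cases hw0 : w.val = 0
    · rw [chain0 m hm.le hv hw0]
      rwa [chain0 m' hm'.le hu hw0] at hPu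
    · have h1 := hmodk _ (hle m hm.le)
      have h2 := hmodk _ (hle m' hm'.le)
      rw [hv] at h1
      rw [hu] at h2
      split_ifs at h1 h2
      all_goals first | omega | skip
      rwa [chain' m' m hm'.le hm.le hu (by omega)] at hPu
  · rintro v ⟨i, rfl, hi⟩ w hw u huv -
    have hiX : ¬ X i := by
      intro h
      have := segment_true (X := Y) (i := i) (.inr (.inl h))
      rw [← hs, hi] at this
      simp at this
    rcases u with _ | j
    · exact absurd huv hiX
    · rw [← hw]
      obtain ⟨m, hm, ⟨h1, h2⟩ | ⟨h1, h2⟩⟩ := hvadj' j i huv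
      · -- the predecessor of a position of class `A`
        have hiv : (s (m + 1)).1 = false := by
          rw [← hcls _ (by omega)]
          simp only [vt, Option.some_inj] at h2
          rw [h2] at hi; exact hi
        rw [h1, h2, hvt _ hm.le, hvt _ (by omega)]
        rcases segment_succ (X := Y) m with ⟨g1, g2, g3⟩ | ⟨g1, g2, g3⟩ | ⟨g1, g2, -, g3⟩
        · rw [← hs, hiv] at g2; simp at g2
        · refine ⟨by rw [← hs] at g3; simp only [g3], ?_⟩
          rintro ⟨j', hj', hj''⟩
          simp only [vt, Option.some_inj] at hj'
          rw [← hj'] at hj''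
          simp only at hj''
          rw [hcls m hm.le, hs, g1] at hj''
          simp at hj''
        · rw [← hs, hiv] at g2; simp at g2
      · have hiv : (s m).1 = false := by
          rw [← hcls _ (by omega)]
          simp only [vt, Option.some_inj] at h1
          rw [h1] at hi; exact hi
        rw [h1, h2, hvt _ hm.le, hvt _ (by omega)]
        rcases segment_succ (X := Y) m with ⟨g1, g2, g3⟩ | ⟨g1, g2, g3⟩ | ⟨g1, g2, -, g3⟩
        · refine ⟨by rw [← hs] at g3; simp only [g3], ?_⟩
          rintro ⟨j', hj', hj''⟩
          simp only [vt, Option.some_inj] at hj'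
          rw [← hj'] at hj''
          simp only at hj''
          rw [hcls (m + 1) (by omega), hs, g2] at hj''
          simp at hj''
        · rw [← hs, hiv] at g1; simp at g1
        · rw [← hs, hiv] at g1; simp at g1
  · have aux : ∀ m, m < n → vt m ∉ {v | ∃ i : Fin n, v = some i ∧ (s i).1 = false} →
        vt (m + 1) ∉ {v | ∃ i : Fin n, v = some i ∧ (s i).1 = false} →
        φ (vt m) ≠ φ (vt (m + 1)) := by
      intro m hm h1 h2
      have h1' : (s m).1 = true := by
        by_contra hc
        exact h1 ⟨_, rfl, by simpa [hcls m hm.le] using hc⟩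
      have h2' : (s (m + 1)).1 = true := by
        by_contra hc
        exact h2 ⟨_, rfl, by simpa [hcls (m + 1) hm] using hc⟩
      rw [hvt _ hm.le, hvt _ (by omega)]
      rcases segment_succ (X := Y) m with ⟨g1, g2, g3⟩ | ⟨g1, g2, g3⟩ | ⟨g1, g2, -, g3⟩
      · rw [← hs, h1'] at g1; simp at g1
      · rw [← hs, h2'] at g2; simp at g2
      · simp only [ne_eq, Option.some_inj, Fin.ext_iff]
        rw [← hs] at g3
        have l1 := hle (m + 1) (by omega)
        rw [g3] at l1 ⊢
        rw [hmodk _ (by omega), hmodk _ l1]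
        split_ifs <;> omega
    intro u v w hu hv h1 h2 huv
    rcases u with _ | i <;> rcases v with _ | j
    · exact huv
    · simp [φ, ← h1] at h2
    · simp [φ, ← h1] at h2
    · obtain ⟨m, hm, ⟨g1, g2⟩ | ⟨g1, g2⟩⟩ := hvadj' i j huv
      · rw [g1] at hu h1
        rw [g2] at hv h2
        exact aux m hm hu hv (h1.trans h2.symm)
      · rw [g1] at hv h2
        rw [g2] at hu h1
        exact aux m hm hv hu (h2.trans h1.symm)
  · have hubrim : ∀ j : Fin k, ∃ v, (markedWheel n X).Adj none v ∧ φ v = some (some j) := by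
      intro j
      obtain ⟨i, hi, h1, h2, h3, -⟩ := exists_segment_eq (X := Y) (n := n) (j := j) (by
        have := j.isLt; rw [← hs]; omega)
      refine ⟨vt i, hXv i hi h3, ?_⟩
      rw [hvt i hi]
      simp only [Option.some_inj, Fin.ext_iff]
      rw [hs, h1, Nat.mod_eq_of_lt j.isLt]
    have step : ∀ j : ℕ, ∀ hj : j < k, ∃ m < n,
        φ (vt m) = some (some ⟨j, hj⟩) ∧
        φ (vt (m + 1)) = some (some ⟨(j + 1) % k, Nat.mod_lt _ hkpos⟩) := by
      intro j hj
      obtain ⟨i, hi, h1, h2, -, h3⟩ := exists_segment_eq (X := Y) (n := n) (j := j + 1) (by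
        rw [← hs]; omega)
      obtain ⟨i', rfl, hi'⟩ := h3 (by omega)
      refine ⟨i', by omega, ?_, ?_⟩
      · rw [hvt i' (by omega)]
        simp only [Option.some_inj, Fin.ext_iff]
        rw [← hs] at hi'
        rw [show (s i').2 = j by omega, Nat.mod_eq_of_lt hj]
      · rw [hvt _ hi]
        simp only [Option.some_inj, Fin.ext_iff]
        rw [hs, h1]
    have step' : ∀ m < n, ∀ a b : Fin k, a ≠ b → φ (vt m) = some (some a) →
        φ (vt (m + 1)) = some (some b) → b.val = (a.val + 1) % k := by
      intro m hm a b hab h1 h2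
      rw [hvt _ (by omega)] at h1 h2
      simp only [Option.some_inj, Fin.ext_iff] at h1 h2
      rw [← h1, ← h2]
      rcases segment_succ (X := Y) m with ⟨g1, g2, g3⟩ | ⟨g1, g2, g3⟩ | ⟨g1, g2, -, g3⟩
      · rw [← hs] at g3; rw [g3, h1] at h2; exact absurd (Fin.ext h2) hab
      · rw [← hs] at g3; rw [g3, h1] at h2; exact absurd (Fin.ext h2) hab
      · rw [← hs] at g3; rw [g3]; simp
    rintro (_ | a) (_ | b) hne
    · exact absurd rfl hne
    · refine iff_of_true trivial ?_
      obtain ⟨v, h1, h2⟩ := hubrim b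
      exact ⟨none, v, h1, rfl, h2⟩
    · refine iff_of_true trivial ?_
      obtain ⟨v, h1, h2⟩ := hubrim a
      exact ⟨v, none, h1.symm, h2, rfl⟩
    · have hab : a ≠ b := fun e => hne (by rw [e])
      change (cycleGraph k).Adj a b ↔ _
      rw [cycleGraph_adj_iff_mod (by omega)]
      constructor
      · rintro (h | h)
        · obtain ⟨m, hm, g1, g2⟩ := step a a.isLt
          refine ⟨_, _, hvadj m hm, g1, g2.trans ?_⟩
          simp only [Option.some_inj, Fin.ext_iff]; exact h.symm
        · obtain ⟨m, hm, g1, g2⟩ := step b b.isLt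
          refine ⟨_, _, (hvadj m hm).symm, g2.trans ?_, g1⟩
          simp only [Option.some_inj, Fin.ext_iff]; exact h.symm
      · rintro ⟨u, v, huv, hu, hv⟩
        rcases u with _ | i
        · simp [φ] at hu
        rcases v with _ | j
        · simp [φ] at hv
        obtain ⟨m, hm, ⟨g1, g2⟩ | ⟨g1, g2⟩⟩ := hvadj' i j huv
        · rw [g1] at hu; rw [g2] at hv
          exact .inl (step' m hm a b hab hu hv)
        · rw [g1] at hv; rw [g2] at hu
          exact .inr (step' m hm b a hab.symm hv hu)

end SimpleGraph
-- Odd wheels from an odd rim and a bipartite hub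
namespace SimpleGraph

/-- Some odd wheel is a t-minor of `G`. -/
def HasOddWheel {V : Type u} (G : SimpleGraph V) : Prop :=
  ∃ (W : Type u) (H : SimpleGraph W), H.IsOddWheel ∧ H.IsTMinor G

theorem TModel.congr {W W' V V' : Type*} {H : SimpleGraph W} {H' : SimpleGraph W'}
    {G : SimpleGraph V} {G' : SimpleGraph V'} {φ : V → Option W} {A : Set V}
    (h : TModel H G φ A) (e : H ≃g H') (f : G ≃g G') :
    TModel H' G' (fun v => (φ (f.symm v)).map e) {v | f.symm v ∈ A} := by
  have key : ∀ v w, (φ (f.symm v)).map e = some w ↔ φ (f.symm v) = some (e.symm w) := by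
    intro v w
    rw [Option.map_eq_some_iff]
    constructor
    · rintro ⟨a, h1, rfl⟩
      simpa using h1
    · intro h1
      exact ⟨_, h1, by simp⟩
  refine ⟨?_, ?_, ?_, ?_, ?_⟩
  · intro w
    obtain ⟨v, hv, hA⟩ := h.surj (e.symm w)
    exact ⟨f v, by rw [key]; simpa using hv, by simpa using hA⟩
  · rintro w P ⟨u, hu, hP⟩ hstep v hv
    rw [key] at hu hv
    have := h.conn (e.symm w) (fun x => P (f x)) ⟨_, hu, by simpa using hP⟩
      (fun a b hab ha hb => hstep _ _ (f.map_adj_iff.2 hab) (by rw [key]; simpa using ha)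
        (by rw [key]; simpa using hb)) _ hv
    simpa using this
  · intro v hv w hw u huv hu
    rw [key] at hw ⊢
    exact h.closed _ hv _ hw _ (f.symm.map_adj_iff.2 huv) (by simpa using hu)
  · intro u v w hu hv h1 h2 huv
    rw [key] at h1 h2
    exact h.stable _ _ _ hu hv h1 h2 (f.symm.map_adj_iff.2 huv)
  · intro w w' hne
    rw [← e.symm.map_adj_iff, h.adj _ _ (fun h => hne (e.symm.injective h))]
    constructor
    · rintro ⟨u, v, huv, hu, hv⟩
      exact ⟨f u, f v, f.map_adj_iff.2 huv, by rw [key]; simpa using hu,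
        by rw [key]; simpa using hv⟩
    · rintro ⟨u, v, huv, hu, hv⟩
      rw [key] at hu hv
      exact ⟨_, _, f.symm.map_adj_iff.2 huv, hu, hv⟩

/-- A t-minor model given by its branch sets. -/
theorem exists_tmodel {W V : Type*} {H : SimpleGraph W} {G : SimpleGraph V} (F : W → Set V)
    (A : Set V) (disj : ∀ w w' v, v ∈ F w → v ∈ F w' → w = w')
    (surj : ∀ w, ∃ v ∈ F w, v ∉ A)
    (conn : ∀ w (P : V → Prop), (∃ u ∈ F w, P u) →
      (∀ a b, G.Adj a b → a ∈ F w → b ∈ F w → P a → P b) → ∀ v ∈ F w, P v)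
    (closed : ∀ v ∈ A, ∀ w, v ∈ F w → ∀ u, G.Adj u v → (∃ w', u ∈ F w') → u ∈ F w ∧ u ∉ A)
    (stable : ∀ u v w, u ∉ A → v ∉ A → u ∈ F w → v ∈ F w → ¬ G.Adj u v)
    (adj : ∀ w w', w ≠ w' → (H.Adj w w' ↔ ∃ u v, G.Adj u v ∧ u ∈ F w ∧ v ∈ F w')) :
    ∃ φ, TModel H G φ A := by
  classical
  let φ : V → Option W := fun v => if h : ∃ w, v ∈ F w then some h.choose else none
  have key : ∀ v w, φ v = some w ↔ v ∈ F w := by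
    intro v w
    constructor
    · intro h
      by_cases hv : ∃ w, v ∈ F w
      · simp only [φ, dif_pos hv, Option.some_inj] at h
        exact h ▸ hv.choose_spec
      · simp only [φ, dif_neg hv] at h
        simp at h
    · intro h
      have hv : ∃ w, v ∈ F w := ⟨w, h⟩
      simp only [φ, dif_pos hv, Option.some_inj]
      exact disj _ _ _ hv.choose_spec h
  refine ⟨φ, ⟨?_, ?_, ?_, ?_, ?_⟩⟩
  · simpa only [key] using surj
  · simpa only [key] using conn
  · simpa only [key, Option.ne_none_iff_exists'] using closed
  · simpa only [key] using stable
  · simpa only [key] using adj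

variable {V : Type u} {G : SimpleGraph V}

theorem hasOddWheel_of_markedWheel [Finite V] {n : ℕ} {X : ℕ → Prop}
    (h : ∃ φ A, TModel (markedWheel n X) G φ A)
    (hn : Odd n) (h0 : X 0) {b c d : ℕ}
    (hb : X b) (hbo : Odd b) (hbc : b ≤ c) (hc : X c) (hd : X d) (hcd : Odd (d - c))
    (hdn : d < n) : HasOddWheel G := by
  obtain ⟨k, hk, hk', φ, A, hφ⟩ := exists_tmodel_markedWheel hn h0 hb hbo hbc hc hd hcd hdn
  obtain ⟨ψ, B, hψ⟩ := h
  -- `IsTMinor` compares graphs of one universe, so the wheel and the marked wheel are lifted to the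
  -- universe of `G`.
  let e : (wheelGraph k).comap (Equiv.ulift.{u} : ULift (Option (Fin k)) ≃ _) ≃g wheelGraph k :=
    Iso.comap _ _
  let f : (markedWheel n X).comap (Equiv.ulift.{u} : ULift (Option (Fin n)) ≃ _) ≃g
    markedWheel n X := Iso.comap _ _
  exact ⟨_, _, ⟨k, hk, hk', ⟨e⟩⟩,
    (hφ.congr e.symm f.symm).isTMinor.trans (hψ.congr f.symm (Iso.refl)).isTMinor⟩

/-- `S` induces a connected subgraph of `G` or is empty. -/
def ConnOn (G : SimpleGraph V) (S : Set V) : Prop :=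
  ∀ P : V → Prop, (∃ u ∈ S, P u) → (∀ a b, G.Adj a b → a ∈ S → b ∈ S → P a → P b) →
    ∀ v ∈ S, P v

/-- `S` is a stable set of `G`. -/
def StableOn (G : SimpleGraph V) (S : Set V) : Prop := ∀ u ∈ S, ∀ v ∈ S, ¬ G.Adj u v

/-- The rim vertices form singleton branch sets, and `A ∪ B` is the branch set of the hub. The
vertices of `A` may be centres because the rim sees the hub in `B` only. -/
theorem exists_tmodel_hub {l : List V} (hl : IndCyc G l) {A B : Set V}
    (hAB : ∀ v ∈ A, v ∉ B) (hT : ConnOn G (A ∪ B)) (hA : StableOn G A) (hB : StableOn G B)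
    (hBne : B.Nonempty)
    (hAl : ∀ v ∈ l, v ∉ A ∧ v ∉ B ∧ ∀ a ∈ A, ¬ G.Adj v a) :
    ∃ φ A, TModel (markedWheel l.length
      (fun i => ∃ h : i < l.length, ∃ b ∈ B, G.Adj l[i] b)) G φ A := by
  have hlT : ∀ (i : ℕ) (h : i < l.length), l[i] ∉ A ∪ B := by
    rintro i h (h' | h')
    · exact (hAl _ (List.getElem_mem h)).1 h'
    · exact (hAl _ (List.getElem_mem h)).2.1 h'
  let F : Option (Fin l.length) → Set V := fun w => w.elim (A ∪ B) (fun i => {l[i]})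
  have hinj := hl.nodup
  have hadj : ∀ i j : Fin l.length, i ≠ j → (G.Adj l[i] l[j] ↔
      (j.val = (i.val + 1) % l.length ∨ i.val = (j.val + 1) % l.length)) := by
    have aux : ∀ i j : Fin l.length, i < j → (G.Adj l[i] l[j] ↔
      (j.val = (i.val + 1) % l.length ∨ i.val = (j.val + 1) % l.length)) := by
      intro i j hij
      have := (hl.getElem hij j.isLt).2
      have hj := j.isLt
      have h3 := hl.three_le
      simp only [Fin.getElem_fin]
      rw [this]
      have hij' : i.val < j.val := hij
      rw [Nat.mod_eq_of_lt (show i.val + 1 < l.length by omega)]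
      by_cases hjl : j.val + 1 = l.length
      · rw [hjl, Nat.mod_self]; omega
      · rw [Nat.mod_eq_of_lt (show j.val + 1 < l.length by omega)]; omega
    intro i j hij
    rcases lt_or_gt_of_ne hij with h | h
    · exact aux i j h
    · rw [G.adj_comm, aux j i h, or_comm]
  suffices h : ∃ φ, TModel (markedWheel l.length
      (fun i => ∃ h : i < l.length, ∃ b ∈ B, G.Adj l[i] b)) G φ A by
    obtain ⟨φ, h⟩ := h
    exact ⟨φ, A, h⟩
  refine exists_tmodel F A ?_ ?_ ?_ ?_ ?_ ?_
  · rintro (_ | i) (_ | j) v h1 h2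
    · rfl
    · rw [show v = l[j] from h2] at h1; exact absurd h1 (hlT _ _)
    · rw [show v = l[i] from h1] at h2; exact absurd h2 (hlT _ _)
    · have e : l[i] = l[j] := (show v = l[i] from h1).symm.trans h2
      rw [Fin.getElem_fin, Fin.getElem_fin, hinj.getElem_inj_iff] at e
      rw [Fin.ext e]
  · rintro (_ | i)
    · obtain ⟨b, hb⟩ := hBne
      exact ⟨b, .inr hb, fun h => hAB b h hb⟩
    · exact ⟨l[i], rfl, (hAl _ (List.getElem_mem _)).1⟩
  · rintro (_ | i) P hu hstep v hv
    · exact hT P hu (fun a b hab ha hb => hstep a b hab ha hb) v hv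
    · obtain ⟨u, hu, hP⟩ := hu
      rw [show u = l[i] from hu] at hP
      rwa [show v = l[i] from hv]
  · rintro v hv w hw u huv ⟨w', hu⟩
    have hw0 : w = none := by
      rcases w with _ | i
      · rfl
      · rw [show v = l[i] from hw] at hv
        exact absurd hv (hAl _ (List.getElem_mem _)).1
    subst hw0
    have huA : u ∉ A := fun h => hA u h v hv huv
    rcases w' with _ | j
    · exact ⟨hu, huA⟩
    · rw [show u = l[j] from hu] at huv
      exact absurd huv ((hAl _ (List.getElem_mem _)).2.2 v hv)
  · rintro u v (_ | i) hu hv h1 h2 huv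
    · exact hB u (h1.resolve_left hu) v (h2.resolve_left hv) huv
    · rw [show u = l[i] from h1, show v = l[i] from h2] at huv
      exact G.irrefl huv
  · have hub : ∀ i : Fin l.length, (∃ h : i.val < l.length, ∃ b ∈ B, G.Adj l[i] b) ↔
        ∃ u v, G.Adj u v ∧ u ∈ F none ∧ v ∈ F (some i) := by
      intro i
      constructor
      · rintro ⟨h, b, hb, hib⟩
        exact ⟨b, l[i], hib.symm, .inr hb, rfl⟩
      · rintro ⟨u, v, huv, hu, hv⟩
        rw [show v = l[i] from hv] at huv
        refine ⟨i.isLt, u, hu.resolve_left fun h => ?_, huv.symm⟩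
        exact (hAl _ (List.getElem_mem _)).2.2 u h huv.symm
    rintro (_ | i) (_ | j) hne
    · exact absurd rfl hne
    · exact hub j
    · refine (hub i).trans ⟨?_, ?_⟩
      · rintro ⟨u, v, huv, hu, hv⟩; exact ⟨v, u, huv.symm, hv, hu⟩
      · rintro ⟨u, v, huv, hu, hv⟩; exact ⟨v, u, huv.symm, hv, hu⟩
    · have hij : i ≠ j := fun e => hne (by rw [e])
      change (i ≠ j ∧ _) ↔ _
      rw [← hadj i j hij]
      constructor
      · rintro ⟨-, h⟩
        exact ⟨_, _, h, rfl, rfl⟩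
      · rintro ⟨u, v, huv, hu, hv⟩
        rw [show u = l[i] from hu, show v = l[j] from hv] at huv
        exact ⟨hij, huv⟩

/-- An odd induced cycle and a connected bipartite hub that meets it at the ends of two disjoint odd
arcs give an odd wheel. -/
theorem hasOddWheel_of_hub [Finite V] {l : List V} (hl : IndCyc G l) (hodd : Odd l.length)
    {A B : Set V}
    (hAB : ∀ v ∈ A, v ∉ B) (hT : ConnOn G (A ∪ B)) (hA : StableOn G A) (hB : StableOn G B)
    (hAl : ∀ v ∈ l, v ∉ A ∧ v ∉ B ∧ ∀ a ∈ A, ¬ G.Adj v a) {a b c d : ℕ}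
    (hab : Odd (b - a)) (hbc : b ≤ c) (hcd : Odd (d - c)) (hd : d < l.length)
    (h1 : ∃ x ∈ B, G.Adj (l[a]'(by have := hab.pos; have := hcd.pos; omega)) x)
    (h2 : ∃ x ∈ B, G.Adj (l[b]'(by have := hab.pos; have := hcd.pos; omega)) x)
    (h3 : ∃ x ∈ B, G.Adj (l[c]'(by have := hab.pos; have := hcd.pos; omega)) x)
    (h4 : ∃ x ∈ B, G.Adj l[d] x) : HasOddWheel G := by
  have hp1 := hab.pos
  have hp2 := hcd.pos
  -- The rim is rotated so that the contact at position `a` comes to position 0.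
  have hl' : IndCyc G (l.drop a ++ l.take a) := by
    apply IndCyc.rotate
    rwa [List.take_append_drop]
  have hlen : (l.drop a ++ l.take a).length = l.length := by
    simp; omega
  have hget : ∀ i, a ≤ i → ∀ hi : i < l.length,
      (l.drop a ++ l.take a)[i - a]'(by omega) = l[i] := by
    intro i hai hi
    rw [List.getElem_append_left (by simp; omega), List.getElem_drop]
    congr 1; omega
  have hne : B.Nonempty := by
    obtain ⟨x, hx, -⟩ := h4
    exact ⟨x, hx⟩
  have := exists_tmodel_hub hl' hAB hT hA hB hne (by
    intro v hv
    refine hAl v ?_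
    rw [List.mem_append] at hv
    rcases hv with hv | hv
    · exact List.mem_of_mem_drop hv
    · exact List.mem_of_mem_take hv)
  have hX : ∀ i, a ≤ i → ∀ hi : i < l.length, (∃ x ∈ B, G.Adj l[i] x) →
      ∃ h : i - a < (l.drop a ++ l.take a).length,
        ∃ b ∈ B, G.Adj (l.drop a ++ l.take a)[i - a] b := by
    intro i hai hi h
    exact ⟨by omega, by rwa [hget i hai hi]⟩
  refine hasOddWheel_of_markedWheel this (by rwa [hlen]) (b := b - a) (c := c - a) (d := d - a)
    ?_ (hX b (by omega) (by omega) h2) hab (by omega) (hX c (by omega) (by omega) h3)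
    (hX d (by omega) (by omega) h4) (by rwa [show d - a - (c - a) = d - c by omega]) (by omega)
  simpa using hX a le_rfl (by omega) h1

/-- The hub meets every vertex of an odd induced cycle. -/
theorem hasOddWheel_of_dominating_hub [Finite V] {l : List V} (hl : IndCyc G l)
    (hodd : Odd l.length) {A B : Set V}
    (hAB : ∀ v ∈ A, v ∉ B) (hT : ConnOn G (A ∪ B)) (hA : StableOn G A) (hB : StableOn G B)
    (hAl : ∀ v ∈ l, v ∉ A ∧ v ∉ B ∧ ∀ a ∈ A, ¬ G.Adj v a)
    (h : ∀ v ∈ l, ∃ x ∈ B, G.Adj v x) : HasOddWheel G := by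
  have := hl.three_le
  -- All rim vertices are contacts, so two consecutive edges serve as the odd arcs.
  exact hasOddWheel_of_hub hl hodd hAB hT hA hB hAl (a := 0) (b := 1) (c := 1) (d := 2)
    (by decide) le_rfl (by decide) (by omega) (h _ (List.getElem_mem _)) (h _ (List.getElem_mem _))
    (h _ (List.getElem_mem _)) (h _ (List.getElem_mem _))

/-- As `hasOddWheel_of_hub`, for a rim vertex `p` at which the rim and the hub are joined by a
contraction: `p` and its neighbours `g`, `h` on the rim and `q` off the rim become one vertex of
the contracted rim, which sees the hub through `q`. -/
theorem hasOddWheel_of_switch [Finite V] {p g h q : V} {mid : List V}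
    (hl : IndCyc G (p :: g :: (mid ++ [h]))) (hodd : Even mid.length) {A B : Set V}
    (hAB : ∀ v ∈ A, v ∉ B) (hT : ConnOn G (A ∪ B)) (hA : StableOn G A) (hB : StableOn G B)
    (hAl : ∀ v ∈ p :: g :: (mid ++ [h]), v ∉ A ∧ v ∉ B ∧ v ≠ q ∧ ∀ a ∈ A, ¬ G.Adj v a)
    (hqA : q ∉ A ∧ q ∉ B ∧ ∀ a ∈ A, ¬ G.Adj q a) (hqB : ∃ x ∈ B, G.Adj q x)
    (hpq : G.Adj p q) (hql : ∀ v ∈ g :: (mid ++ [h]), ¬ G.Adj q v)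
    (hpB : ∀ x ∈ B, ¬ G.Adj p x) {b d : ℕ}
    (hb : Odd (b + 1)) (hbd : Odd (d - b)) (hd : d < mid.length)
    (h1 : ∃ x ∈ B, G.Adj (mid[b]'(by have := hbd.pos; omega)) x)
    (h2 : ∃ x ∈ B, G.Adj mid[d] x) : HasOddWheel G := by
  have hbp := hbd.pos
  -- the contracted rim
  set n := mid.length + 1 with hn
  obtain ⟨L, hLdef⟩ : ∃ L, L = p :: g :: (mid ++ [h]) := ⟨_, rfl⟩
  rw [← hLdef] at hl hAl
  have hLlen : L.length = mid.length + 3 := by simp [hLdef]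
  have hmidL : ∀ i, ∀ hi : i < mid.length, L[i + 2] = mid[i] := by
    intro i hi
    simp only [hLdef, List.getElem_cons_succ]
    rw [List.getElem_append_left hi]
  have hLg : L[1] = g := by simp [hLdef]
  have hLh : L[mid.length + 2] = h := by
    simp [hLdef]
  have hLp : L[0] = p := by simp [hLdef]
  have hnd := hl.nodup
  -- The star of `p` becomes vertex 0 of the new rim, and `mid[j]` becomes vertex `j + 1`. The new
  -- rim is odd because `mid.length` is even.
  let Z : Set V := {v | v = p ∨ v = g ∨ v = h ∨ v = q}
  let F : Option (Fin n) → Set V := fun w => w.elim (A ∪ B)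
    (fun i => {v | (i.val = 0 ∧ v ∈ Z) ∨ ∃ j, ∃ hj : j < mid.length, i.val = j + 1 ∧ v = mid[j]})
  have hZL : ∀ v ∈ Z, v ∉ A ∪ B := by
    have hm : ∀ v ∈ L, v ∉ A ∪ B := by
      rintro v hv (h' | h')
      · exact (hAl _ hv).1 h'
      · exact (hAl _ hv).2.1 h'
    rintro v (rfl | rfl | rfl | rfl)
    · exact hm _ (by simp [hLdef])
    · exact hm _ (by simp [hLdef])
    · exact hm _ (by simp [hLdef])
    · rintro (h' | h')
      · exact hqA.1 h'
      · exact hqA.2.1 h'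
  have hmm : ∀ j, ∀ hj : j < mid.length, mid[j] ∈ L := by
    intro j hj
    rw [← hmidL j hj]; exact List.getElem_mem _
  have hmT : ∀ j, ∀ hj : j < mid.length, mid[j] ∉ A ∪ B := by
    rintro j hj (h' | h')
    · exact (hAl _ (hmm j hj)).1 h'
    · exact (hAl _ (hmm j hj)).2.1 h'
  have hmZ : ∀ j, ∀ hj : j < mid.length, mid[j] ∉ Z := by
    rintro j hj (h' | h' | h' | h')
    · rw [← hLp, ← hmidL j hj, hnd.getElem_inj_iff] at h'; omega
    · rw [← hLg, ← hmidL j hj, hnd.getElem_inj_iff] at h'; omega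
    · rw [← hLh, ← hmidL j hj, hnd.getElem_inj_iff] at h'; omega
    · exact (hAl _ (hmm j hj)).2.2.1 h'
  have hFT : ∀ i v, v ∈ F (some i) → v ∉ A ∪ B := by
    rintro i v (⟨-, hv⟩ | ⟨j, hj, -, rfl⟩)
    · exact hZL v hv
    · exact hmT j hj
  have hmadj : ∀ i j, ∀ hi : i < mid.length, ∀ hj : j < mid.length, G.Adj mid[i] mid[j] →
      j = i + 1 ∨ i = j + 1 := by
    intro i j hi hj hij
    rw [← hmidL i hi, ← hmidL j hj] at hij
    rcases lt_trichotomy i j with h' | h' | h'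
    · rw [(hl.getElem (show i + 2 < j + 2 by omega) (by omega)).2] at hij; omega
    · subst h'; exact absurd hij G.irrefl
    · rw [G.adj_comm, (hl.getElem (show j + 2 < i + 2 by omega) (by omega)).2] at hij; omega
  have hzadj : ∀ z ∈ Z, ∀ j, ∀ hj : j < mid.length, G.Adj z mid[j] →
      (z = g ∧ j = 0) ∨ (z = h ∧ j + 1 = mid.length) := by
    rintro z (rfl | rfl | rfl | rfl) j hj hzj
    · rw [← hLp, ← hmidL j hj, (hl.getElem (show 0 < j + 2 by omega) (by omega)).2] at hzj
      omega
    · rw [← hLg, ← hmidL j hj, (hl.getElem (show 1 < j + 2 by omega) (by omega)).2] at hzj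
      exact .inl ⟨rfl, by omega⟩
    · rw [← hLh, ← hmidL j hj, G.adj_comm,
        (hl.getElem (show j + 2 < mid.length + 2 by omega) (by omega)).2] at hzj
      exact .inr ⟨rfl, by omega⟩
    · refine absurd hzj (hql _ ?_)
      simp
  have hpg : G.Adj p g := by
    rw [← hLp, ← hLg, (hl.getElem (show 0 < 1 by omega) (by omega)).2]; omega
  have hph : G.Adj p h := by
    rw [← hLp, ← hLh, (hl.getElem (show 0 < mid.length + 2 by omega) (by omega)).2]; omega
  have hgh : ¬ G.Adj g h := by
    rw [← hLg, ← hLh, (hl.getElem (show 1 < mid.length + 2 by omega) (by omega)).2]; omega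
  have hpL : ∀ j, ∀ hj : j < mid.length, ¬ G.Adj p mid[j] := by
    intro j hj h'
    rw [← hLp, ← hmidL j hj, (hl.getElem (show 0 < j + 2 by omega) (by omega)).2] at h'
    omega
  have hqg : ¬ G.Adj q g := hql _ (by simp)
  have hqh : ¬ G.Adj q h := hql _ (by simp)
  have hZp : ∀ z ∈ Z, z ≠ p → G.Adj p z := by
    rintro z (rfl | rfl | rfl | rfl) hz
    · exact absurd rfl hz
    · exact hpg
    · exact hph
    · exact hpq
  have hpmem : p ∈ L := by simp [hLdef]
  let X : ℕ → Prop := fun i => i = 0 ∨ ∃ j, ∃ hj : j < mid.length, i = j + 1 ∧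
    ∃ x ∈ B, G.Adj mid[j] x
  -- The vertex `p` is a further centre. The contacts 0, `b + 1` and `d + 1` bound two consecutive
  -- odd arcs.
  suffices h : ∃ φ, TModel (markedWheel n X) G φ (A ∪ {p}) by
    obtain ⟨φ, hφ⟩ := h
    refine hasOddWheel_of_markedWheel ⟨φ, _, hφ⟩ (b := b + 1) (c := b + 1) (d := d + 1)
      hodd.add_one (.inl rfl) (.inr ⟨b, by omega, rfl, h1⟩) hb le_rfl
      (.inr ⟨b, by omega, rfl, h1⟩) (.inr ⟨d, by omega, rfl, h2⟩)
      (by rwa [show d + 1 - (b + 1) = d - b by omega]) (by omega)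
  refine exists_tmodel F (A ∪ {p}) ?_ ?_ ?_ ?_ ?_ ?_
  · rintro (_ | i) (_ | j) v g1 g2
    · rfl
    · exact absurd g1 (hFT _ _ g2)
    · exact absurd g2 (hFT _ _ g1)
    · congr 1
      ext
      rcases g1 with ⟨e1, g1⟩ | ⟨j1, hj1, e1, g1⟩ <;> rcases g2 with ⟨e2, g2⟩ | ⟨j2, hj2, e2, g2⟩
      · omega
      · exact absurd (g2 ▸ g1) (hmZ _ _)
      · exact absurd (g1 ▸ g2) (hmZ _ _)
      · rw [g1] at g2
        rw [← hmidL j1 hj1, ← hmidL j2 hj2, hnd.getElem_inj_iff] at g2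
        omega
  · rintro (_ | i)
    · obtain ⟨x, hx, -⟩ := h2
      refine ⟨x, .inr hx, ?_⟩
      rintro (h' | h')
      · exact hAB x h' hx
      · obtain rfl : x = p := h'
        exact (hAl _ hpmem).2.1 hx
    · by_cases hi : i.val = 0
      · refine ⟨q, .inl ⟨hi, .inr (.inr (.inr rfl))⟩, ?_⟩
        rintro (h' | h')
        · exact hqA.1 h'
        · exact (hAl _ hpmem).2.2.1 (show q = p from h').symm
      · have hi' := i.isLt
        refine ⟨mid[i.val - 1], .inr ⟨i.val - 1, by omega, by omega, rfl⟩, ?_⟩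
        rintro (h' | h')
        · exact hmT _ _ (.inl h')
        · exact hmZ _ _ (.inl h')
  · rintro (_ | i) P hu hstep v hv
    · exact hT P hu (fun a b hab ha hb => hstep a b hab ha hb) v hv
    · obtain ⟨u, hu, hP⟩ := hu
      rcases hu with ⟨e1, hu⟩ | ⟨j1, hj1, e1, hu⟩ <;> rcases hv with ⟨e2, hv⟩ | ⟨j2, hj2, e2, hv⟩
      · have hpP : P p := by
          by_cases e : u = p
          · rwa [← e]
          · exact hstep u p (hZp u hu e).symm (.inl ⟨e1, hu⟩) (.inl ⟨e1, .inl rfl⟩) hP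
        by_cases e : v = p
        · rwa [e]
        · exact hstep p v (hZp v hv e) (.inl ⟨e1, .inl rfl⟩) (.inl ⟨e1, hv⟩) hpP
      · omega
      · omega
      · obtain rfl : j1 = j2 := by omega
        rwa [hv, ← hu]
  · rintro v (hv | hv) w hw u huv ⟨w', hu⟩
    · have hw0 : w = none := by
        rcases w with _ | i
        · rfl
        · exact absurd (.inl hv) (hFT _ _ hw)
      subst hw0
      have huA : u ∉ A := fun h => hA u h v hv huv
      have hup : u ≠ p := fun e => (hAl _ hpmem).2.2.2 v hv (e ▸ huv)
      have huAp : u ∉ A ∪ {p} := fun h' => h'.elim huA hup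
      rcases w' with _ | j
      · exact ⟨hu, huAp⟩
      · exfalso
        have : u = q ∨ u ∈ L := by
          rcases hu with ⟨-, rfl | rfl | rfl | rfl⟩ | ⟨j, hj, -, rfl⟩
          · simp [hLdef]
          · simp [hLdef]
          · simp [hLdef]
          · simp
          · exact .inr (hmm j hj)
        rcases this with rfl | hm
        · exact hqA.2.2 v hv huv
        · exact (hAl _ hm).2.2.2 v hv huv
    · obtain rfl : v = p := hv
      rcases w with _ | i
      · rcases hw with h' | h'
        · exact absurd h' (hAl _ hpmem).1
        · exact absurd h' (hAl _ hpmem).2.1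
      have hi0 : i.val = 0 := by
        rcases hw with ⟨e, -⟩ | ⟨j, hj, -, e⟩
        · exact e
        · exact absurd (.inl e.symm) (hmZ j hj)
      have hne := huv.ne
      rcases w' with _ | j
      · rcases hu with h' | h'
        · exact absurd huv.symm ((hAl _ hpmem).2.2.2 u h')
        · exact absurd huv.symm (hpB u h')
      · rcases hu with ⟨e, hu⟩ | ⟨j, hj, e, rfl⟩
        · refine ⟨.inl ⟨hi0, hu⟩, ?_⟩
          rintro (h' | h')
          · exact hZL u hu (.inl h')
          · exact hne h'
        · exact absurd huv.symm (hpL j hj)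
  · rintro u v (_ | i) hu hv g1 g2 huv
    · exact hB u (g1.resolve_left fun h => hu (.inl h)) v (g2.resolve_left fun h => hv (.inl h)) huv
    · have hup : u ≠ p := fun e => hu (.inr e)
      have hvp : v ≠ p := fun e => hv (.inr e)
      rcases g1 with ⟨e1, g1⟩ | ⟨j1, hj1, e1, g1⟩ <;> rcases g2 with ⟨e2, g2⟩ | ⟨j2, hj2, e2, g2⟩
      · rcases g1 with rfl | rfl | rfl | rfl <;> rcases g2 with rfl | rfl | rfl | rfl <;>
          first
          | exact absurd rfl hup
          | exact absurd rfl hvp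
          | exact absurd huv G.irrefl
          | exact hgh huv
          | exact hgh huv.symm
          | exact hqg huv
          | exact hqg huv.symm
          | exact hqh huv
          | exact hqh huv.symm
      · omega
      · omega
      · obtain rfl : j1 = j2 := by omega
        rw [g1, g2] at huv
        exact G.irrefl huv
  · have hub : ∀ i : Fin n, X i ↔
        ∃ u v, G.Adj u v ∧ u ∈ F none ∧ v ∈ F (some i) := by
      intro i
      constructor
      · rintro (hi | ⟨j, hj, hi, x, hx, hjx⟩)
        · obtain ⟨x, hx, hqx⟩ := hqB
          exact ⟨x, q, hqx.symm, .inr hx, .inl ⟨hi, .inr (.inr (.inr rfl))⟩⟩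
        · exact ⟨x, mid[j], hjx.symm, .inr hx, .inr ⟨j, hj, hi, rfl⟩⟩
      · rintro ⟨u, v, huv, hu, ⟨hi, -⟩ | ⟨j, hj, hi, rfl⟩⟩
        · exact .inl hi
        · refine .inr ⟨j, hj, hi, u, hu.resolve_left fun h => ?_, huv.symm⟩
          exact (hAl _ (hmm j hj)).2.2.2 u h huv.symm
    rintro (_ | i) (_ | j) hne
    · exact absurd rfl hne
    · exact hub j
    · refine (hub i).trans ⟨?_, ?_⟩
      · rintro ⟨u, v, huv, hu, hv⟩; exact ⟨v, u, huv.symm, hv, hu⟩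
      · rintro ⟨u, v, huv, hu, hv⟩; exact ⟨v, u, huv.symm, hv, hu⟩
    · have hij : i ≠ j := fun e => hne (by rw [e])
      have hi := i.isLt
      have hj := j.isLt
      change (i ≠ j ∧ _) ↔ _
      have hmod : ∀ i : ℕ, i < n → (i + 1) % n = if i + 1 = n then 0 else i + 1 := by
        intro i hi
        split_ifs with h
        · rw [h, Nat.mod_self]
        · exact Nat.mod_eq_of_lt (by omega)
      have fwd : ∀ i j : Fin n, i ≠ j → j.val = (i.val + 1) % n →
          ∃ u v, G.Adj u v ∧ u ∈ F (some i) ∧ v ∈ F (some j) := by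
        intro i j hij hv
        have hi := i.isLt
        have hij' : i.val ≠ j.val := fun e => hij (Fin.ext e)
        rw [hmod _ hi] at hv
        split_ifs at hv with hin
        · refine ⟨mid[i.val - 1], h, ?_, .inr ⟨i.val - 1, by omega, by omega, rfl⟩,
            .inl ⟨hv, .inr (.inr (.inl rfl))⟩⟩
          rw [← hLh, ← hmidL (i.val - 1) (by omega),
            (hl.getElem (show i.val - 1 + 2 < mid.length + 2 by omega) (by omega)).2]
          omega
        · by_cases hi0 : i.val = 0
          · refine ⟨g, mid[0], ?_, .inl ⟨hi0, .inr (.inl rfl)⟩, .inr ⟨0, by omega, by omega, rfl⟩⟩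
            rw [← hLg, ← hmidL 0 (by omega), (hl.getElem (show 1 < 0 + 2 by omega) (by omega)).2]
            omega
          · refine ⟨mid[i.val - 1], mid[i.val], ?_, .inr ⟨i.val - 1, by omega, by omega, rfl⟩,
              .inr ⟨i.val, by omega, hv, rfl⟩⟩
            rw [← hmidL (i.val - 1) (by omega), ← hmidL i.val (by omega),
              (hl.getElem (show i.val - 1 + 2 < i.val + 2 by omega) (by omega)).2]
            omega
      constructor
      · rintro ⟨-, hv | hv⟩
        · exact fwd i j hij hv
        · obtain ⟨u, v, huv, hu, hv⟩ := fwd j i hij.symm hv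
          exact ⟨v, u, huv.symm, hv, hu⟩
      · have hij' : i.val ≠ j.val := fun e => hij (Fin.ext e)
        rintro ⟨u, v, huv, hu, hv⟩
        refine ⟨hij, ?_⟩
        rw [hmod _ hi, hmod _ hj]
        rcases hu with ⟨e1, g1⟩ | ⟨j1, hj1, e1, g1⟩ <;> rcases hv with ⟨e2, g2⟩ | ⟨j2, hj2, e2, g2⟩
        · omega
        · rw [g2] at huv
          have := hzadj u g1 j2 hj2 huv
          split_ifs <;> omega
        · rw [g1] at huv
          have := hzadj v g2 j1 hj1 huv.symm
          split_ifs <;> omega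
        · rw [g1, g2] at huv
          have := hmadj j1 j2 hj1 hj2 huv
          split_ifs <;> omega

/-! ### Induced paths and cycles recognised by positions -/

theorem indPath_of_getElem : ∀ {l : List V}, (∀ i j (_ : i < j) (hj : j < l.length),
    l[i] ≠ l[j] ∧ (G.Adj l[i] l[j] ↔ j = i + 1)) → IndPath G l
  | [], _ => trivial
  | x :: l, h => by
    have h2 : IndPath G l := indPath_of_getElem (fun i j hij hj => by
      have := h (i + 1) (j + 1) (by omega) (by simpa using hj)
      simp only [List.getElem_cons_succ] at this
      exact ⟨this.1, this.2.trans (by omega)⟩)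
    refine ⟨fun b hb => ?_, h2⟩
    obtain ⟨j, hj, rfl⟩ := List.getElem_of_mem hb
    have := h 0 (j + 1) (by omega) (by simpa using hj)
    simp only [List.getElem_cons_zero, List.getElem_cons_succ] at this
    refine ⟨this.1, ?_⟩
    rw [this.2, List.head?_eq_getElem?, List.getElem?_eq_getElem (by omega), Option.some_inj,
      h2.nodup.getElem_inj_iff]
    omega

theorem indCyc_of_getElem {l : List V} (h3 : 3 ≤ l.length) (h : ∀ i j (_ : i < j)
    (hj : j < l.length), l[i] ≠ l[j] ∧
      (G.Adj l[i] l[j] ↔ j = i + 1 ∨ (i = 0 ∧ j + 1 = l.length))) : IndCyc G l := by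
  rcases l with _ | ⟨x, l⟩
  · simp at h3
  have h2 : IndPath G l := indPath_of_getElem (fun i j hij hj => by
    have := h (i + 1) (j + 1) (by omega) (by simpa using hj)
    simpa using this)
  refine ⟨by simpa using h3, h2, ?_⟩
  have hlen : 2 ≤ l.length := by simpa using h3
  intro a ha b hb
  obtain rfl := List.mem_singleton.1 ha
  obtain ⟨j, hj, rfl⟩ := List.getElem_of_mem hb
  have := h 0 (j + 1) (by omega) (by simpa using hj)
  simp only [List.getElem_cons_zero, List.getElem_cons_succ] at this
  refine ⟨this.1, ?_⟩
  have e1 : l.head? = some l[0] := by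
    rw [List.head?_eq_getElem?, List.getElem?_eq_getElem (by omega)]
  have e2 : l.getLast? = some l[l.length - 1] := by
    rw [List.getLast?_eq_getElem?, List.getElem?_eq_getElem (by omega)]
  rw [this.2, e1, e2]
  simp only [List.getLast?_singleton, List.head?_cons, true_and, Option.some_inj,
    h2.nodup.getElem_inj_iff, List.length_cons]
  omega

/-! ### Odd closed walks and odd induced cycles -/

/-- The sequence `c` is an odd closed walk of length `n`. -/
def OddWalk (G : SimpleGraph V) (n : ℕ) (c : ℕ → V) : Prop :=
  Odd n ∧ c n = c 0 ∧ ∀ i < n, G.Adj (c i) (c (i + 1))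

/-- A repeated vertex splits the closed walk into two closed walks, and so does a chord, which is
then used in both. The total length is `n` or `n + 2`, so one part is odd, and it is shorter than
`n`. A walk with neither repetition nor chord is an induced cycle. -/
theorem exists_indCyc_of_oddWalk {S : Set V} : ∀ (n : ℕ) (c : ℕ → V), OddWalk G n c →
    (∀ i, c i ∈ S) → ∃ l, IndCyc G l ∧ Odd l.length ∧ l.length ≤ n ∧ ∀ v ∈ l, v ∈ S := by
  intro n
  induction n using Nat.strong_induction_on with
  | _ n ih =>
  intro c ⟨hn, hc, hadj⟩ hS
  have hn1 : n ≠ 1 := by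
    rintro rfl
    have := hadj 0 (by omega)
    rw [show 0 + 1 = 1 from rfl, hc] at this
    exact G.irrefl this
  have hn3 : 3 ≤ n := by obtain ⟨k, hk⟩ := hn; omega
  by_cases hrep : ∃ i j, i < j ∧ j < n ∧ c i = c j
  · obtain ⟨i, j, hij, hj, he⟩ := hrep
    by_cases ho : Odd (j - i)
    · obtain ⟨l, h1, h2, h3, h4⟩ := ih (j - i) (by omega) (fun t => c (i + t))
        ⟨ho, by simp only [Nat.add_sub_cancel' hij.le, add_zero, he],
          fun t ht => hadj (i + t) (by omega)⟩ (fun t => hS _)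
      exact ⟨l, h1, h2, by omega, h4⟩
    · obtain ⟨l, h1, h2, h3, h4⟩ := ih (n - (j - i)) (by omega)
        (fun t => if t ≤ i then c t else c (t + (j - i))) ⟨by
          rw [Nat.odd_iff] at hn ho ⊢; omega, by
          simp only [Nat.zero_le, if_true]
          rw [if_neg (by omega), ← hc]
          congr 1; omega, fun t ht => by
          by_cases h : t + 1 ≤ i
          · simp only [show t ≤ i by omega, h, if_true]
            exact hadj t (by omega)
          · by_cases h' : t = i
            · subst h'
              simp only [le_refl, if_true, if_neg h, he]
              have := hadj j hj
              rwa [show j + 1 = t + 1 + (j - t) by omega] at this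
            · simp only [if_neg h, if_neg (show ¬ t ≤ i by omega)]
              have := hadj (t + (j - i)) (by omega)
              rwa [show t + (j - i) + 1 = t + 1 + (j - i) by omega] at this⟩
        (fun t => by split_ifs <;> exact hS _)
      exact ⟨l, h1, h2, by omega, h4⟩
  push Not at hrep
  by_cases hch : ∃ i j, i < j ∧ j < n ∧ G.Adj (c i) (c j) ∧ j ≠ i + 1 ∧ ¬ (i = 0 ∧ j + 1 = n)
  · obtain ⟨i, j, hij, hj, he, hj1, hj2⟩ := hch
    by_cases ho : Odd (j - i + 1)
    · obtain ⟨l, h1, h2, h3, h4⟩ := ih (j - i + 1) (by omega)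
        (fun t => if t ≤ j - i then c (i + t) else c i)
        ⟨ho, by simp, fun t ht => by
          by_cases h : t + 1 ≤ j - i
          · simp only [show t ≤ j - i by omega, h, if_true]
            exact hadj (i + t) (by omega)
          · simp only [if_neg h, if_pos (show t ≤ j - i by omega)]
            rw [show i + t = j by omega]
            exact he.symm⟩
        (fun t => by split_ifs <;> exact hS _)
      exact ⟨l, h1, h2, by omega, h4⟩
    · obtain ⟨l, h1, h2, h3, h4⟩ := ih (n - (j - i) + 1) (by omega)
        (fun t => if t ≤ i then c t else c (t - 1 + (j - i))) ⟨by
          rw [Nat.odd_iff] at hn ho ⊢; omega, by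
          simp only [Nat.zero_le, if_true]
          rw [if_neg (by omega), ← hc]
          congr 1; omega, fun t ht => by
          by_cases h : t + 1 ≤ i
          · simp only [show t ≤ i by omega, h, if_true]
            exact hadj t (by omega)
          · by_cases h' : t = i
            · subst h'
              simp only [le_refl, if_true, if_neg h]
              rwa [show t + 1 - 1 + (j - t) = j by omega]
            · simp only [if_neg h, if_neg (show ¬ t ≤ i by omega)]
              have := hadj (t - 1 + (j - i)) (by omega)
              rwa [show t - 1 + (j - i) + 1 = t + 1 - 1 + (j - i) by omega] at this⟩
        (fun t => by split_ifs <;> exact hS _)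
      exact ⟨l, h1, h2, by omega, h4⟩
  push Not at hch
  refine ⟨(List.range n).map c, indCyc_of_getElem (by simpa using hn3) ?_, by simpa using hn,
    by simp, ?_⟩
  · intro i j hij hj
    have hj' : j < n := by simpa using hj
    simp only [List.getElem_map, List.getElem_range, List.length_map, List.length_range]
    refine ⟨hrep i j hij hj', fun h => ?_, ?_⟩
    · by_contra hc'
      push Not at hc'
      exact (hc'.2 (hch i j hij hj' h hc'.1).1) (hch i j hij hj' h hc'.1).2
    · rintro (rfl | ⟨rfl, h⟩)
      · exact hadj i (by omega)
      · have := hadj j hj'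
        rw [h, hc] at this
        exact this.symm
  · intro v hv
    obtain ⟨i, -, rfl⟩ := List.mem_map.1 hv
    exact hS i

theorem exists_walk_of_isChain : ∀ (x : V) (l : List V), (x :: l).IsChain G.Adj →
    ∃ (y : V) (p : G.Walk x y), (x :: l).getLast? = some y ∧ p.support = x :: l
  | x, [], _ => ⟨x, .nil, rfl, rfl⟩
  | x, y :: l, h => by
    rw [List.isChain_cons_cons] at h
    obtain ⟨z, p, hz, hp⟩ := exists_walk_of_isChain y l h.2
    exact ⟨z, .cons h.1 p, by rw [List.getLast?_cons_cons, hz], by rw [Walk.support_cons, hp]⟩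

theorem IndPath.isChain : ∀ {l : List V}, IndPath G l → l.IsChain G.Adj
  | [], _ => List.isChain_nil
  | [x], _ => List.isChain_singleton x
  | x :: y :: l, h => by
    rw [List.isChain_cons_cons]
    exact ⟨(h.1 y (by simp)).2.2 rfl, h.2.isChain⟩

/-- The bridge to the walks in which `oddGirth` is measured. -/
theorem IndCyc.exists_isCycle {l : List V} (h : IndCyc G l) :
    ∃ (a : V) (w : G.Walk a a), w.IsCycle ∧ w.length = l.length := by
  rcases l with _ | ⟨x, _ | ⟨y, l⟩⟩
  · exact h.elim
  · exact absurd h.1 (by simp)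
  obtain ⟨h1, h2, h3⟩ := h
  have hxy : G.Adj x y := (h3 x (by simp) y (by simp)).2.2 (.inl ⟨rfl, rfl⟩)
  have hx : x ∉ y :: l := fun hx => (h3 x (by simp) x hx).1 rfl
  obtain ⟨z, p, hz, hp⟩ := exists_walk_of_isChain y l h2.isChain
  have hzm : z ∈ y :: l := List.mem_of_mem_getLast? hz
  have hzx : G.Adj z x := ((h3 x (by simp) z hzm).2.2 (.inr ⟨rfl, hz⟩)).symm
  have hpath : (Walk.cons hxy p).IsPath := by
    rw [Walk.isPath_def, Walk.support_cons, hp]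
    exact List.nodup_cons.2 ⟨hx, h2.nodup⟩
  have hyz : y ≠ z := by
    rintro rfl
    rcases l with _ | ⟨w, l⟩
    · simp at h1
    · rw [List.getLast?_cons_cons] at hz
      exact (h2.1 y (List.mem_of_mem_getLast? hz)).1 rfl
  refine ⟨z, .cons hzx (.cons hxy p), ?_, ?_⟩
  · rw [Walk.cons_isCycle_iff]
    refine ⟨hpath, ?_⟩
    rw [Walk.edges_cons, List.mem_cons]
    rintro (h | h)
    · rcases Sym2.eq_iff.1 h with ⟨h4, h5⟩ | ⟨h4, h5⟩
      · exact hxy.ne h5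
      · exact hyz h4.symm
    · have := p.snd_mem_support_of_mem_edges h
      rw [hp] at this
      exact hx this
  · have : p.length + 1 = (y :: l).length := by rw [← hp, Walk.length_support]
    simp only [Walk.length_cons, List.length_cons] at this ⊢
    omega

theorem IndCyc.eleven_le {l : List V} (h : IndCyc G l) (hG : 11 ≤ G.oddGirth)
    (ho : Odd l.length) : 11 ≤ l.length := by
  obtain ⟨a, w, hw, hl⟩ := h.exists_isCycle
  have := le_oddGirth.1 hG a w hw (hl ▸ ho)
  rw [hl] at this
  exact_mod_cast this

theorem OddWalk.eleven_le {n : ℕ} {c : ℕ → V} (h : OddWalk G n c) (hG : 11 ≤ G.oddGirth) :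
    11 ≤ n := by
  obtain ⟨l, h1, h2, h3, -⟩ := exists_indCyc_of_oddWalk (S := Set.univ) n c h (by simp)
  exact (h1.eleven_le hG h2).trans h3

/-- In this and the next two lemmas the vertices need not be distinct: every odd closed walk
contains an odd cycle that is no longer. -/
theorem not_closed_three (hG : 11 ≤ G.oddGirth) {a b c : V} (h1 : G.Adj a b) (h2 : G.Adj b c)
    (h3 : G.Adj c a) : False := by
  have := OddWalk.eleven_le (n := 3) (c := fun i => [a, b, c, a].getD i a)
    ⟨by decide, rfl, fun i hi => by interval_cases i <;> assumption⟩ hG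
  omega

theorem not_closed_five (hG : 11 ≤ G.oddGirth) {a b c d e : V} (h1 : G.Adj a b) (h2 : G.Adj b c)
    (h3 : G.Adj c d) (h4 : G.Adj d e) (h5 : G.Adj e a) : False := by
  have := OddWalk.eleven_le (n := 5) (c := fun i => [a, b, c, d, e, a].getD i a)
    ⟨by decide, rfl, fun i hi => by interval_cases i <;> assumption⟩ hG
  omega

theorem not_closed_seven (hG : 11 ≤ G.oddGirth) {a b c d e f g : V} (h1 : G.Adj a b)
    (h2 : G.Adj b c) (h3 : G.Adj c d) (h4 : G.Adj d e) (h5 : G.Adj e f) (h6 : G.Adj f g)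
    (h7 : G.Adj g a) : False := by
  have := OddWalk.eleven_le (n := 7) (c := fun i => [a, b, c, d, e, f, g, a].getD i a)
    ⟨by decide, rfl, fun i hi => by interval_cases i <;> assumption⟩ hG
  omega

/-! ### Colourings of vertex sets -/

/-- The subgraph induced on `S` is `N`-colourable. -/
def ColOn (G : SimpleGraph V) (S : Set V) (N : ℕ) : Prop :=
  ∃ f : V → ℕ, (∀ u ∈ S, f u < N) ∧ ∀ u ∈ S, ∀ v ∈ S, G.Adj u v → f u ≠ f v

theorem ColOn.mono {S T : Set V} {N M : ℕ} (h : ColOn G T N) (hST : S ⊆ T) (hNM : N ≤ M) :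
    ColOn G S M := by
  obtain ⟨f, h1, h2⟩ := h
  exact ⟨f, fun u hu => (h1 u (hST hu)).trans_le hNM,
    fun u hu v hv => h2 u (hST hu) v (hST hv)⟩

theorem ColOn.union {S T : Set V} {N M : ℕ} (hS : ColOn G S N) (hT : ColOn G T M) :
    ColOn G (S ∪ T) (N + M) := by
  classical
  obtain ⟨f, h1, h2⟩ := hS
  obtain ⟨g, h3, h4⟩ := hT
  refine ⟨fun v => if v ∈ S then f v else N + g v, ?_, ?_⟩
  · rintro u hu
    by_cases h : u ∈ S
    · have := h1 u h
      simp only [h, if_true]; omega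
    · have := h3 u (hu.resolve_left h)
      simp only [h, if_false]; omega
  · intro u hu v hv huv
    by_cases h : u ∈ S <;> by_cases h' : v ∈ S
    · simpa only [h, h', if_true] using h2 u h v h' huv
    · have := h1 u h
      simp only [h, h', if_true, if_false]; omega
    · have := h1 v h'
      simp only [h, h', if_true, if_false]; omega
    · have := h4 u (hu.resolve_left h) v (hv.resolve_left h') huv
      simp only [h, h', if_false]; omega

theorem ColOn.of_cover {S T U : Set V} {N M K : ℕ} (hS : ColOn G S N) (hT : ColOn G T M)
    (hU : ∀ v ∈ U, v ∈ S ∨ v ∈ T) (hK : N + M ≤ K) : ColOn G U K :=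
  (hS.union hT).mono hU hK

theorem StableOn.colOn {S : Set V} (h : StableOn G S) : ColOn G S 1 :=
  ⟨fun _ => 0, fun _ _ => Nat.one_pos, fun u hu v hv huv => absurd huv (h u hu v hv)⟩

theorem StableOn.mono {S T : Set V} (h : StableOn G T) (hST : S ⊆ T) : StableOn G S :=
  fun u hu v hv => h u (hST hu) v (hST hv)

theorem colOn_empty (N : ℕ) : ColOn G ∅ N := ⟨fun _ => 0, by simp, by simp⟩

theorem nonempty_of_not_colOn {S : Set V} {N : ℕ} (h : ¬ ColOn G S N) : S.Nonempty := by
  rw [Set.nonempty_iff_ne_empty]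
  rintro rfl
  exact h (colOn_empty N)

/-- There are no edges between different fibres, so all fibres can use the same colours. -/
theorem colOn_of_fibres {ι : Type*} {S : Set V} {N : ℕ} (t : V → ι)
    (ht : ∀ u ∈ S, ∀ v ∈ S, G.Adj u v → t u = t v)
    (h : ∀ i, ColOn G {v | v ∈ S ∧ t v = i} N) : ColOn G S N := by
  choose f hf using h
  refine ⟨fun v => f (t v) v, fun u hu => (hf (t u)).1 u ⟨hu, rfl⟩, fun u hu v hv huv => ?_⟩
  have e := ht u hu v hv huv
  simp only [e]
  exact (hf (t v)).2 u ⟨hu, e⟩ v ⟨hv, rfl⟩ huv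

theorem ColOn.exists_bipartition {S : Set V} (h : ColOn G S 2) :
    ∃ A B, S = A ∪ B ∧ (∀ v ∈ A, v ∉ B) ∧ StableOn G A ∧ StableOn G B := by
  obtain ⟨f, h1, h2⟩ := h
  refine ⟨{v | v ∈ S ∧ f v = 0}, {v | v ∈ S ∧ f v = 1}, ?_, ?_, ?_, ?_⟩
  · ext v
    constructor
    · intro hv
      have := h1 v hv
      rcases Nat.lt_succ_iff_lt_or_eq.1 this with h | h
      · exact .inl ⟨hv, by omega⟩
      · exact .inr ⟨hv, h⟩
    · rintro (h | h) <;> exact h.1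
  · rintro v ⟨-, h⟩ ⟨-, h'⟩; omega
  · rintro u ⟨hu, h⟩ v ⟨hv, h'⟩ huv; exact h2 u hu v hv huv (by rw [h, h'])
  · rintro u ⟨hu, h⟩ v ⟨hv, h'⟩ huv; exact h2 u hu v hv huv (by rw [h, h'])

theorem colOn_of_colorable {S : Set V} {N : ℕ} (h : (G.induce S).Colorable N) : ColOn G S N := by
  classical
  obtain ⟨f⟩ := h
  refine ⟨fun v => if h : v ∈ S then (f ⟨v, h⟩).val else 0, ?_, ?_⟩
  · intro u hu
    simp only [hu, dif_pos, (f ⟨u, hu⟩).isLt]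
  · intro u hu v hv huv
    simp only [hu, hv, dif_pos, ne_eq, Fin.val_inj]
    exact f.valid (v := ⟨u, hu⟩) (w := ⟨v, hv⟩) huv

theorem colorable_of_colOn {N : ℕ} (h : ColOn G Set.univ N) : G.Colorable N := by
  obtain ⟨f, h1, h2⟩ := h
  exact ⟨Coloring.mk (fun v => ⟨f v, h1 v trivial⟩) fun {u v} huv e =>
    h2 u trivial v trivial huv (by simpa using e)⟩

theorem exists_indCyc_of_not_colOn {S : Set V} (h : ¬ ColOn G S 2) :
    ∃ l, IndCyc G l ∧ Odd l.length ∧ ∀ v ∈ l, v ∈ S := by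
  have h' : ¬ (G.induce S).Colorable 2 := fun h' => h (colOn_of_colorable h')
  rw [two_colorable_iff_forall_loop_even] at h'
  push Not at h'
  obtain ⟨u, w, hw⟩ := h'
  obtain ⟨l, h1, h2, -, h4⟩ := exists_indCyc_of_oddWalk (G := G) (S := S) w.length
    (fun i => (w.getVert i).1) ⟨Nat.not_even_iff_odd.1 hw, by simp, fun i hi =>
      w.adj_getVert_succ hi⟩ (fun i => (w.getVert i).2)
  exact ⟨l, h1, h2, h4⟩

/-- A set without odd induced cycle is 2-colourable. -/
theorem colOn_two {S : Set V} (h : ∀ l, IndCyc G l → Odd l.length → (∀ v ∈ l, v ∈ S) → False) :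
    ColOn G S 2 := by
  by_contra hc
  obtain ⟨l, h1, h2, h3⟩ := exists_indCyc_of_not_colOn hc
  exact h l h1 h2 h3

/-! ### Connected sets -/

theorem ConnOn.singleton (v : V) : ConnOn G {v} := by
  rintro P ⟨u, hu, hP⟩ - w hw
  rw [Set.mem_singleton_iff] at hu hw
  rwa [hw, ← hu]

theorem ConnOn.union {S T : Set V} (hS : ConnOn G S) (hT : ConnOn G T)
    (h : ∃ u ∈ S, ∃ v ∈ T, u = v ∨ G.Adj u v) : ConnOn G (S ∪ T) := by
  obtain ⟨a, ha, b, hb, hab⟩ := h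
  rintro P ⟨u, hu, hP⟩ hstep v hv
  have h1 : (∃ u ∈ S, P u) → ∀ v ∈ S, P v := fun h =>
    hS P h fun a b hab ha hb => hstep a b hab (.inl ha) (.inl hb)
  have h2 : (∃ u ∈ T, P u) → ∀ v ∈ T, P v := fun h =>
    hT P h fun a b hab ha hb => hstep a b hab (.inr ha) (.inr hb)
  have hPab : P a ↔ P b := by
    rcases hab with rfl | hab
    · rfl
    · exact ⟨hstep a b hab (.inl ha) (.inr hb), hstep b a hab.symm (.inr hb) (.inl ha)⟩
  have h3 : P a ∧ P b := by
    rcases hu with hu | hu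
    · have := h1 ⟨u, hu, hP⟩ a ha
      exact ⟨this, hPab.1 this⟩
    · have := h2 ⟨u, hu, hP⟩ b hb
      exact ⟨hPab.2 this, this⟩
  rcases hv with hv | hv
  · exact h1 ⟨a, ha, h3.1⟩ v hv
  · exact h2 ⟨b, hb, h3.2⟩ v hv

/-- The union of connected sets that all meet a connected set `T` or have a neighbour in it. -/
theorem ConnOn.biUnion {ι : Type*} {S : ι → Set V} {T : Set V} (hT : ConnOn G T)
    (hS : ∀ i, ConnOn G (S i)) (h : ∀ i, ∃ u ∈ S i, ∃ v ∈ T, u = v ∨ G.Adj u v) :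
    ConnOn G (T ∪ ⋃ i, S i) := by
  rintro P ⟨u, hu, hP⟩ hstep v hv
  have key : ∀ i, ((∃ u ∈ T ∪ S i, P u) → ∀ v ∈ T ∪ S i, P v) := by
    intro i hi
    obtain ⟨a, ha, b, hb, hab⟩ := h i
    refine (hT.union (hS i) ⟨b, hb, a, ha, hab.imp Eq.symm Adj.symm⟩) P hi ?_
    intro a b hab ha hb
    exact hstep a b hab (ha.imp_right fun h => Set.mem_iUnion.2 ⟨i, h⟩)
      (hb.imp_right fun h => Set.mem_iUnion.2 ⟨i, h⟩)
  have hT' : (∃ u ∈ T, P u) → ∀ v ∈ T, P v := fun h =>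
    hT P h fun a b hab ha hb => hstep a b hab (.inl ha) (.inl hb)
  rcases hu with hu | hu
  · rcases hv with hv | hv
    · exact hT' ⟨u, hu, hP⟩ v hv
    · obtain ⟨i, hi⟩ := Set.mem_iUnion.1 hv
      exact key i ⟨u, .inl hu, hP⟩ v (.inr hi)
  · obtain ⟨i, hi⟩ := Set.mem_iUnion.1 hu
    have h1 := key i ⟨u, .inr hi, hP⟩
    rcases hv with hv | hv
    · exact h1 v (.inl hv)
    · obtain ⟨j, hj⟩ := Set.mem_iUnion.1 hv
      obtain ⟨a, ha, b, hb, hab⟩ := h i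
      exact key j ⟨b, .inl hb, h1 b (.inl hb)⟩ v (.inr hj)

theorem connOn_of_indPath : ∀ {l : List V}, IndPath G l → ConnOn G {v | v ∈ l}
  | [], _ => by rintro P ⟨u, hu, -⟩; simp at hu
  | [x], _ => by simpa using ConnOn.singleton (G := G) x
  | x :: y :: l, h => by
    have : {v | v ∈ x :: y :: l} = {x} ∪ {v | v ∈ y :: l} := by
      ext v; simp
    rw [this]
    exact (ConnOn.singleton x).union (connOn_of_indPath h.2)
      ⟨x, rfl, y, by simp, .inr ((h.1 y (by simp)).2.2 rfl)⟩

/-- The component of `x` in `S`. -/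
def compOn (G : SimpleGraph V) (S : Set V) (x : V) : Set V :=
  {v | Relation.ReflTransGen (fun a b => G.Adj a b ∧ a ∈ S ∧ b ∈ S) x v}

theorem compOn_subset {S : Set V} {x : V} (hx : x ∈ S) : compOn G S x ⊆ S := by
  intro v hv
  induction hv with
  | refl => exact hx
  | tail _ h _ => exact h.2.2

theorem mem_compOn_self {S : Set V} (x : V) : x ∈ compOn G S x := Relation.ReflTransGen.refl

theorem compOn_adj {S : Set V} {x u v : V} (hu : u ∈ compOn G S x) (huS : u ∈ S) (hv : v ∈ S)
    (h : G.Adj u v) : v ∈ compOn G S x :=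
  Relation.ReflTransGen.tail hu ⟨h, huS, hv⟩

theorem mem_compOn_symm {S : Set V} {x v : V} (hv : v ∈ compOn G S x) : x ∈ compOn G S v := by
  induction hv with
  | refl => exact mem_compOn_self _
  | tail _ h ih => exact Relation.ReflTransGen.head ⟨h.1.symm, h.2.2, h.2.1⟩ ih

theorem connOn_compOn {S : Set V} {x : V} : ConnOn G (compOn G S x) := by
  rintro P ⟨u, hu, hP⟩ hstep v hv
  have huv : Relation.ReflTransGen (fun a b => G.Adj a b ∧ a ∈ S ∧ b ∈ S) u v :=
    Relation.ReflTransGen.trans (mem_compOn_symm hu) hv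
  clear hv
  suffices P v ∧ v ∈ compOn G S x from this.1
  induction huv with
  | refl => exact ⟨hP, hu⟩
  | tail _ h ih =>
    have := compOn_adj ih.2 h.2.1 h.2.2 h.1
    exact ⟨hstep _ _ h.1 ih.2 this ih.1, this⟩

theorem ConnOn.subset_compOn {S T : Set V} (hT : ConnOn G T) (hTS : T ⊆ S) {x : V} (hx : x ∈ T) :
    T ⊆ compOn G S x := fun v hv =>
  hT (fun v => v ∈ compOn G S x) ⟨x, hx, mem_compOn_self x⟩
    (fun _ _ hab ha hb h => compOn_adj h (hTS ha) (hTS hb) hab) v hv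

/-- A set with large chromatic number has a component with large chromatic number. -/
theorem exists_component {S : Set V} {N : ℕ} (h : ¬ ColOn G S N) :
    ∃ C ⊆ S, ConnOn G C ∧ ¬ ColOn G C N ∧ ∀ u ∈ C, ∀ v ∈ S, G.Adj u v → v ∈ C := by
  by_contra hc
  push Not at hc
  refine h (colOn_of_fibres (compOn G S) ?_ ?_)
  · intro u hu v hv huv
    have huv' : v ∈ compOn G S u := compOn_adj (mem_compOn_self u) hu hv huv
    ext w
    exact ⟨fun hw => Relation.ReflTransGen.trans (mem_compOn_symm huv') hw,
      fun hw => Relation.ReflTransGen.trans huv' hw⟩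
  · intro C
    by_cases hC : ∃ v ∈ S, compOn G S v = C
    · obtain ⟨x, hx, rfl⟩ := hC
      by_contra hcol
      obtain ⟨u, hu, v, hv, huv, hvC⟩ := hc (compOn G S x) (compOn_subset hx) connOn_compOn
        (fun h' => hcol (h'.mono (fun v hv => by rw [← hv.2]; exact mem_compOn_self v) le_rfl))
      exact hvC (compOn_adj hu (compOn_subset hx hu) hv huv)
    · push Not at hC
      exact (colOn_empty N).mono (fun v hv => hC v hv.1 hv.2) le_rfl

/-! ### Shortest paths in connected sets -/

theorem IndPath.of_append_left {l₁ l₂ : List V} (h : IndPath G (l₁ ++ l₂)) : IndPath G l₁ :=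
  (indPath_append.1 h).1

theorem IndPath.of_append_right {l₁ l₂ : List V} (h : IndPath G (l₁ ++ l₂)) : IndPath G l₂ :=
  (indPath_append.1 h).2.1

theorem IndPath.of_infix {l₁ l₂ : List V} (h : IndPath G l₂) (hl : l₁ <:+: l₂) :
    IndPath G l₁ := by
  obtain ⟨s, t, rfl⟩ := hl
  exact h.of_append_left.of_append_right

/-- Prepending a vertex to an induced path. -/
theorem IndPath.exists_prepend {b : V} : ∀ {l : List V}, IndPath G l →
    (∃ v ∈ l, v = b ∨ G.Adj b v) → ∃ s, s ≠ [] ∧ s <:+ l ∧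
      (s.head? = some b ∨ (IndPath G (b :: s) ∧ s.head?.elim False (G.Adj b)))
  | [], _, h => by simp at h
  | x :: l, hl, h => by
    by_cases h' : ∃ v ∈ l, v = b ∨ G.Adj b v
    · obtain ⟨s, h1, h2, h3⟩ := hl.2.exists_prepend h'
      exact ⟨s, h1, h2.trans (List.suffix_cons x l), h3⟩
    · push Not at h'
      refine ⟨x :: l, by simp, List.suffix_rfl, ?_⟩
      obtain ⟨v, hv, hvb⟩ := h
      rcases List.mem_cons.1 hv with rfl | hv
      · rcases hvb with rfl | hvb
        · exact .inl rfl
        · refine .inr ⟨⟨?_, hl⟩, hvb⟩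
          intro w hw
          rcases List.mem_cons.1 hw with rfl | hw
          · exact ⟨hvb.ne, by simp [hvb]⟩
          · refine ⟨(h' w hw).1.symm, iff_of_false (h' w hw).2 ?_⟩
            simp only [List.head?_cons, Option.some_inj]
            exact (hl.1 w hw).1
      · exact absurd hvb (by have := h' v hv; tauto)

/-- A shortest path in a connected set from a vertex to a vertex with property `Q`. -/
theorem ConnOn.exists_indPath {S : Set V} (hS : ConnOn G S) {Q : V → Prop} {x : V} (hx : x ∈ S)
    (hQ : ∃ y ∈ S, Q y) : ∃ l y, IndPath G (l ++ [y]) ∧ (l ++ [y]).head? = some x ∧ Q y ∧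
      (∀ v ∈ l, ¬ Q v) ∧ ∀ v ∈ l ++ [y], v ∈ S := by
  obtain ⟨y₀, hy₀, hQ₀⟩ := hQ
  -- Connectivity reduces the claim to one edge: a path from `a` is turned into a path from its
  -- neighbour `b` by prepending `b` to the part that starts at the last vertex seen by `b`. If `b`
  -- itself lies beyond that vertex, the path is cut there.
  refine hS (fun x => ∃ l y, IndPath G (l ++ [y]) ∧ (l ++ [y]).head? = some x ∧ Q y ∧
      (∀ v ∈ l, ¬ Q v) ∧ ∀ v ∈ l ++ [y], v ∈ S) ⟨y₀, hy₀, [], y₀, ?_⟩ ?_ x hx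
  · simpa [hQ₀, hy₀] using indPath_singleton y₀
  · rintro a b hab ha hb ⟨l, y, h1, h2, h3, h4, h5⟩
    by_cases hQb : Q b
    · exact ⟨[], b, by simpa using indPath_singleton b, rfl, hQb, by simp, by simpa using hb⟩
    have ha' : a ∈ l ++ [y] := List.mem_of_mem_head? h2
    obtain ⟨s, hs, hsl, hs'⟩ := h1.exists_prepend (b := b) ⟨a, ha', .inr hab.symm⟩
    obtain ⟨t, z, rfl⟩ : ∃ t z, s = t ++ [z] := ⟨s.dropLast, s.getLast hs,
      (List.dropLast_append_getLast hs).symm⟩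
    obtain ⟨u, hu⟩ := hsl
    have hu' : (u ++ t) ++ [z] = l ++ [y] := by rw [← hu, List.append_assoc]
    obtain ⟨rfl, hzy⟩ := List.append_inj' hu' rfl
    obtain rfl : z = y := by simpa using hzy
    have hsub : ∀ v ∈ t ++ [z], v ∈ (u ++ t) ++ [z] := by
      intro v hv
      rw [List.append_assoc]
      exact List.mem_append_right _ hv
    rcases hs' with hs' | ⟨hs', -⟩
    · refine ⟨t, z, ?_, hs', h3, fun v hv => h4 v (List.mem_append_right _ hv),
        fun v hv => h5 v (hsub v hv)⟩
      rw [List.append_assoc] at h1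
      exact h1.of_append_right
    · refine ⟨b :: t, z, hs', rfl, h3, ?_, ?_⟩
      · intro v hv
        rcases List.mem_cons.1 hv with rfl | hv
        · exact hQb
        · exact h4 v (List.mem_append_right _ hv)
      · intro v hv
        rw [List.cons_append] at hv
        rcases List.mem_cons.1 hv with rfl | hv
        · exact hb
        · exact h5 v (hsub v hv)

theorem IndCyc.connOn_diff {l : List V} (hl : IndCyc G l) {o : V} (ho : o ∈ l) :
    ConnOn G {v | v ∈ l ∧ v ≠ o} := by
  obtain ⟨l₁, l₂, rfl⟩ := List.append_of_mem ho
  have h := hl.rotate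
  have hn := h.nodup
  rw [List.cons_append] at h hn
  convert connOn_of_indPath h.2.1 using 1
  ext v
  have : o ∉ l₂ ++ l₁ := (List.nodup_cons.1 hn).1
  simp only [Set.mem_ofPred_eq, List.mem_append, List.mem_cons]
  constructor
  · rintro ⟨h | h | h, h'⟩
    · exact .inr h
    · exact absurd h h'
    · exact .inl h
  · intro hv
    have hne : v ≠ o := by
      rintro rfl
      exact this (List.mem_append.2 hv)
    tauto

/-- A minimal connected set containing at most ten terminals is bipartite, as it cannot contain a
cycle of length at least eleven. -/
theorem exists_connOn_bipartite [Finite V] (hG : 11 ≤ G.oddGirth) {W : Set V} (hW : ConnOn G W)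
    {S : List V} (hS : S.length ≤ 10) (hSW : ∀ s ∈ S, s ∈ W) :
    ∃ Q ⊆ W, ConnOn G Q ∧ (∀ s ∈ S, s ∈ Q) ∧ ColOn G Q 2 := by
  obtain ⟨Q, hQ⟩ := (Set.toFinite {Q : Set V | Q ⊆ W ∧ ConnOn G Q ∧ ∀ s ∈ S, s ∈ Q}).exists_minimal
    ⟨W, subset_rfl, hW, hSW⟩
  obtain ⟨⟨hQW, hQc, hQS⟩, hmin⟩ := hQ
  refine ⟨Q, hQW, hQc, hQS, colOn_two ?_⟩
  intro O hO hodd hOQ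
  have hlen := hO.eleven_le hG hodd
  obtain ⟨o₀, ho₀⟩ : ∃ o, o ∈ O := List.exists_mem_of_length_pos (by omega)
  -- A path from `s` that stops at its first vertex `o` on the cycle avoids all other vertices of
  -- the cycle.
  have hpath : ∀ s, s ∈ Q → ∃ o, o ∈ O ∧ ∀ o' ∈ O, o' ≠ o →
      ∃ T ⊆ Q, ConnOn G T ∧ s ∈ T ∧ o ∈ T ∧ o' ∉ T := by
    intro s hs
    obtain ⟨l, y, h1, h2, h3, h4, h5⟩ := hQc.exists_indPath (Q := fun v => v ∈ O) hs
      ⟨o₀, hOQ o₀ ho₀, ho₀⟩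
    refine ⟨y, h3, fun o' ho' hne => ⟨{v | v ∈ l ++ [y]}, h5, connOn_of_indPath h1,
      List.mem_of_mem_head? h2, by simp, ?_⟩⟩
    intro hm
    rcases List.mem_append.1 hm with hm | hm
    · exact h4 o' hm ho'
    · exact hne (by simpa using hm)
  choose! g hgO hg using hpath
  -- If `o` were the entry `g s` of no terminal, then the component of `Q \ {o}` that contains the
  -- rest of the cycle would contain all terminals, against the minimality of `Q`. So the cycle has
  -- no more vertices than there are terminals.
  have hall : ∀ o ∈ O, o ∈ S.map g := by
    intro o ho
    by_contra hno
    obtain ⟨o₁, ho₁, hne⟩ : ∃ o₁ ∈ O, o₁ ≠ o := by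
      by_contra hc
      push Not at hc
      have : O.length ≤ 1 := by
        have h01 := hO.nodup.getElem_inj_iff (i := 0) (j := 1) (hi := by omega) (hj := by omega)
        rw [hc _ (List.getElem_mem _), hc _ (List.getElem_mem _)] at h01
        simp at h01
      omega
    have hK : compOn G (Q \ {o}) o₁ ⊆ Q \ {o} := compOn_subset ⟨hOQ o₁ ho₁, hne⟩
    have hOK : ∀ v ∈ O, v ≠ o → v ∈ compOn G (Q \ {o}) o₁ := fun v hv hvo =>
      (hO.connOn_diff ho).subset_compOn (S := Q \ {o}) (fun w hw => ⟨hOQ w hw.1, hw.2⟩)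
        (x := o₁) ⟨ho₁, hne⟩ ⟨hv, hvo⟩
    suffices hmem : ∀ s ∈ S, s ∈ compOn G (Q \ {o}) o₁ from
      absurd (hmin (y := compOn G (Q \ {o}) o₁)
        (show _ ⊆ W ∧ ConnOn G _ ∧ ∀ s ∈ S, s ∈ _ from
          ⟨(hK.trans Set.sdiff_subset).trans hQW, connOn_compOn, hmem⟩)
        (hK.trans Set.sdiff_subset) (hOQ o ho)) (fun h => (hK h).2 rfl)
    intro s hs
    have hgs : g s ≠ o := fun e => hno (List.mem_map.2 ⟨s, hs, e⟩)
    obtain ⟨T, hTQ, hT, hsT, hgT, hoT⟩ := hg s (hQS s hs) o ho hgs.symm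
    have h1 := hT.subset_compOn (S := Q \ {o}) (fun v hv => ⟨hTQ hv, fun e => hoT (e ▸ hv)⟩) hgT hsT
    exact Relation.ReflTransGen.trans (hOK _ (hgO s (hQS s hs)) hgs) h1
  have hle := (hO.nodup.subperm (l₂ := S.map g) hall).length_le
  rw [List.length_map] at hle
  omega

/-! ### Levellings -/

/-- Breadth-first search in the connected set `S` from `r`. -/
structure Levelling (G : SimpleGraph V) (S : Set V) (r : V) (lev : V → ℕ) (par : V → V) : Prop where
  root_mem : r ∈ S
  root : lev r = 0
  par_mem : ∀ v ∈ S, v ≠ r → par v ∈ S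
  par_adj : ∀ v ∈ S, v ≠ r → G.Adj (par v) v
  par_lev : ∀ v ∈ S, v ≠ r → lev (par v) + 1 = lev v
  lev_le : ∀ u ∈ S, ∀ v ∈ S, G.Adj u v → lev v ≤ lev u + 1

theorem ConnOn.exists_levelling {S : Set V} (hS : ConnOn G S) {r : V} (hr : r ∈ S) :
    ∃ lev par, Levelling G S r lev par := by
  classical
  -- `R n v`: there is a walk of length `n` from the root
  let R : ℕ → V → Prop := fun n => n.rec (fun v => v = r)
    (fun _ P v => v ∈ S ∧ ∃ u ∈ S, P u ∧ G.Adj u v)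
  have hex : ∀ v ∈ S, ∃ n, R n v :=
    hS (fun v => ∃ n, R n v) ⟨r, hr, 0, rfl⟩
      (fun a b hab ha hb ⟨n, hn⟩ => ⟨n + 1, hb, a, ha, hn, hab⟩)
  let lev : V → ℕ := fun v => sInf {n | R n v}
  have hlev : ∀ v ∈ S, R (lev v) v := fun v hv => Nat.sInf_mem (hex v hv)
  have hmin : ∀ v n, R n v → lev v ≤ n := fun v n hn => Nat.sInf_le hn
  have hle : ∀ u ∈ S, ∀ v ∈ S, G.Adj u v → lev v ≤ lev u + 1 := fun u hu v hv huv =>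
    hmin v _ ⟨hv, u, hu, hlev u hu, huv⟩
  have hpar : ∀ v, ∃ u, v ∈ S → v ≠ r → u ∈ S ∧ G.Adj u v ∧ lev u + 1 = lev v := by
    intro v
    by_cases hv : v ∈ S ∧ v ≠ r
    · have h := hlev v hv.1
      obtain ⟨n, hn⟩ : ∃ n, lev v = n := ⟨_, rfl⟩
      rw [hn] at h
      rcases n with _ | n
      · exact absurd h hv.2
      · obtain ⟨-, u, hu, h1, h2⟩ := h
        have := hmin u n h1
        have := hle u hu v hv.1 h2
        exact ⟨u, fun _ _ => ⟨hu, h2, by omega⟩⟩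
    · exact ⟨v, fun h h' => absurd ⟨h, h'⟩ hv⟩
  choose par hpar using hpar
  exact ⟨lev, par, hr, Nat.le_zero.1 (hmin r 0 rfl), fun v hv h => (hpar v hv h).1,
    fun v hv h => (hpar v hv h).2.1, fun v hv h => (hpar v hv h).2.2, hle⟩

section Levelling

variable {S : Set V} {r : V} {lev : V → ℕ} {par : V → V}

theorem Levelling.ne_root (h : Levelling G S r lev par) {v : V} (hv : 0 < lev v) : v ≠ r := by
  rintro rfl
  rw [h.root] at hv
  omega

theorem Levelling.eq_root (h : Levelling G S r lev par) {v : V} (hvS : v ∈ S) (hv : lev v = 0) :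
    v = r := by
  by_contra hne
  have := h.par_lev v hvS hne
  omega

/-- Edges stay in a level or join consecutive levels. Hence all even levels can share `N` colours,
and all odd levels can share `N` others. -/
theorem Levelling.exists_level (_h : Levelling G S r lev par) {N : ℕ}
    (hcol : ¬ ColOn G S (2 * N)) :
    ∃ k, ¬ ColOn G {v | v ∈ S ∧ lev v = k} N := by
  by_contra hc
  push Not at hc
  have aux : ∀ e, ColOn G {v | v ∈ S ∧ lev v % 2 = e} N := by
    intro e
    refine colOn_of_fibres lev ?_ (fun k => (hc k).mono (fun v hv => ⟨hv.1.1, hv.2⟩) le_rfl)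
    rintro u ⟨hu, h1⟩ v ⟨hv, h2⟩ huv
    have := _h.lev_le u hu v hv huv
    have := _h.lev_le v hv u hu huv.symm
    omega
  exact hcol (ColOn.of_cover (aux 0) (aux 1) (fun v hv => by
    simp only [Set.mem_ofPred_eq, hv, true_and]; omega) (by omega))

/-- The set is the tree path from `v` to the root. -/
theorem Levelling.exists_ancestors (h : Levelling G S r lev par) : ∀ (n : ℕ) (v : V), v ∈ S →
    lev v = n → ∃ T ⊆ S, ConnOn G T ∧ v ∈ T ∧ r ∈ T ∧ ∀ u ∈ T, u ≠ v → lev u < n := by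
  intro n
  induction n with
  | zero =>
    intro v hv hn
    obtain rfl := h.eq_root hv hn
    exact ⟨{v}, by simpa using hv, ConnOn.singleton v, rfl, rfl, fun u hu hne => absurd hu hne⟩
  | succ n ih =>
    intro v hv hn
    have hne := h.ne_root (v := v) (by omega)
    have hl := h.par_lev v hv hne
    obtain ⟨T, hTS, hT, h1, h2, h3⟩ := ih (par v) (h.par_mem v hv hne) (by omega)
    refine ⟨{v} ∪ T, by simp [Set.insert_subset_iff, hv, hTS],
      (ConnOn.singleton v).union hT ⟨v, rfl, par v, h1, .inr (h.par_adj v hv hne).symm⟩,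
      .inl rfl, .inr h2, ?_⟩
    rintro u (hu | hu) huv
    · exact absurd hu huv
    · by_cases e : u = par v
      · rw [e]; omega
      · have := h3 u hu e; omega

end Levelling

/-- Distinct vertices at distance at least three. -/
def Far (G : SimpleGraph V) (a b : V) : Prop := a ≠ b ∧ ¬ G.Adj a b ∧ ∀ w, G.Adj a w → ¬ G.Adj b w

theorem Far.symm {a b : V} (h : Far G a b) : Far G b a :=
  ⟨h.1.symm, fun h' => h.2.1 h'.symm, fun w h1 h2 => h.2.2 w h2 h1⟩

/-- The bipartite connected set that joins a few letters of a level through the levels above. -/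
theorem Levelling.exists_link [Finite V] (hG : 11 ≤ G.oddGirth) {S : Set V} {r : V} {lev : V → ℕ}
    {par : V → V} (h : Levelling G S r lev par) {m : ℕ} (hm : 0 < m) {ps : List V}
    (hlen : ps.length ≤ 10)
    (hps : ∀ p ∈ ps, p ∈ S ∧ lev p = m) (hfar : ∀ p ∈ ps, ∀ q ∈ ps, p ≠ q → Far G p q) :
    ∃ A B, (∀ v ∈ A, v ∉ B) ∧ StableOn G A ∧ StableOn G B ∧ ConnOn G (A ∪ B) ∧
      (∀ v ∈ A ∪ B, v ∈ S ∧ lev v < m) ∧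
      ∀ p ∈ ps, par p ∈ A ∪ B ∧ G.Adj p (par p) ∧ ∀ w ∈ A ∪ B, G.Adj p w → w = par p := by
  have hpar : ∀ p ∈ ps, par p ∈ S ∧ lev (par p) + 1 = m ∧ G.Adj (par p) p := by
    intro p hp
    obtain ⟨h1, h2⟩ := hps p hp
    have hne := h.ne_root (v := p) (by omega)
    exact ⟨h.par_mem p h1 hne, by rw [h.par_lev p h1 hne, h2], h.par_adj p h1 hne⟩
  have hT : ∀ p : {p // p ∈ ps}, ∃ T ⊆ S, ConnOn G T ∧ par p ∈ T ∧ r ∈ T ∧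
      ∀ u ∈ T, u ≠ par p → lev u < m - 1 := by
    rintro ⟨p, hp⟩
    obtain ⟨h1, h2, -⟩ := hpar p hp
    exact h.exists_ancestors (m - 1) (par p) h1 (by omega)
  choose T hTS hTc hTp hTr hTl using hT
  have hW : ConnOn G ({r} ∪ ⋃ p, T p) :=
    (ConnOn.singleton r).biUnion hTc (fun p => ⟨r, hTr p, r, rfl, .inl rfl⟩)
  -- The last clause is what matters: in level `m - 1` the union has only the parents of the given
  -- letters, or the root.
  have hWm : ∀ v ∈ ({r} ∪ ⋃ p, T p : Set V), v ∈ S ∧ lev v < m ∧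
      (lev v + 1 = m → v = r ∨ ∃ p ∈ ps, v = par p) := by
    rintro v (hv | hv)
    · rw [Set.mem_singleton_iff] at hv
      subst hv
      exact ⟨h.root_mem, by rw [h.root]; exact hm, fun _ => .inl rfl⟩
    · obtain ⟨⟨p, hp⟩, hv⟩ := Set.mem_iUnion.1 hv
      have hl := (hpar p hp).2.1
      by_cases e : v = par p
      · exact ⟨hTS _ hv, by rw [e]; omega, fun _ => .inr ⟨p, hp, e⟩⟩
      · have := hTl _ v hv e
        exact ⟨hTS _ hv, by omega, by omega⟩
  obtain ⟨Q, hQW, hQ, hQS, hQ2⟩ := exists_connOn_bipartite hG hW (S := ps.map par) (by simpa)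
    (by
      intro s hs
      obtain ⟨p, hp, rfl⟩ := List.mem_map.1 hs
      exact .inr (Set.mem_iUnion.2 ⟨⟨p, hp⟩, hTp ⟨p, hp⟩⟩))
  obtain ⟨A, B, rfl, hAB, hA, hB⟩ := hQ2.exists_bipartition
  refine ⟨A, B, hAB, hA, hB, hQ, fun v hv => ⟨(hWm v (hQW hv)).1, (hWm v (hQW hv)).2.1⟩, ?_⟩
  intro p hp
  obtain ⟨h1, h2, h3⟩ := hpar p hp
  refine ⟨hQS _ (List.mem_map.2 ⟨p, hp, rfl⟩), h3.symm, ?_⟩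
  intro w hw hpw
  obtain ⟨h4, h5, h6⟩ := hWm w (hQW hw)
  have hl := h.lev_le w h4 p (hps p hp).1 hpw.symm
  rw [(hps p hp).2] at hl
  rcases h6 (by omega) with rfl | ⟨q, hq, rfl⟩
  · rw [h.root] at hl
    exact (h.eq_root h1 (by omega)).symm
  -- A second neighbour `par q` of `p` would be a common neighbour of the far letters `p` and `q`.
  · by_contra hne
    refine (hfar p hp q hq (fun e => hne (by rw [e]))).2.2 _ hpw (hpar q hq).2.2.symm

/-- Two of three vertices lie in the same part of a bipartition. -/
theorem exists_pair_same_class {A B : Set V} {a b c : V} (ha : a ∈ A ∪ B) (hb : b ∈ A ∪ B)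
    (hc : c ∈ A ∪ B) : ((a ∈ A ∧ b ∈ A) ∨ (a ∈ A ∧ c ∈ A) ∨ (b ∈ A ∧ c ∈ A)) ∨
      ((a ∈ B ∧ b ∈ B) ∨ (a ∈ B ∧ c ∈ B) ∨ (b ∈ B ∧ c ∈ B)) := by
  rcases ha with ha | ha <;> rcases hb with hb | hb <;> rcases hc with hc | hc <;> tauto

/-! ### Vertices near a letter -/

/-- Such a `z` has a walk of length two or three to `a`. Two adjacent vertices with walks of equal
length would give a closed walk of length five or seven. -/
theorem colOn_near (hG : 11 ≤ G.oddGirth) (a : V) :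
    ColOn G {z | ∃ b, G.Adj z b ∧ ¬ Far G a b} 2 := by
  have h3 : StableOn G {z | ∃ b c, G.Adj z b ∧ G.Adj b c ∧ G.Adj c a} := by
    rintro u ⟨b, c, h1, h2, h3⟩ v ⟨b', c', h1', h2', h3'⟩ huv
    exact not_closed_seven hG huv.symm h1 h2 h3 h3'.symm h2'.symm h1'.symm
  have h2 : StableOn G {z | ∃ b, G.Adj z b ∧ G.Adj b a} := by
    rintro u ⟨b, h1, h2⟩ v ⟨b', h1', h2'⟩ huv
    exact not_closed_five hG huv.symm h1 h2 h2'.symm h1'.symm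
  refine h3.colOn.of_cover h2.colOn ?_ le_rfl
  rintro z ⟨b, hzb, hb⟩
  by_cases e : a = b
  · subst e
    -- The walk of length three is `z`, `a`, `z`, `a`.
    exact .inl ⟨a, z, hzb, hzb.symm, hzb⟩
  by_cases e' : G.Adj a b
  · exact .inr ⟨b, hzb, e'.symm⟩
  have : ∃ w, G.Adj a w ∧ G.Adj b w := by
    by_contra hc
    push Not at hc
    exact hb ⟨e, e', hc⟩
  obtain ⟨w, h1, h2⟩ := this
  exact .inl ⟨b, w, hzb, h2, h1.symm⟩

theorem stableOn_letter_adj (hG : 11 ≤ G.oddGirth) (g : V) :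
    StableOn G {z | ∃ b, G.Adj z b ∧ G.Adj b g} := by
  rintro u ⟨b, h1, h2⟩ v ⟨b', h1', h2'⟩ huv
  exact not_closed_five hG huv.symm h1 h2 h2'.symm h1'.symm

theorem stableOn_neighbor (hG : 11 ≤ G.oddGirth) (g : V) : StableOn G {z | G.Adj z g} :=
  fun _ hu _ hv huv => not_closed_three hG huv hv (G.adj_symm hu)

/-! ### Letters that see an induced path in one parity class only -/

/-- The vertices of `l` at positions of parity `ε`. -/
def parityClass (l : List V) (ε : ℕ) : Set V := {v | ∃ i, ∃ h : i < l.length, v = l[i] ∧ i % 2 = ε}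

theorem IndPath.stableOn_parityClass {l : List V} (hl : IndPath G l) (ε : ℕ) :
    StableOn G (parityClass l ε) := by
  rintro _ ⟨i, hi, rfl, hiε⟩ _ ⟨j, hj, rfl, hjε⟩ hij
  rcases lt_trichotomy i j with h | rfl | h
  · have := (hl.getElem h hj).2.1 hij; omega
  · exact G.irrefl hij
  · have := (hl.getElem h hi).2.1 hij.symm; omega

theorem parityClass_union {l : List V} {ε : ℕ} (hε : ε < 2) :
    parityClass l (1 - ε) ∪ parityClass l ε = {v | v ∈ l} := by
  ext v
  constructor
  · rintro (⟨i, hi, rfl, -⟩ | ⟨i, hi, rfl, -⟩) <;> exact List.getElem_mem hi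
  · intro hv
    obtain ⟨i, hi, rfl⟩ := List.getElem_of_mem hv
    by_cases h : i % 2 = ε
    · exact .inr ⟨i, hi, rfl, h⟩
    · exact .inl ⟨i, hi, rfl, by omega⟩

theorem parityClass_subset {l : List V} {ε : ℕ} {v : V} (h : v ∈ parityClass l ε) : v ∈ l := by
  obtain ⟨i, hi, rfl, -⟩ := h
  exact List.getElem_mem hi

theorem IndPath.not_mem_parityClass {l : List V} (hl : IndPath G l) {ε ε' : ℕ} (h : ε ≠ ε') {v : V}
    (hv : v ∈ parityClass l ε) : v ∉ parityClass l ε' := by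
  rintro ⟨j, hj, e, hj'⟩
  obtain ⟨i, hi, rfl, hi'⟩ := hv
  rw [hl.nodup.getElem_inj_iff] at e
  omega

/-- The letters induce a bipartite graph: on an odd hole of letters, the path `l` is a hub that
meets every vertex, in the class of parity `ε`. For each colour class of letters, `l` together with
these letters is again a bipartite hub, now with the vertices of parity `ε` as centres. Every vertex
of `F` with its letter in the class sees this hub through that letter, so these vertices contain no
odd hole either. -/
theorem colOn_of_pure [Finite V] (hno : ¬ HasOddWheel G) {l : List V} (hl : IndPath G l)
    {F : Set V} {p : V → V} {ε : ℕ} (hε : ε < 2) (hadj : ∀ z ∈ F, G.Adj z (p z))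
    (hFl : ∀ z ∈ F, z ∉ l ∧ ∀ v ∈ l, ¬ G.Adj z v) (hpl : ∀ z ∈ F, p z ∉ l)
    (hpF : ∀ z ∈ F, ∀ z' ∈ F, p z ≠ z')
    (hhit : ∀ z ∈ F, ∃ v ∈ l, G.Adj (p z) v)
    (hpar : ∀ z ∈ F, ∀ v ∈ l, G.Adj (p z) v → v ∈ parityClass l ε) : ColOn G F 4 := by
  have hlc : ConnOn G (parityClass l (1 - ε) ∪ parityClass l ε) := by
    rw [parityClass_union hε]; exact connOn_of_indPath hl
  have h1 : ColOn G (p '' F) 2 := by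
    refine colOn_two fun O hO hodd hOP => hno ?_
    have hO' : ∀ v ∈ O, ∃ z ∈ F, v = p z := fun v hv => by
      obtain ⟨z, hz, e⟩ := hOP v hv; exact ⟨z, hz, e.symm⟩
    refine hasOddWheel_of_dominating_hub hO hodd
      (fun v hv => hl.not_mem_parityClass (by omega) hv) hlc
      (hl.stableOn_parityClass _) (hl.stableOn_parityClass _) ?_ ?_
    · intro v hv
      obtain ⟨z, hz, rfl⟩ := hO' v hv
      refine ⟨fun h => hpl z hz (parityClass_subset h), fun h => hpl z hz (parityClass_subset h),
        fun a ha haz => ?_⟩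
      exact hl.not_mem_parityClass (by omega) ha (hpar z hz a (parityClass_subset ha) haz)
    · intro v hv
      obtain ⟨z, hz, rfl⟩ := hO' v hv
      obtain ⟨w, hw, hzw⟩ := hhit z hz
      exact ⟨w, hpar z hz w hw hzw, hzw⟩
  obtain ⟨A, B, hAB, -, hA, hB⟩ := h1.exists_bipartition
  have key : ∀ A : Set V, StableOn G A → ColOn G {z | z ∈ F ∧ p z ∈ A} 2 := by
    intro A hA
    refine colOn_two fun O hO hodd hOF => hno ?_
    let P : Set V := {q | q ∈ A ∧ ∃ z ∈ F, q = p z}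
    have e : parityClass l ε ∪ (parityClass l (1 - ε) ∪ P) = {v | v ∈ l} ∪ ⋃ q : P, {q.1} := by
      rw [← Set.union_assoc, Set.union_comm (parityClass l ε), parityClass_union hε]
      simp
    have hPl : ∀ q ∈ P, q ∉ l := by
      rintro q ⟨-, z, hz, rfl⟩; exact hpl z hz
    refine hasOddWheel_of_dominating_hub (A := parityClass l ε) (B := parityClass l (1 - ε) ∪ P)
      hO hodd ?_ ?_ (hl.stableOn_parityClass _) ?_ ?_ ?_
    · rintro v hv (hv' | hv')
      · exact hl.not_mem_parityClass (by omega) hv hv'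
      · exact hPl v hv' (parityClass_subset hv)
    · rw [e]
      refine (connOn_of_indPath hl).biUnion (fun q => ConnOn.singleton _) ?_
      rintro ⟨q, hqA, z, hz, rfl⟩
      obtain ⟨w, hw, hzw⟩ := hhit z hz
      exact ⟨_, rfl, w, hw, .inr hzw⟩
    · have aux : ∀ u ∈ parityClass l (1 - ε), ∀ v ∈ P, ¬ G.Adj u v := by
        rintro u hu v ⟨-, z, hz, rfl⟩ huv
        exact hl.not_mem_parityClass (by omega) hu (hpar z hz u (parityClass_subset hu) huv.symm)
      rintro u (hu | hu) v (hv | hv) huv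
      · exact hl.stableOn_parityClass _ u hu v hv huv
      · exact aux u hu v hv huv
      · exact aux v hv u hu huv.symm
      · exact hA u hu.1 v hv.1 huv
    · intro v hv
      have hvF := (hOF v hv).1
      refine ⟨fun h => (hFl v hvF).1 (parityClass_subset h), ?_,
        fun a ha => (hFl v hvF).2 a (parityClass_subset ha)⟩
      rintro (h | ⟨-, z, hz, e⟩)
      · exact (hFl v hvF).1 (parityClass_subset h)
      · exact hpF z hz v hvF e.symm
    · intro v hv
      exact ⟨p v, .inr ⟨(hOF v hv).2, v, (hOF v hv).1, rfl⟩, hadj v (hOF v hv).1⟩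
  refine (key A hA).of_cover (key B hB) ?_ le_rfl
  intro z hz
  have : p z ∈ A ∪ B := hAB ▸ Set.mem_image_of_mem p hz
  exact this.imp (fun h => ⟨hz, h⟩) (fun h => ⟨hz, h⟩)

/-! ### First hits and parity changes -/

/-- The first position of `l` that `q` sees (and `l.length` if there is none). -/
noncomputable def firstHit (G : SimpleGraph V) (l : List V) (q : V) : ℕ :=
  sInf {i | i = l.length ∨ ∃ h : i < l.length, G.Adj q l[i]}

/-- The first position of `l` that `q` sees at which the parity differs from the first hit. -/
noncomputable def firstTurn (G : SimpleGraph V) (l : List V) (q : V) : ℕ :=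
  sInf {i | i = l.length ∨ ∃ h : i < l.length, G.Adj q l[i] ∧ i % 2 ≠ firstHit G l q % 2}

theorem firstTurn_le (l : List V) (q : V) : firstTurn G l q ≤ l.length := Nat.sInf_le (.inl rfl)

theorem firstHit_le_of_adj {l : List V} {q : V} {i : ℕ} (h : i < l.length) (hi : G.Adj q l[i]) :
    firstHit G l q ≤ i := Nat.sInf_le (.inr ⟨h, hi⟩)

theorem adj_firstHit {l : List V} {q : V} (h : firstHit G l q < l.length) :
    G.Adj q l[firstHit G l q] := by
  have := Nat.sInf_mem (s := {i | i = l.length ∨ ∃ h : i < l.length, G.Adj q l[i]}) ⟨_, .inl rfl⟩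
  rcases this with h' | ⟨_, h'⟩
  · exact absurd h' h.ne
  · exact h'

theorem firstHit_lt {l : List V} {q : V} (h : ∃ v ∈ l, G.Adj q v) :
    firstHit G l q < l.length := by
  obtain ⟨v, hv, hq⟩ := h
  obtain ⟨i, hi, rfl⟩ := List.getElem_of_mem hv
  exact (firstHit_le_of_adj hi hq).trans_lt hi

theorem parity_of_lt_firstTurn {l : List V} {q : V} {i : ℕ} (h : i < firstTurn G l q)
    (hi : i < l.length) (hq : G.Adj q l[i]) : i % 2 = firstHit G l q % 2 := by
  by_contra hc
  exact absurd h (not_lt.2 (Nat.sInf_le (.inr ⟨hi, hq, hc⟩)))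

theorem adj_firstTurn {l : List V} {q : V} (h : firstTurn G l q < l.length) :
    G.Adj q l[firstTurn G l q] ∧ firstTurn G l q % 2 ≠ firstHit G l q % 2 := by
  have := Nat.sInf_mem (s := {i | i = l.length ∨ ∃ h : i < l.length, G.Adj q l[i] ∧
    i % 2 ≠ firstHit G l q % 2}) ⟨_, .inl rfl⟩
  rcases this with h' | ⟨_, h'⟩
  · exact absurd h' h.ne
  · exact h'

theorem firstHit_lt_firstTurn {l : List V} {q : V} (h : firstTurn G l q < l.length) :
    firstHit G l q < firstTurn G l q := by
  have h1 := adj_firstTurn h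
  have h2 := firstHit_le_of_adj h h1.1
  rcases h2.lt_or_eq with h3 | h3
  · exact h3
  · exact absurd (by rw [h3]) h1.2

/-- Three far letters with disjoint ranges up to their first turns. -/
theorem exists_three_letters (hG : 11 ≤ G.oddGirth) {F : Set V} {p : V → V} {s t : V → ℕ} {N : ℕ}
    (hadj : ∀ z ∈ F, G.Adj z (p z))
    (hcol : ∀ τ, ColOn G {z | z ∈ F ∧ s z < τ ∧ τ ≤ t z} N)
    (hF : ¬ ColOn G F (2 * (N + 2))) :
    ∃ x ∈ F, ∃ y ∈ F, ∃ z ∈ F, Far G (p x) (p y) ∧ Far G (p x) (p z) ∧ Far G (p y) (p z) ∧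
      t x ≤ s y ∧ t x ≤ s z ∧ t y ≤ s z := by
  have step : ∀ F' ⊆ F, ∀ M, ¬ ColOn G F' (M + (N + 2)) → ∃ x ∈ F',
      ¬ ColOn G {z | z ∈ F' ∧ Far G (p x) (p z) ∧ t x ≤ s z} M := by
    intro F' hF' M hM
    have hne := nonempty_of_not_colOn hM
    -- As `t x` is minimal, a vertex `z` with `s z < t x` also has `t x ≤ t z`; these vertices need
    -- `N` colours. Two more colours serve those whose letter is not far from that of `x`.
    obtain ⟨x, hx, hmin⟩ := exists_minimalFor_of_wellFoundedLT (fun z => z ∈ F') t hne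
    refine ⟨x, hx, fun hc => hM ?_⟩
    refine hc.of_cover ((hcol (t x)).union (colOn_near hG (p x))) (fun z hz => ?_) le_rfl
    by_cases h1 : Far G (p x) (p z)
    · by_cases h2 : t x ≤ s z
      · exact .inl ⟨hz, h1, h2⟩
      · have := hmin hz
        refine .inr (.inl ⟨hF' hz, by omega, ?_⟩)
        by_contra h3
        exact h3 (this (by omega))
    · exact .inr (.inr ⟨p z, hadj z (hF' hz), h1⟩)
  obtain ⟨x, hx, h1⟩ := step F subset_rfl (N + 2) (by rwa [two_mul] at hF)
  obtain ⟨y, hy, h2⟩ := step {z | z ∈ F ∧ Far G (p x) (p z) ∧ t x ≤ s z}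
    (fun z hz => hz.1) 0 (by rwa [zero_add])
  obtain ⟨z, hz⟩ := nonempty_of_not_colOn h2
  exact ⟨x, hx, y, hy.1, z, hz.1.1, hy.2.1, hz.1.2.1, hz.2.1, hy.2.2, hz.1.2.2, hz.2.2⟩

/-! ### Colouring the vertices whose letters see a hole, or both sides of a hole -/

section Floor

variable {S : Set V} {r : V} {lev : V → ℕ} {par : V → V} {m : ℕ}

/-- Two of three far letters are joined to the same class of a bipartite connected set in the
levels above. -/
theorem Levelling.exists_even_link [Finite V] (hG : 11 ≤ G.oddGirth)
    (h : Levelling G S r lev par) (hm : 0 < m) {x y z : V} (hx : x ∈ S ∧ lev x = m)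
    (hy : y ∈ S ∧ lev y = m) (hz : z ∈ S ∧ lev z = m) (hxy : Far G x y) (hxz : Far G x z)
    (hyz : Far G y z) :
    ∃ A B, (∀ v ∈ A, v ∉ B) ∧ StableOn G A ∧ StableOn G B ∧ ConnOn G (A ∪ B) ∧
      (∀ v ∈ A ∪ B, v ∈ S ∧ lev v < m) ∧
      ∃ p q, ((p = x ∧ q = y) ∨ (p = x ∧ q = z) ∨ (p = y ∧ q = z)) ∧
        (par p ∈ A ∧ G.Adj p (par p) ∧ ∀ w ∈ A ∪ B, G.Adj p w → w = par p) ∧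
        (par q ∈ A ∧ G.Adj q (par q) ∧ ∀ w ∈ A ∪ B, G.Adj q w → w = par q) := by
  obtain ⟨A, B, hAB, hA, hB, hc, hl, hp⟩ := h.exists_link hG hm (ps := [x, y, z]) (by simp)
    (by simp [hx, hy, hz]) (by simp [hxy, hxz, hyz, hxy.symm, hxz.symm, hyz.symm])
  obtain ⟨x1, x2, x3⟩ := hp x (by simp)
  obtain ⟨y1, y2, y3⟩ := hp y (by simp)
  obtain ⟨z1, z2, z3⟩ := hp z (by simp)
  rcases exists_pair_same_class x1 y1 z1 with (⟨h1, h2⟩ | ⟨h1, h2⟩ | ⟨h1, h2⟩) |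
    (⟨h1, h2⟩ | ⟨h1, h2⟩ | ⟨h1, h2⟩)
  · exact ⟨A, B, hAB, hA, hB, hc, hl, x, y, by simp, ⟨h1, x2, x3⟩, h2, y2, y3⟩
  · exact ⟨A, B, hAB, hA, hB, hc, hl, x, z, by simp, ⟨h1, x2, x3⟩, h2, z2, z3⟩
  · exact ⟨A, B, hAB, hA, hB, hc, hl, y, z, by simp, ⟨h1, y2, y3⟩, h2, z2, z3⟩
  all_goals
    rw [Set.union_comm] at hc hl x3 y3 z3
  · exact ⟨B, A, fun v hv hv' => hAB v hv' hv, hB, hA, hc, hl, x, y, by simp, ⟨h1, x2, x3⟩, h2, y2, y3⟩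
  · exact ⟨B, A, fun v hv hv' => hAB v hv' hv, hB, hA, hc, hl, x, z, by simp, ⟨h1, x2, x3⟩, h2, z2, z3⟩
  · exact ⟨B, A, fun v hv hv' => hAB v hv' hv, hB, hA, hc, hl, y, z, by simp, ⟨h1, y2, y3⟩, h2, z2, z3⟩

theorem Levelling.letter (h : Levelling G S r lev par) {z : V} (hz : z ∈ S ∧ lev z = m + 1) :
    (par z ∈ S ∧ lev (par z) = m) ∧ G.Adj z (par z) := by
  have hne := h.ne_root (v := z) (by omega)
  have := h.par_lev z hz.1 hne
  exact ⟨⟨h.par_mem z hz.1 hne, by omega⟩, (h.par_adj z hz.1 hne).symm⟩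

/-- The vertices whose letters see an initial segment of an induced path in one parity class. -/
theorem Levelling.colOn_pure [Finite V] (hno : ¬ HasOddWheel G) (h : Levelling G S r lev par)
    {l : List V} (hl : IndPath G l) (hlS : ∀ v ∈ l, v ∈ S ∧ lev v = m + 1) {F : Set V}
    (hF : ∀ z ∈ F, z ∈ S ∧ lev z = m + 1) (hFl : ∀ z ∈ F, z ∉ l ∧ ∀ v ∈ l, ¬ G.Adj z v) {ε : ℕ}
    (hε : ε < 2) (τ : ℕ) :
    ColOn G {z | z ∈ F ∧ firstHit G l (par z) < τ ∧ τ ≤ firstTurn G l (par z) ∧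
      firstHit G l (par z) % 2 = ε} 4 := by
  -- No first turn exceeds the length of `l`, so for larger `τ` the set is empty.
  rcases le_or_gt τ l.length with hτ | hτ
  swap
  · refine (colOn_empty 4).mono ?_ le_rfl
    rintro z ⟨-, -, h1, -⟩
    have := firstTurn_le (G := G) l (par z)
    omega
  -- The path is cut at `τ`: these letters hit the remaining part, and in one parity class only, as
  -- their first turn does not come before `τ`.
  have hlen : (l.take τ).length = τ := by simp [hτ]
  have hl' : IndPath G (l.take τ) := hl.of_infix (List.take_prefix τ l).isInfix
  have hmem : ∀ v ∈ l.take τ, v ∈ l := fun v hv => List.mem_of_mem_take hv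
  refine colOn_of_pure hno hl' (p := par) hε (fun z hz => (h.letter (hF z hz.1)).2)
    (fun z hz => ⟨fun hz' => (hFl z hz.1).1 (hmem z hz'),
      fun v hv => (hFl z hz.1).2 v (hmem v hv)⟩) ?_ ?_ ?_ ?_
  · intro z hz hz'
    have h1 := (h.letter (hF z hz.1)).1.2
    have h2 := (hlS _ (hmem _ hz')).2
    omega
  · intro z hz z' hz' e
    have h1 := (h.letter (hF z hz.1)).1.2
    have h2 := (hF z' hz'.1).2
    rw [e] at h1
    omega
  · intro z hz
    exact ⟨_, by
      rw [← List.getElem_take (j := τ) (h := by rw [hlen]; exact hz.2.1)]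
      exact List.getElem_mem _, adj_firstHit (hz.2.1.trans_le hτ)⟩
  · intro z hz v hv hzv
    obtain ⟨i, hi, rfl⟩ := List.getElem_of_mem hv
    refine ⟨i, hi, rfl, ?_⟩
    rw [List.getElem_take] at hzv
    rw [hlen] at hi
    rw [parity_of_lt_firstTurn (hi.trans_le hz.2.2.1) (by omega) hzv, hz.2.2.2]

/-- Without one vertex `o` the hole is an induced path. A letter that sees both parity classes of
the path spans an odd arc from its first hit to its first turn. Two such letters with successive
ranges, joined to the same class of a link, form a hub with two disjoint odd arcs; hence these
vertices need only `20 = 2 * (8 + 2)` colours. Letters that see a single parity class cost 8 more,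
and those that see `o` cost 1. -/
theorem Levelling.colOn_hole [Finite V] (hG : 11 ≤ G.oddGirth) (hno : ¬ HasOddWheel G)
    (h : Levelling G S r lev par) (hm : 0 < m) {O : List V} (hO : IndCyc G O) (hodd : Odd O.length)
    (hOS : ∀ v ∈ O, v ∈ S ∧ lev v = m + 1) {F : Set V} (hF : ∀ z ∈ F, z ∈ S ∧ lev z = m + 1)
    (hFO : ∀ z ∈ F, z ∉ O ∧ ∀ v ∈ O, ¬ G.Adj z v) :
    ColOn G {z | z ∈ F ∧ ∃ v ∈ O, G.Adj (par z) v} 29 := by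
  obtain ⟨o, l, rfl⟩ : ∃ o l, O = o :: l := by
    rcases O with _ | ⟨o, l⟩
    · exact hO.elim
    · exact ⟨o, l, rfl⟩
  have hl : IndPath G l := hO.2.1
  have hlS : ∀ v ∈ l, v ∈ S ∧ lev v = m + 1 := fun v hv => hOS v (List.mem_cons_of_mem _ hv)
  have hFl : ∀ z ∈ F, z ∉ l ∧ ∀ v ∈ l, ¬ G.Adj z v := fun z hz =>
    ⟨fun h' => (hFO z hz).1 (List.mem_cons_of_mem _ h'),
      fun v hv => (hFO z hz).2 v (List.mem_cons_of_mem _ hv)⟩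
  set s : V → ℕ := fun z => firstHit G l (par z) with hs
  set t : V → ℕ := fun z => firstTurn G l (par z) with ht
  have hcol : ∀ τ, ColOn G {z | z ∈ F ∧ s z < τ ∧ τ ≤ t z} 8 := by
    intro τ
    refine (h.colOn_pure hno hl hlS hF hFl (ε := 0) (by omega) τ).of_cover
      (h.colOn_pure hno hl hlS hF hFl (ε := 1) (by omega) τ) ?_ (by omega)
    rintro z ⟨h1, h2, h3⟩
    rcases Nat.mod_two_eq_zero_or_one (s z) with h4 | h4
    · exact .inl ⟨h1, h2, h3, h4⟩
    · exact .inr ⟨h1, h2, h3, h4⟩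
  have hrest : ColOn G {z | z ∈ F ∧ t z < l.length} 20 := by
    by_contra hc
    obtain ⟨x, hx, y, hy, z, hz, hxy, hxz, hyz, h1, h2, h3⟩ :=
      exists_three_letters hG (p := par) (s := s) (t := t) (N := 8)
        (fun z (hz : z ∈ {z | z ∈ F ∧ t z < l.length}) => (h.letter (hF z hz.1)).2)
        (fun τ => (hcol τ).mono (fun z hz => ⟨hz.1.1, hz.2⟩) le_rfl) hc
    obtain ⟨A, B, hAB, hA, hB, hc', hl', p, q, hpq, hp, hq⟩ := h.exists_even_link hG hm
      (h.letter (hF x hx.1)).1 (h.letter (hF y hy.1)).1 (h.letter (hF z hz.1)).1 hxy hxz hyz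
    obtain ⟨u, v, hu, hv, rfl, rfl, hfar, htu⟩ : ∃ u v, (u ∈ F ∧ t u < l.length) ∧
        (v ∈ F ∧ t v < l.length) ∧ p = par u ∧ q = par v ∧ Far G (par u) (par v) ∧ t u ≤ s v := by
      rcases hpq with ⟨rfl, rfl⟩ | ⟨rfl, rfl⟩ | ⟨rfl, rfl⟩
      · exact ⟨x, y, hx, hy, rfl, rfl, hxy, h1⟩
      · exact ⟨x, z, hx, hz, rfl, rfl, hxz, h2⟩
      · exact ⟨y, z, hy, hz, rfl, rfl, hyz, h3⟩
    have hlu := (h.letter (hF u hu.1)).1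
    have hlv := (h.letter (hF v hv.1)).1
    have t1 := adj_firstTurn hu.2
    have t2 := adj_firstTurn hv.2
    have s1 := firstHit_lt_firstTurn hu.2
    have s2 := firstHit_lt_firstTurn hv.2
    have a1 := adj_firstHit (s1.trans hu.2)
    have a2 := adj_firstHit (s2.trans hv.2)
    have hlevB : ∀ w ∈ A ∪ (B ∪ {par u, par v}), lev w ≤ m := by
      rintro w (hw | hw | rfl | rfl)
      · exact (hl' w (.inl hw)).2.le
      · exact (hl' w (.inr hw)).2.le
      · exact hlu.2.le
      · exact hlv.2.le
    -- Positions on the hole `o :: l` are those on `l` plus one.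
    refine hno (hasOddWheel_of_hub hO hodd (A := A) (B := B ∪ {par u, par v}) ?_ ?_ hA ?_ ?_
      (a := s u + 1) (b := t u + 1) (c := s v + 1) (d := t v + 1) ?_ ?_ ?_ ?_ ?_ ?_ ?_ ?_)
    · rintro w hw (hw' | rfl | rfl)
      · exact hAB w hw hw'
      · have := (hl' _ (.inl hw)).2; omega
      · have := (hl' _ (.inl hw)).2; omega
    · rw [show A ∪ (B ∪ {par u, par v}) = (A ∪ B ∪ {par u}) ∪ {par v} by
        ext w; simp; tauto]
      refine (hc'.union (ConnOn.singleton _) ⟨par (par u), .inl hp.1, _, rfl, .inr hp.2.1.symm⟩).union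
        (ConnOn.singleton _) ⟨par (par v), .inl (.inl hq.1), _, rfl, .inr hq.2.1.symm⟩
    · have aux : ∀ w ∈ B, ∀ b, (b = par u ∨ b = par v) → ¬ G.Adj b w := by
        rintro w hw b (rfl | rfl) hbw
        · exact hAB _ hp.1 (hp.2.2 w (.inr hw) hbw ▸ hw)
        · exact hAB _ hq.1 (hq.2.2 w (.inr hw) hbw ▸ hw)
      rintro a (ha | ha) b (hb | hb) hab
      · exact hB a ha b hb hab
      · exact aux a ha b hb hab.symm
      · exact aux b hb a ha hab
      · rcases ha with rfl | rfl <;> rcases hb with rfl | rfl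
        · exact G.irrefl hab
        · exact hfar.2.1 hab
        · exact hfar.2.1 hab.symm
        · exact G.irrefl hab
    · intro w hw
      have hwl := hOS w hw
      refine ⟨fun h' => ?_, fun h' => ?_, fun a ha haw => ?_⟩
      · have := hlevB w (.inl h'); omega
      · have := hlevB w (.inr h'); omega
      · have h5 := hl' a (.inl ha)
        have := h.lev_le a h5.1 w hwl.1 haw.symm
        omega
    · rw [Nat.odd_iff]; simp only [hs, ht]; omega
    · omega
    · rw [Nat.odd_iff]; simp only [hs, ht]; omega
    · have := hv.2; simp only [List.length_cons]; omega
    · exact ⟨par u, .inr (.inl rfl), by simpa using a1.symm⟩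
    · exact ⟨par u, .inr (.inl rfl), by simpa using t1.1.symm⟩
    · exact ⟨par v, .inr (.inr rfl), by simpa using a2.symm⟩
    · exact ⟨par v, .inr (.inr rfl), by simpa using t2.1.symm⟩
  refine (hrest.union (hcol l.length)).of_cover (stableOn_letter_adj hG o).colOn ?_ (by omega)
  rintro z ⟨hz, v, hv, hzv⟩
  rcases List.mem_cons.1 hv with rfl | hv
  · exact .inr ⟨par z, (h.letter (hF z hz)).2, hzv⟩
  · have h1 := firstHit_lt ⟨v, hv, hzv⟩
    by_cases h2 : t z < l.length
    · exact .inl (.inl ⟨hz, h2⟩)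
    · exact .inl (.inr ⟨hz, h1, by omega⟩)

end Floor

theorem exists_split_firstHit {l : List V} {q : V} (h : firstHit G l q < l.length) :
    ∃ l₁ g l₂, l = l₁ ++ g :: l₂ ∧ l₁.length = firstHit G l q ∧ G.Adj q g ∧
      ∀ v ∈ l₁, ¬ G.Adj q v := by
  refine ⟨l.take (firstHit G l q), l[firstHit G l q], l.drop (firstHit G l q + 1), ?_, by
    simp [h.le], adj_firstHit h, ?_⟩
  · rw [List.cons_getElem_drop_succ, List.take_append_drop]
  · intro v hv hqv
    obtain ⟨i, hi, rfl⟩ := List.getElem_of_mem hv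
    rw [List.getElem_take] at hqv
    have hi' : i < firstHit G l q := by
      rw [List.length_take] at hi; omega
    have := firstHit_le_of_adj _ hqv
    omega

/-- A vertex that sees exactly the two ends of an induced path closes it to an induced cycle. -/
theorem indCyc_cons {q g h : V} {mid : List V} (hl : IndPath G (g :: (mid ++ [h])))
    (hq : q ∉ g :: (mid ++ [h])) (hg : G.Adj q g) (hh : G.Adj q h)
    (hm : ∀ v ∈ mid, ¬ G.Adj q v) : IndCyc G (q :: g :: (mid ++ [h])) := by
  refine ⟨by simp, hl, ?_⟩
  intro a ha b hb
  obtain rfl := List.mem_singleton.1 ha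
  refine ⟨fun e => hq (e ▸ hb), ?_⟩
  have e : (g :: (mid ++ [h])).getLast? = some h := by
    rw [← List.cons_append, List.getLast?_append]; simp
  rw [e]
  simp only [List.getLast?_singleton, List.head?_cons, true_and, Option.some_inj]
  rw [List.mem_cons, List.mem_append, List.mem_singleton] at hb
  constructor
  · intro hab
    rcases hb with rfl | hb | rfl
    · exact .inl rfl
    · exact absurd hab (hm b hb)
    · exact .inr rfl
  · rintro (rfl | rfl)
    · exact hg
    · exact hh

section Floor

variable {S : Set V} {r : V} {lev : V → ℕ} {par : V → V} {m : ℕ}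

/-- A letter of this kind closes an odd hole with the part of the path between its first hits to the
left and to the right of `Md`. Of three far letters with successive ranges on `Lf`, two are joined
to the same class of a link. The one with the later range closes the hole; the other one has its
first hit and first turn on that hole and belongs to the hub. The vertex of the hole off the path
sees the hub through its parent, which is the situation of `hasOddWheel_of_switch`. -/
theorem Levelling.colOn_dense_class [Finite V] (hG : 11 ≤ G.oddGirth) (hno : ¬ HasOddWheel G)
    (h : Levelling G S r lev par) (hm : 0 < m) {Lf Md Rt : List V}
    (hpath : IndPath G (Lf.reverse ++ Md ++ Rt))
    (hfl : ∀ v, v ∈ Lf ∨ v ∈ Md ∨ v ∈ Rt → v ∈ S ∧ lev v = m + 1)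
    {F : Set V} (hF : ∀ z ∈ F, z ∈ S ∧ lev z = m + 1)
    (hFl : ∀ z ∈ F, z ∉ Lf ∧ ∀ v ∈ Lf, ¬ G.Adj z v) {α : ℕ} (hα : α < 2)
    (hFh : ∀ z ∈ F, (∃ v ∈ Lf, G.Adj (par z) v) ∧ (∃ v ∈ Rt, G.Adj (par z) v) ∧
      (∀ v ∈ Md, ¬ G.Adj (par z) v) ∧ firstHit G Lf (par z) % 2 = α ∧
      Even (firstHit G Lf (par z) + Md.length + firstHit G Rt (par z))) :
    ColOn G F 12 := by
  set s : V → ℕ := fun z => firstHit G Lf (par z) with hs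
  set t : V → ℕ := fun z => firstTurn G Lf (par z) with ht
  have hLf : IndPath G Lf := by
    rw [List.append_assoc] at hpath
    simpa using hpath.of_append_left.reverse
  by_contra hc
  obtain ⟨x, hx, y, hy, z, hz, hxy, hxz, hyz, h1, h2, h3⟩ :=
    exists_three_letters hG (p := par) (s := s) (t := t) (N := 4)
      (fun z hz => (h.letter (hF z hz)).2)
      (fun τ => (h.colOn_pure hno hLf (fun v hv => hfl v (.inl hv)) hF hFl hα τ).mono
        (fun z hz => ⟨hz.1, hz.2.1, hz.2.2, (hFh z hz.1).2.2.2.1⟩) le_rfl) hc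
  obtain ⟨A, B, hAB, hA, hB, hc', hl', p, q, hpq, hp, hq⟩ := h.exists_even_link hG hm
    (h.letter (hF x hx)).1 (h.letter (hF y hy)).1 (h.letter (hF z hz)).1 hxy hxz hyz
  obtain ⟨u, v, hu, hv, rfl, rfl, hfar, htu⟩ : ∃ u v, u ∈ F ∧ v ∈ F ∧
      p = par u ∧ q = par v ∧ Far G (par u) (par v) ∧ t u ≤ s v := by
    rcases hpq with ⟨rfl, rfl⟩ | ⟨rfl, rfl⟩ | ⟨rfl, rfl⟩
    · exact ⟨x, y, hx, hy, rfl, rfl, hxy, h1⟩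
    · exact ⟨x, z, hx, hz, rfl, rfl, hxz, h2⟩
    · exact ⟨y, z, hy, hz, rfl, rfl, hyz, h3⟩
  clear hpq h1 h2 h3 hxy hxz hyz hx hy hz x y z
  obtain ⟨hvL, hvR, hvM, hvα, hveven⟩ := hFh v hv
  have huα := (hFh u hu).2.2.2.1
  have hlu := (h.letter (hF u hu)).1
  have hlv := (h.letter (hF v hv)).1
  have hsv : s v < Lf.length := firstHit_lt hvL
  have htl : t u < Lf.length := htu.trans_lt hsv
  have t1 := adj_firstTurn htl
  have s1 : s u < t u := firstHit_lt_firstTurn htl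
  have a1 := adj_firstHit (s1.trans htl)
  -- Equality would give the two far letters a common neighbour.
  have htu' : t u < s v := by
    rcases htu.lt_or_eq with h' | h'
    · exact h'
    · refine absurd (adj_firstHit hsv) ?_
      have e : Lf[firstHit G Lf (par v)]'hsv = Lf[firstTurn G Lf (par u)]'htl := by
        congr 1; exact h'.symm
      rw [e]
      exact hfar.2.2 _ t1.1
  obtain ⟨L₁, g, L₂, eL, hL1, hg, hL1h⟩ := exists_split_firstHit hsv
  obtain ⟨R₁, k, R₂, eR, hR1, hk, hR1h⟩ := exists_split_firstHit (firstHit_lt hvR)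
  have hL1' : L₁.length = s v := hL1
  -- the link from the parent of `par u` to the parent of `par v`
  obtain ⟨l₀, w, w1, w2, rfl, w4, w5⟩ := hc'.exists_indPath (x := par (par u))
    (Q := fun y => y = par (par v)) (.inl hp.1) ⟨_, .inl hq.1, rfl⟩
  have hne : par (par u) ≠ par (par v) := fun e => hfar.2.2 _ hp.2.1 (e ▸ hq.2.1)
  have hl₀ : l₀.head? = some (par (par u)) := by
    rcases l₀ with _ | ⟨a, l₀⟩
    · simp only [List.nil_append, List.head?_cons, Option.some_inj] at w2
      exact absurd w2.symm hne
    · simpa using w2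
  have hl₀' : ∀ v ∈ l₀, v ∈ A ∪ B := fun v hv => w5 v (List.mem_append_left _ hv)
  have hw0 : par (par v) ∉ l₀ := fun h' => w4 _ h' rfl
  have hlink := (indPath_append.1 w1).2.2
  have hinf : g :: (L₁.reverse ++ Md ++ R₁ ++ [k]) <:+: Lf.reverse ++ Md ++ Rt :=
    ⟨L₂.reverse, R₂, by rw [eL, eR]; simp⟩
  have hrim : IndPath G (g :: (L₁.reverse ++ Md ++ R₁ ++ [k])) := hpath.of_infix hinf
  have hrimfl : ∀ x ∈ g :: (L₁.reverse ++ Md ++ R₁ ++ [k]), x ∈ S ∧ lev x = m + 1 := by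
    intro x hx
    have := hinf.subset hx
    simp only [List.mem_append, List.mem_reverse] at this
    exact hfl x (by tauto)
  have hmidh : ∀ x ∈ L₁.reverse ++ Md ++ R₁, ¬ G.Adj (par v) x := by
    intro x hx
    simp only [List.mem_append, List.mem_reverse] at hx
    rcases hx with (hx | hx) | hx
    · exact hL1h x hx
    · exact hvM x hx
    · exact hR1h x hx
  -- The length of this rim is three plus the sum that is even by hypothesis.
  have hcyc : IndCyc G (par v :: g :: (L₁.reverse ++ Md ++ R₁ ++ [k])) := by
    refine indCyc_cons hrim (fun h' => ?_) hg hk hmidh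
    have := (hrimfl _ h').2; omega
  -- The inner part of the rim begins with `L₁` reversed, which reverses the positions on `Lf`.
  have hcontact : ∀ i, ∀ hi : i < L₁.length, ∀ (h' : L₁.length - 1 - i < _),
      (L₁.reverse ++ Md ++ R₁)[L₁.length - 1 - i]'(h') = Lf[i]'(by rw [eL]; simp; omega) := by
    intro i hi h'
    have e : Lf[i]'(by rw [eL]; simp; omega) = L₁[i] := by
      simp only [eL]
      rw [List.getElem_append_left hi]
    rw [e, List.getElem_append_left (by simp; omega), List.getElem_append_left (by simp; omega),
      List.getElem_reverse]
    congr 1; omega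
  have hlenmid : (L₁.reverse ++ Md ++ R₁).length = L₁.length + Md.length + R₁.length := by
    simp only [List.length_append, List.length_reverse]
  -- The hub consists of `par u` and the link path without its end `par (par v)`, which is the
  -- vertex `q` of the contracted star. Both odd arcs come from the parities of `s u`, `t u` and `s
  -- v`: the first and the last agree, the middle one differs.
  refine hno (hasOddWheel_of_switch hcyc (A := {x | x ∈ A ∧ x ∈ l₀})
    (B := {x | x ∈ B ∧ x ∈ l₀} ∪ {par u}) (q := par (par v)) ?_ ?_ ?_ ?_ ?_ ?_ ?_ ?_ hq.2.1 ?_ ?_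
    (b := L₁.length - 1 - t u) (d := L₁.length - 1 - s u) ?_ ?_ ?_ ?_ ?_)
  · rw [hlenmid, hL1, hR1]
    exact hveven
  · rintro x ⟨hx, -⟩ (⟨hx', -⟩ | rfl)
    · exact hAB x hx hx'
    · have := (hl' _ (.inl hx)).2; omega
  · have : ({x | x ∈ A ∧ x ∈ l₀} ∪ ({x | x ∈ B ∧ x ∈ l₀} ∪ {par u}) : Set V) =
        {x | x ∈ l₀} ∪ {par u} := by
      ext x
      have := hl₀' x
      simp only [Set.mem_union, Set.mem_ofPred_eq, Set.mem_singleton_iff] at this ⊢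
      tauto
    rw [this]
    exact (connOn_of_indPath w1.of_append_left).union (ConnOn.singleton _)
      ⟨_, List.mem_of_mem_head? hl₀, _, rfl, .inr hp.2.1.symm⟩
  · exact hA.mono fun x hx => hx.1
  · have aux : ∀ x ∈ B, ¬ G.Adj (par u) x := fun x hx hux =>
      hAB _ hp.1 (hp.2.2 x (.inr hx) hux ▸ hx)
    rintro a (ha | rfl) b (hb | rfl) hab
    · exact hB a ha.1 b hb.1 hab
    · exact aux a ha.1 hab.symm
    · exact aux b hb.1 hab
    · exact G.irrefl hab
  · intro x hx
    rcases List.mem_cons.1 hx with rfl | hx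
    · refine ⟨fun h' => ?_, ?_, ?_, ?_⟩
      · have := (hl' _ (.inl h'.1)).2; omega
      · rintro (h' | h')
        · have := (hl' _ (.inr h'.1)).2; omega
        · exact hfar.1 h'.symm
      · exact hq.2.1.ne
      · rintro a ⟨ha, ha'⟩ hva
        exact hw0 (hq.2.2 a (.inl ha) hva ▸ ha')
    · have hxl := hrimfl x hx
      refine ⟨fun h' => ?_, ?_, ?_, ?_⟩
      · have := (hl' _ (.inl h'.1)).2; omega
      · rintro (h' | rfl)
        · have := (hl' _ (.inr h'.1)).2; omega
        · omega
      · rintro rfl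
        have := (hl' _ (.inl hq.1)).2; omega
      · rintro a ⟨ha, -⟩ hxa
        have h5 := hl' a (.inl ha)
        have := h.lev_le a h5.1 x hxl.1 hxa.symm
        omega
  · refine ⟨fun h' => hw0 h'.2, ?_, fun a ha => hA _ hq.1 a ha.1⟩
    rintro (h' | h')
    · exact hw0 h'.2
    · have e : par (par v) = par u := h'
      have := (hl' _ (.inl hq.1)).2
      rw [e] at this
      omega
  · obtain ⟨y, hy⟩ : ∃ y, l₀.getLast? = some y := by
      rcases hl : l₀.getLast? with _ | y
      · rw [List.getLast?_eq_none_iff] at hl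
        rw [hl] at hl₀
        simp at hl₀
      · exact ⟨y, rfl⟩
    have hyl := List.mem_of_mem_getLast? hy
    have hadj : G.Adj y (par (par v)) := (hlink y hyl _ (by simp)).2.2 ⟨hy, rfl⟩
    refine ⟨y, .inl ⟨(hl₀' y hyl).resolve_left fun h' => hA _ h' _ hq.1 hadj, hyl⟩, hadj.symm⟩
  · intro x hx hxv
    have hxl := hrimfl x hx
    have h5 := hl' _ (.inl hq.1)
    have := h.lev_le _ h5.1 x hxl.1 hxv
    omega
  · rintro x (⟨hx, hx'⟩ | rfl) hvx
    · exact hAB _ hq.1 (hq.2.2 x (.inr hx) hvx ▸ hx)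
    · exact hfar.2.1 hvx.symm
  · have h5 : t u % 2 ≠ s u % 2 := t1.2
    have h6 : s u % 2 = α := huα
    have h7 : s v % 2 = α := hvα
    rw [Nat.odd_iff]
    omega
  · have h5 : t u % 2 ≠ s u % 2 := t1.2
    have h6 : s u % 2 = α := huα
    have h7 : s v % 2 = α := hvα
    rw [Nat.odd_iff]
    omega
  · rw [hlenmid]
    omega
  · refine ⟨par u, .inr rfl, ?_⟩
    rw [hcontact (t u) (by omega)]
    exact t1.1.symm
  · refine ⟨par u, .inr rfl, ?_⟩
    rw [hcontact (s u) (by omega)]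
    exact a1.symm

/-- There are four parity patterns for the first hits on the two sides. Since the arcs differ in
parity, for each pattern one of them makes the closed hole odd, so that `colOn_dense_class` gives 12
colours. -/
theorem Levelling.colOn_dense [Finite V] (hG : 11 ≤ G.oddGirth) (hno : ¬ HasOddWheel G)
    (h : Levelling G S r lev par) (hm : 0 < m) {Lf Rt : List V} {Md : Bool → List V}
    (hpath : ∀ e, IndPath G (Lf.reverse ++ Md e ++ Rt))
    (hMd : (Md true).length % 2 ≠ (Md false).length % 2)
    (hfl : ∀ v e, v ∈ Lf ∨ v ∈ Md e ∨ v ∈ Rt → v ∈ S ∧ lev v = m + 1)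
    {F : Set V} (hF : ∀ z ∈ F, z ∈ S ∧ lev z = m + 1)
    (hFl : ∀ z ∈ F, z ∉ Lf ∧ ∀ v ∈ Lf, ¬ G.Adj z v) :
    ColOn G {z | z ∈ F ∧ (∃ v ∈ Lf, G.Adj (par z) v) ∧ (∃ v ∈ Rt, G.Adj (par z) v) ∧
      ∀ e, ∀ v ∈ Md e, ¬ G.Adj (par z) v} 48 := by
  set T := {z | z ∈ F ∧ (∃ v ∈ Lf, G.Adj (par z) v) ∧ (∃ v ∈ Rt, G.Adj (par z) v) ∧
      ∀ e, ∀ v ∈ Md e, ¬ G.Adj (par z) v} with hT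
  have key : ∀ α β, α < 2 → ColOn G {z | z ∈ T ∧ firstHit G Lf (par z) % 2 = α ∧
      firstHit G Rt (par z) % 2 = β} 12 := by
    intro α β hα
    obtain ⟨e, he⟩ : ∃ e, (α + (Md e).length + β) % 2 = 0 := by
      rcases Nat.mod_two_eq_zero_or_one (α + (Md true).length + β) with h' | h'
      · exact ⟨true, h'⟩
      · exact ⟨false, by omega⟩
    refine h.colOn_dense_class hG hno hm (hpath e) (fun v hv => hfl v e hv)
      (fun z hz => hF z hz.1.1) (fun z hz => hFl z hz.1.1) hα ?_
    rintro z ⟨⟨-, h1, h2, h3⟩, h4, h5⟩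
    refine ⟨h1, h2, h3 e, h4, ?_⟩
    rw [Nat.even_iff]
    omega
  have := ((key 0 0 (by omega)).union (key 0 1 (by omega))).union
    ((key 1 0 (by omega)).union (key 1 1 (by omega)))
  refine this.mono ?_ (by omega)
  intro z hz
  rcases Nat.mod_two_eq_zero_or_one (firstHit G Lf (par z)) with h1 | h1 <;>
    rcases Nat.mod_two_eq_zero_or_one (firstHit G Rt (par z)) with h2 | h2
  · exact .inl (.inl ⟨hz, h1, h2⟩)
  · exact .inl (.inr ⟨hz, h1, h2⟩)
  · exact .inr (.inl ⟨hz, h1, h2⟩)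
  · exact .inr (.inr ⟨hz, h1, h2⟩)

end Floor

/-! ### Growing an induced path into a connected set of large chromatic number -/

/-- `x` is attached to the connected set `C`. -/
def Att (G : SimpleGraph V) (x : V) (C : Set V) : Prop :=
  x ∉ C ∧ ConnOn G C ∧ ∃ v ∈ C, G.Adj x v

theorem Att.connOn_insert {x : V} {C : Set V} (h : Att G x C) : ConnOn G ({x} ∪ C) := by
  obtain ⟨v, hv, hxv⟩ := h.2.2
  exact (ConnOn.singleton x).union h.2.1 ⟨x, rfl, v, hv, .inr hxv⟩

/-- A component left after the deletion of `E` is attached to a vertex of `E`. -/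
theorem ConnOn.exists_attached {C E : Set V} (hC : ConnOn G C) (hE : ∃ v ∈ C, v ∈ E) {N β : ℕ}
    (hEc : ColOn G (C ∩ E) β) (hcol : ¬ ColOn G C (N + β)) :
    ∃ y C', y ∈ C ∧ y ∈ E ∧ C' ⊆ C ∧ (∀ v ∈ C', v ∉ E) ∧ ¬ ColOn G C' N ∧ Att G y C' := by
  have h1 : ¬ ColOn G (C \ E) N := fun h1 => hcol (h1.of_cover hEc (fun v hv => by
    by_cases h : v ∈ E
    · exact .inr ⟨hv, h⟩
    · exact .inl ⟨hv, h⟩) le_rfl)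
  obtain ⟨C', hC', hc, hcol', hcomp⟩ := exists_component h1
  obtain ⟨e, heC, heE⟩ := hE
  obtain ⟨c, hcC⟩ := nonempty_of_not_colOn hcol'
  by_cases hy : ∃ y ∈ C, y ∈ E ∧ ∃ v ∈ C', G.Adj y v
  · obtain ⟨y, h2, h3, h4⟩ := hy
    exact ⟨y, C', h2, h3, fun v hv => (hC' hv).1, fun v hv => (hC' hv).2, hcol',
      fun h => (hC' h).2 h3, hc, h4⟩
  · push Not at hy
    -- If no vertex of `E` were attached to it, the component `C'` would be closed under adjacency
    -- in the connected set `C`.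
    have := hC (fun v => v ∈ C') ⟨c, (hC' hcC).1, hcC⟩ (fun a b hab ha hb h => by
      by_cases hbE : b ∈ E
      · exact absurd hab.symm (hy b hb hbE a h)
      · exact hcomp a h b ⟨hb, hbE⟩ hab) e heC
    exact absurd heE (hC' this).2

theorem Att.step (hG : 11 ≤ G.oddGirth) {x : V} {C : Set V} (h : Att G x C) {N : ℕ}
    (hcol : ¬ ColOn G C (N + 1)) :
    ∃ y C', y ∈ C ∧ G.Adj x y ∧ C' ⊆ C ∧ (∀ v ∈ C', ¬ G.Adj x v) ∧ ¬ ColOn G C' N ∧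
      Att G y C' := by
  obtain ⟨y, C', h1, h2, h3, h4, h5, h6⟩ := h.2.1.exists_attached (E := {v | G.Adj x v}) h.2.2
    (((stableOn_neighbor hG x).mono fun v hv => G.adj_symm hv.2).colOn) hcol
  exact ⟨y, C', h1, h2, h3, h4, h5, h6⟩

/-- The first vertex in `D` would have a predecessor with a neighbour in `D`. -/
theorem IndPath.avoids {D : Set V} {y : V} : ∀ {l : List V}, IndPath G (l ++ [y]) →
    (∀ x, (l ++ [y]).head? = some x → x ∉ D) → (∀ v ∈ l, ¬ ∃ c ∈ D, G.Adj v c) →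
    ∀ v ∈ l ++ [y], v ∉ D
  | [], _, h2, _, v, hv => by
    obtain rfl : v = y := by simpa using hv
    exact h2 v rfl
  | a :: l, h1, h2, h3, v, hv => by
    rcases List.mem_cons.1 hv with rfl | hv
    · exact h2 v rfl
    · refine IndPath.avoids (l := l) h1.2 (fun x hx hxD => ?_)
        (fun v hv => h3 v (List.mem_cons_of_mem _ hv)) v hv
      exact h3 a (by simp) ⟨x, hxD, (h1.1 x (List.mem_of_mem_head? hx)).2.2 hx⟩

/-- Walking from `x` into a component of `C` minus `Bd`. -/
theorem Att.extend {x : V} {C : Set V} (h : Att G x C) {Bd : Set V} {N β : ℕ}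
    (hBd : ColOn G Bd β) (hcol : ¬ ColOn G C (N + β)) :
    ∃ l y C', IndPath G (l ++ [y]) ∧ (l ++ [y]).head? = some x ∧
      (∀ v ∈ l ++ [y], v ≠ x → v ∈ C) ∧ C' ⊆ C ∧ (∀ v ∈ C', v ∉ Bd) ∧ ¬ ColOn G C' N ∧
      Att G y C' ∧ (∀ v ∈ l, v ∉ C' ∧ ∀ c ∈ C', ¬ G.Adj v c) := by
  have h1 : ¬ ColOn G (C \ Bd) N := fun h1 => hcol (h1.of_cover hBd (fun v hv => by
    by_cases h : v ∈ Bd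
    · exact .inr h
    · exact .inl ⟨hv, h⟩) le_rfl)
  obtain ⟨C', hC', hc, hcol', -⟩ := exists_component h1
  obtain ⟨c, hcC⟩ := nonempty_of_not_colOn hcol'
  have hxC' : x ∉ C' := fun h' => h.1 (hC' h').1
  have hQ : ∃ y ∈ ({x} ∪ C : Set V), ∃ v ∈ C', G.Adj y v := by
    by_contra hno
    push Not at hno
    exact hxC' (h.connOn_insert (fun v => v ∈ C') ⟨c, .inr (hC' hcC).1, hcC⟩
      (fun a b hab ha hb h' => absurd hab.symm (hno b hb a h')) x (.inl rfl))
  obtain ⟨l, y, h2, h3, h4, h5, h6⟩ := h.connOn_insert.exists_indPath (.inl rfl) hQ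
  have hav := h2.avoids (D := C') (fun z hz => by
    rw [h3, Option.some_inj] at hz
    exact hz ▸ hxC') h5
  refine ⟨l, y, C', h2, h3, fun v hv hvx => (h6 v hv).resolve_left hvx, fun v hv => (hC' hv).1,
    fun v hv => (hC' hv).2, hcol', ⟨hav y (by simp), hc, h4⟩,
    fun v hv => ⟨hav v (List.mem_append_left _ hv), fun c hc hvc => h5 v hv ⟨c, hc, hvc⟩⟩⟩

/-! ### Holes along the path -/

theorem indPath_glue {l₁ l₂ : List V} {a : V} (h₁ : IndPath G (l₁ ++ [a]))
    (h₂ : IndPath G (a :: l₂)) (h : ∀ u ∈ l₁, ∀ v ∈ l₂, u ≠ v ∧ ¬ G.Adj u v) :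
    IndPath G (l₁ ++ a :: l₂) := by
  rw [indPath_append] at h₁ ⊢
  refine ⟨h₁.1, h₂, ?_⟩
  intro u hu v hv
  rcases List.mem_cons.1 hv with rfl | hv
  · simpa using h₁.2.2 u hu v (by simp)
  · refine ⟨(h u hu v hv).1, iff_of_false (h u hu v hv).2 ?_⟩
    rintro ⟨-, h3⟩
    simp only [List.head?_cons, Option.some_inj] at h3
    exact (h₂.1 v hv).1 h3

/-- A piece of the path that starts at `x`, runs to `s`, around one of the two arcs of an odd hole to
`t`, and on to a vertex `x'` attached to a smaller connected set. -/
structure Block (G : SimpleGraph V) (x : V) (C : Set V) (N : ℕ) (st : List V) (s : V)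
    (ar : Bool → List V) (t : V) (be : List V) (x' : V) (C' : Set V) : Prop where
  head : (st ++ [s]).head? = some x
  last : (t :: be).getLast? = some x'
  path : ∀ e, IndPath G (st ++ s :: (ar e ++ t :: be))
  parity : (ar true).length % 2 ≠ (ar false).length % 2
  hole : IndCyc G (s :: ar true ++ t :: (ar false).reverse)
  mem : ∀ e, ∀ v ∈ st ++ s :: (ar e ++ t :: be), v ≠ x → v ∈ C
  subset : C' ⊆ C
  col : ¬ ColOn G C' N
  att : Att G x' C'
  anti : ∀ e, ∀ v ∈ st ++ s :: (ar e ++ t :: be), v ≠ x' → v ∉ C' ∧ ∀ c ∈ C', ¬ G.Adj v c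

theorem IndCyc.indPath_of_append {l₁ l₂ : List V} (h : IndCyc G (l₁ ++ l₂)) (h₂ : l₂ ≠ []) :
    IndPath G l₁ := by
  rcases eq_or_ne l₁ [] with rfl | h1
  · trivial
  · exact ((indCyc_append h1 h₂).1 h).2.1

theorem IndCyc.reverse {l : List V} (h : IndCyc G l) : IndCyc G l.reverse := by
  rcases l with _ | ⟨x, l⟩
  · exact h.elim
  have h' : IndCyc G ([x] ++ l) := h
  have hl : l ≠ [] := by
    rintro rfl
    exact absurd h.1 (by simp)
  rw [List.reverse_cons]
  rw [indCyc_append (by simp) hl] at h'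
  rw [indCyc_append (by simpa using hl) (by simp)]
  refine ⟨by simpa using h'.1, h'.2.2.1.reverse, indPath_singleton x, ?_⟩
  intro a ha b hb
  obtain rfl := List.mem_singleton.1 hb
  have := h'.2.2.2 b (by simp) a (by simpa using ha)
  refine ⟨this.1.symm, ?_⟩
  rw [G.adj_comm, this.2]
  simp

/-- Reversal of an induced cycle with the first vertex kept. -/
theorem IndCyc.reverse_tail {x : V} {l : List V} (h : IndCyc G (x :: l)) :
    IndCyc G (x :: l.reverse) := by
  have := h.reverse
  rw [List.reverse_cons] at this
  exact this.rotate

/-! ### Climbing and descending in a levelling -/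

section Levels

variable {S : Set V} {r : V} {lev : V → ℕ} {par : V → V}

theorem Levelling.exists_geodesic (h : Levelling G S r lev par) : ∀ (n : ℕ) (s : V), s ∈ S →
    lev s = n → ∃ st, IndPath G (st ++ [s]) ∧ (st ++ [s]).head? = some r ∧
      ∀ v ∈ st, v ∈ S ∧ lev v < n := by
  intro n
  induction n with
  | zero =>
    intro s hs hn
    obtain rfl := h.eq_root hs hn
    exact ⟨[], indPath_singleton s, rfl, by simp⟩
  | succ n ih =>
    intro s hs hn
    have hne := h.ne_root (v := s) (by omega)
    have hl := h.par_lev s hs hne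
    have hps := h.par_mem s hs hne
    obtain ⟨st, h1, h2, h3⟩ := ih (par s) hps (by omega)
    refine ⟨st ++ [par s], ?_, ?_, ?_⟩
    · rw [List.append_assoc]
      refine indPath_glue h1 ⟨?_, indPath_singleton s⟩ ?_
      · intro b hb
        obtain rfl := List.mem_singleton.1 hb
        have := h.par_adj b hs hne
        exact ⟨this.ne, by simp [this]⟩
      · intro u hu v hv
        obtain rfl := List.mem_singleton.1 hv
        obtain ⟨h4, h5⟩ := h3 u hu
        refine ⟨fun e => by rw [e] at h5; omega, fun e => ?_⟩
        have := h.lev_le u h4 v hs e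
        omega
    · rw [List.head?_append, h2]; rfl
    · intro v hv
      rcases List.mem_append.1 hv with hv | hv
      · exact ⟨(h3 v hv).1, by have := (h3 v hv).2; omega⟩
      · obtain rfl := List.mem_singleton.1 hv
        exact ⟨hps, by omega⟩

/-- Two vertices of one level are joined by two paths that go up to a common ancestor. -/
theorem Levelling.exists_cone (h : Levelling G S r lev par) {U : Set V}
    (hU : ∀ u ∈ S, ∀ v ∈ U, G.Adj u v → lev v = lev u + 1 → u ∈ U) :
    ∀ (n : ℕ) (u v : V), u ∈ S → v ∈ S → lev u = n → lev v = n → u ≠ v → v ∈ U →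
    (∀ a ∈ S, ∀ b ∈ U, G.Adj a b → lev a = lev b → n ≤ lev b) →
    ∃ s α β, s ∈ S ∧ α.length = β.length ∧ IndPath G (s :: (α ++ [u])) ∧
      IndPath G (s :: (β ++ [v])) ∧
      (∀ a ∈ α, a ∈ S ∧ lev s < lev a ∧ lev a < n) ∧ (∀ b ∈ β, b ∈ S ∧ lev s < lev b ∧ lev b < n) ∧
      (∀ a ∈ α ++ [u], ∀ b ∈ β ++ [v], a ≠ b ∧ (G.Adj a b → a = u ∧ b = v)) ∧ lev s < n ∧
      (∀ a ∈ α, lev a + 1 = n → G.Adj a u) ∧ ∀ b ∈ β, lev b + 1 = n → G.Adj b v := by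
  intro n
  induction n with
  | zero =>
    intro u v hu hv h1 h2 hne
    exact absurd ((h.eq_root hu h1).trans (h.eq_root hv h2).symm) hne
  | succ n ih =>
    intro u v hu hv hun hvn hne hvU hmin
    -- The climb ends when the two ends have a common neighbour one level up; otherwise it continues
    -- with their parents, which are then distinct. Edges between the two sides are excluded: one
    -- between the parents would be a horizontal edge against `hmin`, and one from a parent to the
    -- other end would make it a common neighbour.
    by_cases hs : ∃ s ∈ S, G.Adj s u ∧ G.Adj s v ∧ lev s = n
    · obtain ⟨s, hs, hsu, hsv, hsn⟩ := hs
      refine ⟨s, [], [], hs, rfl, ⟨?_, indPath_singleton u⟩, ⟨?_, indPath_singleton v⟩, by simp,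
        by simp, ?_, by omega, by simp, by simp⟩
      · intro b hb
        obtain rfl : b = u := by simpa using hb
        exact ⟨hsu.ne, by simp [hsu]⟩
      · intro b hb
        obtain rfl : b = v := by simpa using hb
        exact ⟨hsv.ne, by simp [hsv]⟩
      · intro a ha b hb
        obtain rfl : a = u := by simpa using ha
        obtain rfl : b = v := by simpa using hb
        exact ⟨hne, fun _ => ⟨rfl, rfl⟩⟩
    · push Not at hs
      have hur := h.ne_root (v := u) (by omega)
      have hvr := h.ne_root (v := v) (by omega)
      have hpu := h.par_mem u hu hur
      have hpv := h.par_mem v hv hvr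
      have lu := h.par_lev u hu hur
      have lv := h.par_lev v hv hvr
      have au := h.par_adj u hu hur
      have av := h.par_adj v hv hvr
      have hne' : par u ≠ par v := fun e =>
        hs _ hpu au (e ▸ av) (by omega)
      have hpvU : par v ∈ U := hU _ hpv v hvU av lv.symm
      obtain ⟨s, α, β, h1, h2, h3, h4, h5, h6, h7, h8, -⟩ := ih (par u) (par v) hpu hpv (by omega)
        (by omega) hne' hpvU (fun a ha b hb hab hl => by have := hmin a ha b hb hab hl; omega)
      -- extending one side
      have ext : ∀ (γ : List V) (w : V), w ∈ S → lev w = n + 1 → lev (par w) = n → par w ∈ S →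
          G.Adj (par w) w → IndPath G (s :: (γ ++ [par w])) →
          (∀ b ∈ γ, b ∈ S ∧ lev s < lev b ∧ lev b < n) →
          IndPath G (s :: (γ ++ [par w] ++ [w])) := by
        intro γ w hw lw lpw hpw aw hγ hγl
        have := indPath_glue (l₁ := s :: γ) (a := par w) (l₂ := [w]) hγ
          ⟨fun b hb => by
            obtain rfl := List.mem_singleton.1 hb
            exact ⟨aw.ne, by simp [aw]⟩, indPath_singleton w⟩ ?_
        · simpa using this
        · intro a ha b hb
          obtain rfl := List.mem_singleton.1 hb
          have : a ∈ S ∧ lev a < n := by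
            rcases List.mem_cons.1 ha with rfl | ha
            · exact ⟨h1, h8⟩
            · exact ⟨(hγl a ha).1, (hγl a ha).2.2⟩
          refine ⟨fun e => by rw [e] at this; omega, fun e => ?_⟩
          have := h.lev_le a this.1 b hw e
          omega
      have low : ∀ (γ : List V) (w : V), lev (par w) = n → par w ∈ S →
          (∀ b ∈ γ, b ∈ S ∧ lev s < lev b ∧ lev b < n) →
          ∀ b ∈ γ ++ [par w], b ∈ S ∧ lev s < lev b ∧ lev b < n + 1 ∧ (lev b = n → b = par w) := by
        intro γ w hw hw' hγ b hb
        rcases List.mem_append.1 hb with hb | hb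
        · have := hγ b hb
          exact ⟨this.1, this.2.1, by omega, fun e => by omega⟩
        · obtain rfl := List.mem_singleton.1 hb
          exact ⟨hw', by omega, by omega, fun _ => rfl⟩
      have lowu := low α u (by omega) hpu h5
      have lowv := low β v (by omega) hpv h6
      refine ⟨s, α ++ [par u], β ++ [par v], h1, by simp [h2],
        ext α u hu hun (by omega) hpu au h3 h5, ext β v hv hvn (by omega) hpv av h4 h6,
        fun a ha => ⟨(lowu a ha).1, (lowu a ha).2.1, (lowu a ha).2.2.1⟩,
        fun a ha => ⟨(lowv a ha).1, (lowv a ha).2.1, (lowv a ha).2.2.1⟩, ?_, by omega,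
        fun a ha hl => (lowu a ha).2.2.2 (by omega) ▸ au,
        fun a ha hl => (lowv a ha).2.2.2 (by omega) ▸ av⟩
      intro a ha b hb
      rcases List.mem_append.1 ha with ha | ha <;> rcases List.mem_append.1 hb with hb | hb
      · obtain ⟨h9, h10⟩ := h7 a ha b hb
        refine ⟨h9, fun hab => ?_⟩
        obtain ⟨rfl, rfl⟩ := h10 hab
        have := hmin _ hpu _ hpvU hab (by omega)
        omega
      · obtain rfl := List.mem_singleton.1 hb
        have l1 := lowu a ha
        refine ⟨fun e => by rw [e] at l1; omega, fun hab => ?_⟩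
        have := h.lev_le a l1.1 b hv hab
        obtain rfl := l1.2.2.2 (by omega)
        exact absurd (by omega) (hs _ hpu au hab)
      · obtain rfl := List.mem_singleton.1 ha
        have l1 := lowv b hb
        refine ⟨fun e => by rw [← e] at l1; omega, fun hab => ?_⟩
        have := h.lev_le b l1.1 a hu hab.symm
        obtain rfl := l1.2.2.2 (by omega)
        exact absurd (by omega) (hs _ hpv hab.symm av)
      · obtain rfl := List.mem_singleton.1 ha
        obtain rfl := List.mem_singleton.1 hb
        exact ⟨hne, fun _ => ⟨rfl, rfl⟩⟩

/-- A chain that descends the levels. -/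
theorem Levelling.exists_descent (h : Levelling G S r lev par) {a w : V}
    (haw : Relation.ReflTransGen
      (fun a b => G.Adj a b ∧ a ∈ S ∧ b ∈ S ∧ lev b = lev a + 1) a w) :
    lev a < lev w → ∃ m z, IndPath G (a :: m) ∧ (a :: m).getLast? = some z ∧ G.Adj z w ∧ z ∈ S ∧
      w ∈ S ∧ lev w = lev z + 1 ∧ (∀ b ∈ m, b ∈ S ∧ lev a < lev b ∧ lev b < lev w) ∧
      (∀ b ∈ a :: m, lev b + 1 = lev w → b = z) ∧ ∀ b ∈ m, lev b = lev a + 1 → G.Adj a b := by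
  induction haw using Relation.ReflTransGen.head_induction_on with
  | refl => intro h'; omega
  | @head a b hab _ ih =>
    intro hlt
    obtain ⟨h1, h2, h3, h4⟩ := hab
    by_cases hb : lev b < lev w
    · obtain ⟨m, z, g1, g2, g3, g4, g5, g6, g7, g8, g9⟩ := ih hb
      refine ⟨b :: m, z, ⟨?_, g1⟩, by rw [List.getLast?_cons_cons, g2], g3, g4, g5, g6, ?_, ?_, ?_⟩
      · intro c hc
        rcases List.mem_cons.1 hc with rfl | hc
        · exact ⟨h1.ne, by simp [h1]⟩
        · have := g7 c hc
          refine ⟨fun e => by rw [← e] at this; omega, iff_of_false (fun e => ?_) ?_⟩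
          · have := h.lev_le a h2 c this.1 e
            omega
          · simp only [List.head?_cons, Option.some_inj]
            rintro rfl
            omega
      · intro c hc
        rcases List.mem_cons.1 hc with rfl | hc
        · exact ⟨h3, by omega, hb⟩
        · have := g7 c hc
          exact ⟨this.1, by omega, this.2.2⟩
      · intro c hc hcw
        rcases List.mem_cons.1 hc with rfl | hc
        · omega
        · exact g8 c hc hcw
      · intro c hc hca
        rcases List.mem_cons.1 hc with rfl | hc
        · exact h1
        · have := g7 c hc
          omega
    · have hbw : lev b = lev w := by omega
      rename_i hbw'
      -- Levels increase along the chain, so its only vertex in the level of `w` is the end.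
      have : b = w := by
        rcases Relation.ReflTransGen.cases_head hbw' with rfl | ⟨d, hd, hdw⟩
        · rfl
        · exfalso
          have mono : ∀ {x y}, Relation.ReflTransGen
              (fun a b => G.Adj a b ∧ a ∈ S ∧ b ∈ S ∧ lev b = lev a + 1) x y → lev x ≤ lev y := by
            intro x y hxy
            induction hxy with
            | refl => rfl
            | tail _ h ih => have := h.2.2.2; omega
          have := mono hdw
          have := hd.2.2.2
          omega
      subst this
      exact ⟨[], a, indPath_singleton a, rfl, h1, h2, h3, h4, by simp, by simp, by simp⟩

end Levels

theorem IndCyc.indPath_arcs {s t : V} {a₁ a₂ : List V}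
    (hcyc : IndCyc G (s :: a₁ ++ t :: a₂.reverse)) (h₁ : a₁ ≠ []) (h₂ : a₂ ≠ []) :
    IndPath G (s :: a₁ ++ [t]) ∧ IndPath G (s :: a₂ ++ [t]) := by
  constructor
  · have e : s :: a₁ ++ t :: a₂.reverse = (s :: a₁ ++ [t]) ++ a₂.reverse := by simp
    rw [e] at hcyc
    exact hcyc.indPath_of_append (by simpa using h₂)
  · have h3 := IndCyc.reverse_tail (x := s) (l := a₁ ++ t :: a₂.reverse) hcyc
    have e : s :: (a₁ ++ t :: a₂.reverse).reverse = (s :: a₂ ++ [t]) ++ a₁.reverse := by simp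
    rw [e] at h3
    exact h3.indPath_of_append (by simpa using h₁)

/-! ### Blocks built from two tree paths and a horizontal edge -/

section Levels

variable {x : V} {C : Set V} {lev : V → ℕ} {par : V → V}

/-- Assembling a block from its parts. -/
theorem Levelling.exists_block (h : Levelling G ({x} ∪ C) x lev par) {s t x' : V}
    {st a₁ a₂ be : List V} {C' : Set V} {N : ℕ} (hs : s ∈ ({x} ∪ C : Set V))
    (hst : IndPath G (st ++ [s]) ∧ (st ++ [s]).head? = some x ∧
      ∀ v ∈ st, v ∈ ({x} ∪ C : Set V) ∧ lev v < lev s)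
    (hcyc : IndCyc G (s :: a₁ ++ t :: a₂.reverse)) (hpar : a₁.length % 2 ≠ a₂.length % 2)
    (h₁ : a₁ ≠ []) (h₂ : a₂ ≠ []) (hbe : IndPath G (t :: be))
    (hlast : (t :: be).getLast? = some x')
    (hlev : ∀ b, (b ∈ a₁ ∨ b ∈ a₂ ∨ b ∈ t :: be) → b ∈ ({x} ∪ C : Set V) ∧ lev s < lev b)
    (hcross : ∀ a, (a = s ∨ a ∈ a₁ ∨ a ∈ a₂) → ∀ b ∈ be, a ≠ b ∧ ¬ G.Adj a b)
    (hC' : C' ⊆ C) (hcol : ¬ ColOn G C' N) (hatt : Att G x' C')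
    (hC'lev : ∀ c ∈ C', lev s + 1 < lev c)
    (hanti : ∀ v, (v ∈ a₁ ∨ v ∈ a₂ ∨ v ∈ t :: be) → v ≠ x' → v ∉ C' ∧ ∀ c ∈ C', ¬ G.Adj v c) :
    ∃ st s ar t be, Block G x C N st s ar t be x' C' := by
  obtain ⟨hp1, hp2⟩ := hcyc.indPath_arcs h₁ h₂
  let ar : Bool → List V := fun e => if e then a₁ else a₂
  have har : ∀ e, ar e = a₁ ∨ ar e = a₂ := by rintro (_ | _) <;> simp [ar]
  have harmem : ∀ e v, v ∈ ar e → v ∈ a₁ ∨ v ∈ a₂ := by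
    intro e v hv
    rcases har e with e' | e' <;> rw [e'] at hv
    · exact .inl hv
    · exact .inr hv
  have hlow : ∀ v, v ∈ st ∨ v = s → v ∈ ({x} ∪ C : Set V) ∧ lev v ≤ lev s := by
    rintro v (hv | rfl)
    · have := hst.2.2 v hv
      exact ⟨this.1, this.2.le⟩
    · exact ⟨hs, le_rfl⟩
  have hcases : ∀ e v, v ∈ st ++ s :: (ar e ++ t :: be) → (v ∈ st ∨ v = s) ∨
      (v ∈ a₁ ∨ v ∈ a₂ ∨ v ∈ t :: be) := by
    intro e v hv
    rw [List.mem_append, List.mem_cons, List.mem_append] at hv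
    rcases hv with hv | hv | hv | hv
    · exact .inl (.inl hv)
    · exact .inl (.inr hv)
    · have := harmem e v hv
      tauto
    · exact .inr (.inr (.inr hv))
  refine ⟨st, s, ar, t, be, hst.2.1, hlast, ?_, hpar, hcyc, ?_, hC', hcol, hatt, ?_⟩
  · intro e
    have hp : IndPath G (s :: ar e ++ [t]) := by
      rcases har e with e' | e' <;> rw [e'] <;> assumption
    have h3 : IndPath G (s :: (ar e ++ t :: be)) := by
      refine indPath_glue hp hbe ?_
      intro u hu v hv
      refine hcross u ?_ v hv
      rcases List.mem_cons.1 hu with hu | hu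
      · exact .inl hu
      · exact .inr (harmem e u hu)
    refine indPath_glue hst.1 h3 ?_
    intro u hu v hv
    have hu' := hst.2.2 u hu
    have hv' : v ∈ ({x} ∪ C : Set V) ∧ lev s < lev v := by
      rcases List.mem_append.1 hv with hv | hv
      · have := harmem e v hv
        exact hlev v (by tauto)
      · exact hlev v (.inr (.inr hv))
    refine ⟨fun e => by rw [e] at hu'; omega, fun e => ?_⟩
    have := h.lev_le u hu'.1 v hv'.1 e
    omega
  · intro e v hv hvx
    rcases hcases e v hv with hv | hv
    · exact (hlow v hv).1.resolve_left hvx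
    · exact (hlev v hv).1.resolve_left hvx
  · intro e v hv hvx
    rcases hcases e v hv with hv | hv
    · have h4 := hlow v hv
      refine ⟨fun hc => ?_, fun c hc hvc => ?_⟩
      · have := hC'lev v hc; omega
      · have h5 := hC'lev c hc
        have := h.lev_le v h4.1 c (.inr (hC' hc)) hvc
        omega
    · exact hanti v hv hvx

/-- Two paths of the same length that go down from `s` to the ends of an edge of level `l`, which
together form an odd induced cycle. -/
structure Kite (G : SimpleGraph V) (S : Set V) (lev : V → ℕ) (l : ℕ) (s : V) (α : List V) (c : V)
    (β : List V) (c' : V) : Prop where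
  len : α.length = β.length
  four_le : 4 ≤ α.length
  cyc : IndCyc G (s :: (α ++ [c]) ++ (β ++ [c']).reverse)
  left : ∀ a ∈ α, a ∈ S ∧ lev s < lev a ∧ lev a < l
  right : ∀ a ∈ β, a ∈ S ∧ lev s < lev a ∧ lev a < l
  left_top : ∀ a ∈ α, lev a + 1 = l → G.Adj a c
  right_top : ∀ a ∈ β, lev a + 1 = l → G.Adj a c'
  left_end : c ∈ S ∧ lev c = l
  right_end : c' ∈ S ∧ lev c' = l
  adj : G.Adj c c'

theorem Kite.symm {S : Set V} {l : ℕ} {s : V} {α β : List V} {c c' : V}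
    (K : Kite G S lev l s α c β c') : Kite G S lev l s β c' α c where
  len := K.len.symm
  four_le := K.len ▸ K.four_le
  cyc := by
    have := IndCyc.reverse_tail (x := s) (l := (α ++ [c]) ++ (β ++ [c']).reverse) K.cyc
    simpa using this
  left := K.right
  right := K.left
  left_top := K.right_top
  right_top := K.left_top
  left_end := K.right_end
  right_end := K.left_end
  adj := K.adj.symm

theorem Kite.lev_lt {S : Set V} {l : ℕ} {s : V} {α β : List V} {c c' : V}
    (K : Kite G S lev l s α c β c') : lev s + 1 < l := by
  obtain ⟨a, ha⟩ := List.exists_mem_of_length_pos (l := α) (by have := K.four_le; omega)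
  have := K.left a ha
  omega

/-- The block that leaves the hole at an end of the lowest edge. -/
theorem Kite.exists_block_end (h : Levelling G ({x} ∪ C) x lev par) {l j : ℕ} {s : V}
    {α β : List V} {c c' : V} (K : Kite G ({x} ∪ C) lev l s α c β c') {st be : List V} {x' : V}
    {C' : Set V} {N : ℕ} (hs : s ∈ ({x} ∪ C : Set V))
    (hst : IndPath G (st ++ [s]) ∧ (st ++ [s]).head? = some x ∧
      ∀ v ∈ st, v ∈ ({x} ∪ C : Set V) ∧ lev v < lev s)
    (hbe : IndPath G (c' :: be)) (hlast : (c' :: be).getLast? = some x')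
    (hlev : ∀ b ∈ be, b ∈ ({x} ∪ C : Set V) ∧ l ≤ lev b)
    (hbec : ∀ b ∈ be, c ≠ b ∧ ¬ G.Adj c b)
    (hbeα : ∀ b ∈ be, ∀ a, (a ∈ α ∨ a ∈ β) → ¬ G.Adj a b)
    (hlj : l ≤ j) (hC' : C' ⊆ C) (hC'j : ∀ v ∈ C', lev v = j) (hcol : ¬ ColOn G C' N)
    (hatt : Att G x' C')
    (hanti : ∀ v, (v = c ∨ v ∈ c' :: be) → v ≠ x' → v ∉ C' ∧ ∀ w ∈ C', ¬ G.Adj v w)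
    (hanti' : ∀ v, (v ∈ α ∨ v ∈ β) → ∀ w ∈ C', ¬ G.Adj v w) :
    ∃ st s ar t be, Block G x C N st s ar t be x' C' := by
  have hl := K.lev_lt
  have h4 := K.four_le
  -- The exit `c'` leaves arcs with `α.length + 1` and `α.length` vertices.
  refine h.exists_block (a₁ := α ++ [c]) (a₂ := β) (t := c') (be := be) hs hst ?_ ?_ (by simp) ?_
    hbe hlast ?_ ?_ hC' hcol hatt (fun w hw => by rw [hC'j w hw]; omega) ?_
  · simpa using K.cyc
  · rw [List.length_append, K.len]; simp; omega
  · intro e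
    have := K.len
    rw [e] at this
    simp only [List.length_nil] at this
    omega
  · rintro b (hb | hb | hb)
    · rcases List.mem_append.1 hb with hb | hb
      · exact ⟨(K.left b hb).1, (K.left b hb).2.1⟩
      · obtain rfl := List.mem_singleton.1 hb
        exact ⟨K.left_end.1, by rw [K.left_end.2]; omega⟩
    · exact ⟨(K.right b hb).1, (K.right b hb).2.1⟩
    · rcases List.mem_cons.1 hb with rfl | hb
      · exact ⟨K.right_end.1, by rw [K.right_end.2]; omega⟩
      · exact ⟨(hlev b hb).1, by have := (hlev b hb).2; omega⟩
  · intro a ha b hb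
    have hb' := hlev b hb
    rcases ha with rfl | ha | ha
    · refine ⟨fun e => by rw [← e] at hb'; omega, fun e => ?_⟩
      have := h.lev_le a hs b hb'.1 e
      omega
    · rcases List.mem_append.1 ha with ha | ha
      · refine ⟨?_, hbeα b hb a (.inl ha)⟩
        rintro rfl
        have := (K.left a ha).2.2; omega
      · obtain rfl := List.mem_singleton.1 ha
        exact hbec b hb
    · refine ⟨?_, hbeα b hb a (.inr ha)⟩
      rintro rfl
      have := (K.right a ha).2.2; omega
  · rintro v (hv | hv | hv) hvx
    · rcases List.mem_append.1 hv with hv | hv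
      · refine ⟨fun hc => ?_, hanti' v (.inl hv)⟩
        have := hC'j v hc
        have := (K.left v hv).2.2; omega
      · exact hanti v (.inl (List.mem_singleton.1 hv)) hvx
    · refine ⟨fun hc => ?_, hanti' v (.inr hv)⟩
      have := hC'j v hc
      have := (K.right v hv).2.2; omega
    · exact hanti v (.inr hv) hvx

/-- This isolates the only vertex of `β` that sees `c'`; it serves as another exit from the hole. -/
theorem Kite.right_split {S : Set V} {l : ℕ} {s : V}
    {α β : List V} {c c' : V} (K : Kite G S lev l s α c β c') :
    ∃ β' v', β = β' ++ [v'] ∧ β' ≠ [] ∧ G.Adj v' c' ∧ ∀ b ∈ β', ¬ G.Adj b c' := by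
  have h4 := K.four_le
  rw [K.len] at h4
  have hne : β ≠ [] := by rintro rfl; simp at h4
  have hp : IndPath G (β ++ [c']) := by
    have h1 : IndCyc G ((β ++ [c']).reverse ++ s :: (α ++ [c])) := K.cyc.rotate
    have := (h1.indPath_of_append (by simp)).reverse
    rwa [List.reverse_reverse] at this
  have e : β = β.dropLast ++ [β.getLast hne] := (List.dropLast_append_getLast hne).symm
  have hlink := (indPath_append.1 hp).2.2
  have hnd : β.Nodup := hp.of_append_left.nodup
  have hlast : β.getLast? = some (β.getLast hne) := List.getLast?_eq_some_getLast hne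
  refine ⟨β.dropLast, β.getLast hne, e, ?_, ?_, ?_⟩
  · intro h
    have := congrArg List.length h
    simp at this
    omega
  · exact (hlink _ (List.getLast_mem hne) c' (by simp)).2.2 ⟨hlast, rfl⟩
  · intro b hb hbc
    have := ((hlink b (List.mem_of_mem_dropLast hb) c' (by simp)).2.1 hbc).1
    rw [hlast, Option.some_inj] at this
    rw [e, List.nodup_append] at hnd
    exact hnd.2.2 b hb _ (by simp) this.symm

/-- The case where the lowest edge of the hole lies in the last level. -/
theorem Kite.exists_block_top (hG : 11 ≤ G.oddGirth) (h : Levelling G ({x} ∪ C) x lev par) {l : ℕ}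
    {s : V} {α β : List V} {c c' : V} (K : Kite G ({x} ∪ C) lev l s α c β c') {st : List V} {x' : V}
    {C' : Set V} {N : ℕ} (hs : s ∈ ({x} ∪ C : Set V))
    (hst : IndPath G (st ++ [s]) ∧ (st ++ [s]).head? = some x ∧
      ∀ v ∈ st, v ∈ ({x} ∪ C : Set V) ∧ lev v < lev s)
    (hx' : x' ∈ ({x} ∪ C : Set V) ∧ lev x' = l)
    (hC' : C' ⊆ C) (hC'l : ∀ v ∈ C', lev v = l) (hcol : ¬ ColOn G C' N)
    (hatt : Att G x' C')
    (hcC : ∀ w ∈ C', ¬ G.Adj c w) (hcC' : ∀ w ∈ C', ¬ G.Adj c' w)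
    (htopC : ∀ a, (a ∈ α ∧ G.Adj a c) ∨ (a ∈ β ∧ G.Adj a c') → ∀ w ∈ C', ¬ G.Adj a w)
    (hhit : G.Adj x' c' ∨ (¬ G.Adj x' c ∧ ¬ G.Adj x' c' ∧ ∃ v ∈ β, G.Adj v c' ∧ G.Adj x' v)) :
    ∃ st s ar t be, Block G x C N st s ar t be x' C' := by
  have hl := K.lev_lt
  have h4 := K.four_le
  obtain ⟨β', v', rfl, hβ', hv'c', hβ'c⟩ := K.right_split
  have hxne : ∀ a ∈ C', x' ≠ a := fun a ha e => hatt.1 (e ▸ ha)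
  obtain ⟨w, hw, hxw⟩ := hatt.2.2
  have hcx : c ≠ x' := fun e => hcC w hw (e ▸ hxw)
  have hc'x : c' ≠ x' := fun e => hcC' w hw (e ▸ hxw)
  have hlow : ∀ a, (a ∈ α ∨ a ∈ β' ++ [v']) → a ∈ ({x} ∪ C : Set V) ∧ lev s < lev a ∧ lev a < l := by
    rintro a (ha | ha)
    · exact K.left a ha
    · exact K.right a ha
  have htop : ∀ a, (a ∈ α ∨ a ∈ β' ++ [v']) → ∀ y, y ∈ ({x} ∪ C : Set V) ∧ lev y = l → G.Adj a y →
      (a ∈ α ∧ G.Adj a c) ∨ (a ∈ β' ++ [v'] ∧ G.Adj a c') := by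
    intro a ha y hy hay
    have h1 := hlow a ha
    have := h.lev_le a h1.1 y hy.1 hay
    rcases ha with ha | ha
    · exact .inl ⟨ha, K.left_top a ha (by omega)⟩
    · exact .inr ⟨ha, K.right_top a ha (by omega)⟩
  have hantiC : ∀ a, (a ∈ α ∨ a ∈ β' ++ [v']) → ∀ w ∈ C', ¬ G.Adj a w := by
    intro a ha w hw haw
    exact htopC a (htop a ha w ⟨.inr (hC' hw), hC'l w hw⟩ haw) w hw haw
  have hlowC : ∀ a, (a ∈ α ∨ a ∈ β' ++ [v']) → a ∉ C' := by
    intro a ha hc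
    have := hC'l a hc
    have := hlow a ha
    omega
  have hcn : c ∉ C' := fun hc => hcC' c hc K.adj.symm
  have hc'n : c' ∉ C' := fun hc => hcC c' hc K.adj
  have hv'β : v' ∈ β' ++ [v'] := by simp
  have hsadj : ∀ y, y ∈ ({x} ∪ C : Set V) ∧ lev y = l → s ≠ y ∧ ¬ G.Adj s y := by
    intro y hy
    refine ⟨fun e => by rw [← e] at hy; omega, fun e => ?_⟩
    have := h.lev_le s hs y hy.1 e
    omega
  have hβα : ∀ a ∈ β', ¬ G.Adj a x' := by
    intro a ha hax
    have ha' : a ∈ β' ++ [v'] := List.mem_append_left _ ha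
    have h1 := hlow a (.inr ha')
    have := h.lev_le a h1.1 x' hx'.1 hax
    exact hβ'c a ha (K.right_top a ha' (by omega))
  have hsing : ∀ t, G.Adj t x' → IndPath G [t, x'] := by
    intro t ht
    refine ⟨fun b hb => ?_, indPath_singleton x'⟩
    obtain rfl := List.mem_singleton.1 hb
    exact ⟨ht.ne, by simp [ht]⟩
  -- If `x'` sees `c'`, the hole is left at `c'`, unless `x'` also sees the end of `α`; in that case
  -- `x'` replaces `c` on the hole and is itself the exit. If `x'` does not see `c'`, it sees the
  -- end of `β`, and the hole is left there.
  by_cases hx'c' : G.Adj x' c'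
  · have hx'c : ¬ G.Adj x' c := fun e => not_closed_three hG e K.adj hx'c'.symm
    have hx'v' : ¬ G.Adj x' v' := fun e => not_closed_three hG e hv'c' hx'c'.symm
    by_cases hα : ∃ v ∈ α, G.Adj v x'
    · -- the vertex `x'` sees `c'` and the parent of `c`
      obtain ⟨v, hv, hvx⟩ := hα
      have hvc : G.Adj v c := by
        rcases htop v (.inl hv) x' hx' hvx with h1 | h1
        · exact h1.2
        · have h2 := h1.1
          rcases List.mem_append.1 h2 with h2 | h2
          · exact absurd hvx (hβα v h2)
          · obtain rfl := List.mem_singleton.1 h2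
            exact absurd hvx.symm hx'v'
      obtain ⟨α', v₀, rfl, hα', hv₀, hα'c⟩ := K.symm.right_split
      have hvv₀ : v = v₀ := by
        rcases List.mem_append.1 hv with h2 | h2
        · exact absurd hvc (hα'c v h2)
        · exact List.mem_singleton.1 h2
      subst hvv₀
      have hlen := K.len
      simp only [List.length_append, List.length_singleton] at hlen h4
      -- the new hole drops `c`
      have hcyc : IndCyc G (s :: (α' ++ [v]) ++ x' :: ((β' ++ [v']) ++ [c']).reverse) := by
        have e : s :: (α' ++ [v] ++ [c]) ++ (β' ++ [v'] ++ [c']).reverse =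
          [] ++ (s :: (α' ++ [v])) ++ ([c] ++ (β' ++ [v'] ++ [c']).reverse) := by simp
        have hK := K.cyc
        rw [e, List.nil_append] at hK
        have hp1 : IndPath G (s :: (α' ++ [v])) := hK.indPath_of_append (by simp)
        have hK' := (indCyc_append (by simp) (by simp)).1 hK
        have hp2 : IndPath G (β' ++ [v'] ++ [c']).reverse := hK'.2.2.1.of_append_right
        have hlink : ∀ a ∈ s :: (α' ++ [v]), ∀ b ∈ (β' ++ [v'] ++ [c']).reverse, a ≠ b ∧
            (G.Adj a b ↔ s = a ∧ (β' ++ [v'] ++ [c']).reverse.getLast? = some b) := by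
          intro a ha b hb
          have h1 := hK'.2.2.2 a ha b (List.mem_append_right _ hb)
          refine ⟨h1.1, ?_⟩
          rw [h1.2]
          have e2 : ([c] ++ (β' ++ [v'] ++ [c']).reverse).getLast? =
              (β' ++ [v'] ++ [c']).reverse.getLast? :=
            List.getLast?_append_of_ne_nil _ (by simp)
          rw [e2]
          have hcb : c ≠ b := (hK'.2.2.1.1 b hb).1
          simp [hcb]
        have hx'β : ∀ b ∈ (β' ++ [v'] ++ [c']).reverse, x' ≠ b ∧ (G.Adj x' b ↔ b = c') := by
          intro b hb
          rw [List.mem_reverse, List.mem_append, List.mem_singleton] at hb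
          rcases hb with hb | rfl
          · have hb' := hlow b (.inr hb)
            refine ⟨fun e => by rw [← e] at hb'; omega, iff_of_false (fun hxb => ?_) ?_⟩
            · rcases List.mem_append.1 hb with hb | hb
              · exact hβα b hb hxb.symm
              · obtain rfl := List.mem_singleton.1 hb
                exact hx'v' hxb
            · rintro rfl
              have := K.right_end.2
              omega
          · exact ⟨hc'x.symm, by simp [hx'c']⟩
        have hp3 : IndPath G (x' :: (β' ++ [v'] ++ [c']).reverse) := by
          refine ⟨fun b hb => ⟨(hx'β b hb).1, ?_⟩, hp2⟩
          rw [(hx'β b hb).2, List.head?_reverse, List.getLast?_append]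
          simp [eq_comm]
        rw [indCyc_append (by simp) (by simp)]
        refine ⟨by simp; omega, hp1, hp3, ?_⟩
        have elast : (s :: (α' ++ [v])).getLast? = some v := by
          rw [← List.cons_append, List.getLast?_append]; simp
        have elast' : (x' :: (β' ++ [v'] ++ [c']).reverse).getLast? =
            (β' ++ [v'] ++ [c']).reverse.getLast? := by
          rw [← List.singleton_append, List.getLast?_append_of_ne_nil _ (by simp)]
        rw [CycLink, elast, elast']
        intro a ha b hb
        rcases List.mem_cons.1 hb with rfl | hb
        · have e3 : (β' ++ [v'] ++ [c']).reverse.getLast? ≠ some b := by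
            intro e3
            exact (hx'β b (List.mem_of_mem_getLast? e3)).1 rfl
          rcases List.mem_cons.1 ha with rfl | ha
          · have h1 := hsadj b hx'
            have hva : v ≠ a := by
              rintro rfl
              exact h1.2 hvx
            exact ⟨h1.1, iff_of_false h1.2 (by
              rintro (⟨h2, -⟩ | ⟨-, h2⟩)
              · exact hva (Option.some_inj.1 h2)
              · exact e3 h2)⟩
          · have h1 := hlow a (.inl ha)
            have hsa : s ≠ a := by rintro rfl; omega
            refine ⟨fun e => by rw [e] at h1; omega, ?_⟩
            simp only [Option.some_inj, List.head?_cons, e3, and_false, or_false, and_true]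
            constructor
            · intro hab
              rcases htop a (.inl ha) b hx' hab with h2 | h2
              · rcases List.mem_append.1 ha with ha | ha
                · exact absurd h2.2 (hα'c a ha)
                · exact (List.mem_singleton.1 ha).symm
              · rcases List.mem_append.1 h2.1 with h3 | h3
                · exact absurd hab (hβα a h3)
                · obtain rfl := List.mem_singleton.1 h3
                  exact absurd hab.symm hx'v'
            · rintro rfl
              exact hvx
        · have h1 := hlink a ha b hb
          refine ⟨h1.1, ?_⟩
          rw [h1.2]
          simp [(hx'β b hb).1]
      refine h.exists_block (a₁ := α' ++ [v]) (a₂ := (β' ++ [v']) ++ [c']) (t := x') (be := [])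
        hs hst hcyc ?_ (by simp) (by simp) (indPath_singleton x') rfl ?_ (by simp) hC' hcol hatt
        (fun w hw => by rw [hC'l w hw]; omega) ?_
      · simp only [List.length_append, List.length_singleton]; omega
      · rintro b (hb | hb | hb)
        · exact ⟨(K.left b hb).1, (K.left b hb).2.1⟩
        · rcases List.mem_append.1 hb with hb | hb
          · exact ⟨(K.right b hb).1, (K.right b hb).2.1⟩
          · obtain rfl := List.mem_singleton.1 hb
            exact ⟨K.right_end.1, by rw [K.right_end.2]; omega⟩
        · obtain rfl := List.mem_singleton.1 hb
          exact ⟨hx'.1, by omega⟩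
      · rintro a (ha | ha | ha) hax
        · exact ⟨hlowC a (.inl ha), hantiC a (.inl ha)⟩
        · rcases List.mem_append.1 ha with ha | ha
          · exact ⟨hlowC a (.inr ha), hantiC a (.inr ha)⟩
          · obtain rfl := List.mem_singleton.1 ha
            exact ⟨hc'n, hcC'⟩
        · exact absurd (List.mem_singleton.1 ha) hax
    · push Not at hα
      refine K.exists_block_end h (j := l) (be := [x']) hs hst (hsing c' hx'c'.symm) rfl ?_ ?_ ?_
        le_rfl hC' hC'l hcol hatt ?_ hantiC
      · intro b hb
        obtain rfl := List.mem_singleton.1 hb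
        exact ⟨hx'.1, hx'.2.ge⟩
      · intro b hb
        obtain rfl := List.mem_singleton.1 hb
        exact ⟨hcx, fun e => hx'c e.symm⟩
      · intro b hb a ha
        obtain rfl := List.mem_singleton.1 hb
        rcases ha with ha | ha
        · exact hα a ha
        · rcases List.mem_append.1 ha with ha | ha
          · exact hβα a ha
          · obtain rfl := List.mem_singleton.1 ha
            exact fun e => hx'v' e.symm
      · rintro a (rfl | ha) hax
        · exact ⟨hcn, hcC⟩
        · rcases List.mem_cons.1 ha with rfl | ha
          · exact ⟨hc'n, hcC'⟩
          · exact absurd (List.mem_singleton.1 ha) hax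
  · obtain ⟨hx'c, -, v, hv, hvc', hx'v⟩ := hhit.resolve_left hx'c'
    have hvv' : v = v' := by
      rcases List.mem_append.1 hv with h2 | h2
      · exact absurd hvc' (hβ'c v h2)
      · exact List.mem_singleton.1 h2
    subst hvv'
    have hlen := K.len
    simp only [List.length_append, List.length_singleton] at hlen
    have hαx : ∀ a ∈ α, ¬ G.Adj a x' := by
      intro a ha hax
      have h1 := hlow a (.inl ha)
      have := h.lev_le a h1.1 x' hx'.1 hax
      have h2 := K.left_top a ha (by omega)
      exact not_closed_five hG hax.symm h2 K.adj hvc'.symm hx'v.symm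
    -- The arcs have `α.length + 2` and `α.length - 1` vertices.
    refine h.exists_block (a₁ := α ++ [c, c']) (a₂ := β') (t := v) (be := [x'])
        hs hst ?_ ?_ (by simp) hβ' (hsing v hx'v.symm) rfl ?_ ?_ hC' hcol hatt
        (fun w hw => by rw [hC'l w hw]; omega) ?_
    · simpa using K.cyc
    · simp only [List.length_append, List.length_cons, List.length_nil]; omega
    · rintro b (hb | hb | hb)
      · rcases List.mem_append.1 hb with hb | hb
        · exact ⟨(K.left b hb).1, (K.left b hb).2.1⟩
        · simp only [List.mem_cons, List.not_mem_nil, or_false] at hb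
          rcases hb with rfl | rfl
          · exact ⟨K.left_end.1, by rw [K.left_end.2]; omega⟩
          · exact ⟨K.right_end.1, by rw [K.right_end.2]; omega⟩
      · have := K.right b (List.mem_append_left _ hb)
        exact ⟨this.1, this.2.1⟩
      · simp only [List.mem_cons, List.not_mem_nil, or_false] at hb
        rcases hb with rfl | rfl
        · exact ⟨(K.right b hv).1, (K.right b hv).2.1⟩
        · exact ⟨hx'.1, by omega⟩
    · intro a ha b hb
      obtain rfl := List.mem_singleton.1 hb
      rcases ha with rfl | ha | ha
      · exact hsadj b hx'
      · rcases List.mem_append.1 ha with ha | ha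
        · refine ⟨?_, hαx a ha⟩
          rintro rfl
          have := hlow a (.inl ha); omega
        · simp only [List.mem_cons, List.not_mem_nil, or_false] at ha
          rcases ha with rfl | rfl
          · exact ⟨hcx, fun e => hx'c e.symm⟩
          · exact ⟨hc'x, fun e => hx'c' e.symm⟩
      · refine ⟨?_, hβα a ha⟩
        rintro rfl
        have := hlow a (.inr (List.mem_append_left _ ha)); omega
    · rintro a (ha | ha | ha) hax
      · rcases List.mem_append.1 ha with ha | ha
        · exact ⟨hlowC a (.inl ha), hantiC a (.inl ha)⟩
        · simp only [List.mem_cons, List.not_mem_nil, or_false] at ha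
          rcases ha with rfl | rfl
          · exact ⟨hcn, hcC⟩
          · exact ⟨hc'n, hcC'⟩
      · exact ⟨hlowC a (.inr (List.mem_append_left _ ha)),
          hantiC a (.inr (List.mem_append_left _ ha))⟩
      · simp only [List.mem_cons, List.not_mem_nil, or_false] at ha
        rcases ha with rfl | rfl
        · exact ⟨hlowC a (.inr hv), hantiC a (.inr hv)⟩
        · exact absurd rfl hax

end Levels

/-- Every attached set of large chromatic number contains a block that leads to an attached set of
large chromatic number. -/
theorem Att.exists_block (hG : 11 ≤ G.oddGirth) {x : V} {C : Set V} (hatt : Att G x C) {N : ℕ}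
    (hcol : ¬ ColOn G C (2 * (N + 2))) :
    ∃ st s ar t be x' C', Block G x C N st s ar t be x' C' := by
  obtain ⟨lev, par, h⟩ := hatt.connOn_insert.exists_levelling (r := x) (.inl rfl)
  set S : Set V := {x} ∪ C with hS
  -- The two extra colours pay for the set of neighbours that is deleted from the component of this
  -- level.
  obtain ⟨j, hj⟩ := h.exists_level (N := N + 2) (fun hc => hcol (hc.mono (fun v hv => .inr hv) le_rfl))
  obtain ⟨D, hDS, hD, hDcol, hDcomp⟩ := exists_component hj
  have hj0 : 0 < j := by
    by_contra hj0
    refine hDcol ((StableOn.colOn (S := D) ?_).mono subset_rfl (by omega))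
    intro u hu v hv huv
    have e1 := h.eq_root (hDS hu).1 (by rw [(hDS hu).2]; omega)
    have e2 := h.eq_root (hDS hv).1 (by rw [(hDS hv).2]; omega)
    rw [e1, e2] at huv
    exact G.irrefl huv
  have hDC : D ⊆ C := by
    intro v hv
    refine (hDS hv).1.resolve_left fun e => ?_
    have := (hDS hv).2
    rw [Set.mem_singleton_iff.1 e, h.root] at this
    omega
  -- the vertices above `D`
  let Up : V → V → Prop := fun a b => G.Adj a b ∧ a ∈ S ∧ b ∈ S ∧ lev b = lev a + 1
  let U : Set V := {a | ∃ w ∈ D, Relation.ReflTransGen Up a w}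
  have hUS : ∀ a ∈ U, a ∈ S ∧ lev a ≤ j := by
    rintro a ⟨w, hw, haw⟩
    induction haw using Relation.ReflTransGen.head_induction_on with
    | refl => exact ⟨(hDS hw).1, (hDS hw).2.le⟩
    | head hab _ ih => exact ⟨hab.2.1, by have := hab.2.2.2; omega⟩
  have hUj : ∀ a ∈ U, lev a = j → a ∈ D := by
    rintro a ⟨w, hw, haw⟩ haj
    rcases Relation.ReflTransGen.cases_head haw with rfl | ⟨b, hab, hbw⟩
    · exact hw
    · have := (hUS b ⟨w, hw, hbw⟩).2
      have := hab.2.2.2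
      omega
  have hUup : ∀ u ∈ S, ∀ v ∈ U, G.Adj u v → lev v = lev u + 1 → u ∈ U := by
    rintro u hu v ⟨w, hw, hvw⟩ huv hl
    exact ⟨w, hw, .head ⟨huv, hu, (hUS v ⟨w, hw, hvw⟩).1, hl⟩ hvw⟩
  -- the highest horizontal edge above `D`
  have hex : ∃ l, ∃ c ∈ S, ∃ c' ∈ U, G.Adj c c' ∧ lev c = l ∧ lev c' = l := by
    have h2 : ¬ ColOn G D 1 := fun h1 => hDcol (h1.mono subset_rfl (by omega))
    have h3 : ¬ StableOn G D := fun h3 => h2 h3.colOn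
    simp only [StableOn] at h3
    push Not at h3
    obtain ⟨u, hu, v, hv, huv⟩ := h3
    exact ⟨j, u, (hDS hu).1, v, ⟨v, hv, .refl⟩, huv, (hDS hu).2, (hDS hv).2⟩
  classical
  obtain ⟨c, hcS, c', hc'U, hcc', hcl, hc'l⟩ := Nat.find_spec hex
  have hmin := fun m hm => Nat.find_min hex (m := m) hm
  set l := Nat.find hex with hl
  have hc'S := (hUS c' hc'U).1
  have hlj : l ≤ j := by rw [← hc'l]; exact (hUS c' hc'U).2
  -- By the choice of `l` no horizontal edge with an end in `U` lies nearer to the root, as the cone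
  -- requires.
  obtain ⟨s, α, β, hs, hlen, hα, hβ, hαl, hβl, hαβ, hsl, hαt, hβt⟩ := h.exists_cone hUup l c c' hcS
    hc'S hcl hc'l hcc'.ne hc'U (fun a ha b hb hab hlev => by
      by_contra hlt
      exact hmin (lev b) (by omega) ⟨a, ha, b, hb, hab, hlev, rfl⟩)
  obtain ⟨st, hst1, hst2, hst3⟩ := h.exists_geodesic (lev s) s hs rfl
  have hst := And.intro hst1 (And.intro hst2 hst3)
  have hcyc : IndCyc G (s :: (α ++ [c]) ++ (β ++ [c']).reverse) := by
    rw [indCyc_append (by simp) (by simp)]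
    refine ⟨by simp; omega, hα, hβ.2.reverse, ?_⟩
    have e1 : (s :: (α ++ [c])).getLast? = some c := by
      rw [← List.cons_append, List.getLast?_append]; simp
    have e2 : (β ++ [c']).reverse.head? = some c' := by simp
    rw [CycLink, e1, e2]
    intro a ha b hb
    rw [List.mem_reverse] at hb
    rw [List.getLast?_reverse]
    rcases List.mem_cons.1 ha with rfl | ha
    · have h1 := hβ.1 b hb
      refine ⟨h1.1, ?_⟩
      rw [h1.2]
      have : c ≠ a := by rintro rfl; omega
      simp [this]
    · have h1 := hαβ a ha b hb
      have : s ≠ a := (hα.1 a ha).1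
      refine ⟨h1.1, ?_⟩
      simp only [Option.some_inj, List.head?_cons, this, false_and, or_false]
      constructor
      · intro hab
        obtain ⟨rfl, rfl⟩ := h1.2 hab
        exact ⟨rfl, rfl⟩
      · rintro ⟨rfl, rfl⟩
        exact hcc'
  -- The cycle has `2 * α.length + 3` vertices; being odd it has at least eleven, whence `4 ≤
  -- α.length`.
  have h11 := hcyc.eleven_le hG (by
    rw [Nat.odd_iff]
    simp only [List.length_append, List.length_cons, List.length_nil, List.length_reverse]
    omega)
  have K : Kite G S lev l s α c β c' := ⟨hlen, by
    simp only [List.length_append, List.length_cons, List.length_nil, List.length_reverse] at h11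
    omega, hcyc, hαl, hβl, hαt, hβt, ⟨hcS, hcl⟩, ⟨hc'S, hc'l⟩, hcc'⟩
  have hnb := stableOn_neighbor hG
  have hadjlow : ∀ a ∈ S, ∀ b ∈ D, G.Adj a b → j ≤ lev a + 1 := by
    intro a ha b hb hab
    have := h.lev_le a ha b (hDS hb).1 hab
    rw [(hDS hb).2] at this
    exact this
  rcases hlj.lt_or_eq with hlj' | hlj'
  · obtain ⟨w, hw, hc'w⟩ := id hc'U
    have hwj := (hDS hw).2
    obtain ⟨m, z, g1, g2, g3, g4, g5, g6, g7, g8, g9⟩ := h.exists_descent hc'w (by omega)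
    have hzl : lev z + 1 = j := by omega
    have hzm : z ∈ c' :: m := List.mem_of_mem_getLast? g2
    rcases m with _ | ⟨m₁, m⟩
    · -- the edge lies just above the last level
      obtain rfl : c' = z := by simpa using g2
      have hE : ColOn G (D ∩ {v | G.Adj v c ∨ G.Adj v c'}) 2 :=
        (hnb c).colOn.of_cover (hnb c').colOn (fun v hv => hv.2) le_rfl
      obtain ⟨x', C', k1, k2, k3, k4, k5, k6⟩ := hD.exists_attached ⟨w, hw, .inr g3.symm⟩ hE hDcol
      have hx'j := (hDS k1).2
      -- The vertex `x'` may see either end of the edge; stated for any kite at `s`, this covers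
      -- both cases by symmetry.
      have fin : ∀ {α β : List V} {c c' : V}, Kite G S lev l s α c β c' → G.Adj x' c' →
          (∀ v ∈ C', ¬ G.Adj c v ∧ ¬ G.Adj c' v) → ∃ st s ar t be x' C',
            Block G x C N st s ar t be x' C' := by
        intro α β c c' K hx'c' hcC
        have hlow : ∀ a, (a ∈ α ∨ a ∈ β) → ∀ v ∈ D, ¬ G.Adj a v := by
          intro a ha v hv hav
          have : a ∈ S ∧ lev a < l := by
            rcases ha with ha | ha
            · exact ⟨(K.left a ha).1, (K.left a ha).2.2⟩
            · exact ⟨(K.right a ha).1, (K.right a ha).2.2⟩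
          have := hadjlow a this.1 v hv hav
          omega
        obtain ⟨st, s, ar, t, be, hb⟩ := K.exists_block_end h (j := j) (be := [x']) hs hst
          ⟨fun b hb => by
            obtain rfl := List.mem_singleton.1 hb
            exact ⟨hx'c'.symm.ne, by simp [hx'c'.symm]⟩, indPath_singleton x'⟩ rfl
          (fun b hb => by
            obtain rfl := List.mem_singleton.1 hb
            exact ⟨(hDS k1).1, by omega⟩)
          (fun b hb => by
            obtain rfl := List.mem_singleton.1 hb
            refine ⟨?_, fun e => not_closed_three hG e.symm K.adj hx'c'.symm⟩
            rintro rfl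
            have := K.left_end.2
            omega)
          (fun b hb a ha => by
            obtain rfl := List.mem_singleton.1 hb
            exact hlow a ha b k1) hlj (k3.trans hDC) (fun v hv => (hDS (k3 hv)).2) k5 k6
          (by
            rintro v (rfl | hv) hvx
            · exact ⟨fun hv => by have := (hDS (k3 hv)).2; have := K.left_end.2; omega,
                fun w hw => (hcC w hw).1⟩
            · rcases List.mem_cons.1 hv with rfl | hv
              · exact ⟨fun hv => by have := (hDS (k3 hv)).2; have := K.right_end.2; omega,
                  fun w hw => (hcC w hw).2⟩
              · exact absurd (List.mem_singleton.1 hv) hvx)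
          (fun v hv w hw => hlow v hv w (k3 hw))
        exact ⟨st, s, ar, t, be, x', C', hb⟩
      rcases k2 with k2 | k2
      · exact fin K.symm k2 (fun v hv => ⟨fun e => k4 v hv (.inr e.symm),
          fun e => k4 v hv (.inl e.symm)⟩)
      · exact fin K k2 (fun v hv => ⟨fun e => k4 v hv (.inl e.symm),
          fun e => k4 v hv (.inr e.symm)⟩)
    · -- the edge lies higher, and we descend to the last level
      have hE : ColOn G (D ∩ {v | G.Adj v z}) 1 :=
        ((hnb z).mono fun v hv => hv.2).colOn
      obtain ⟨x', C', k1, k2, k3, k4, k5, k6⟩ := hD.exists_attached (N := N) ⟨w, hw, g3.symm⟩ hE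
        (fun hc => hDcol (hc.mono subset_rfl (by omega)))
      have hx'j := (hDS k1).2
      have hzm' : z ∈ m₁ :: m := by
        rw [List.getLast?_cons_cons] at g2
        exact List.mem_of_mem_getLast? g2
      have hzl' := (g7 z hzm').2.1
      have hc'S' : ∀ b ∈ c' :: m₁ :: m, b ∈ S ∧ l ≤ lev b ∧ lev b < j := by
        intro b hb
        rcases List.mem_cons.1 hb with rfl | hb
        · exact ⟨hc'S, hc'l.ge, by omega⟩
        · have := g7 b hb
          exact ⟨this.1, by omega, by omega⟩
      have hzD : ∀ b ∈ c' :: m₁ :: m, ∀ v ∈ D, G.Adj b v → b = z := by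
        intro b hb v hv hbv
        have h1 := hc'S' b hb
        have := hadjlow b h1.1 v hv hbv
        exact g8 b hb (by omega)
      obtain ⟨m₀, hm₀⟩ : ∃ m₀, c' :: m₁ :: m = m₀ ++ [z] := by
        refine ⟨(c' :: m₁ :: m).dropLast, ?_⟩
        rw [List.getLast?_eq_some_getLast (by simp), Option.some_inj] at g2
        rw [← g2, List.dropLast_append_getLast]
      have hbe : IndPath G (c' :: (m₁ :: m ++ [x'])) := by
        have : c' :: (m₁ :: m ++ [x']) = m₀ ++ z :: [x'] := by
          rw [← List.cons_append, hm₀]; simp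
        rw [this]
        refine indPath_glue (hm₀ ▸ g1) ⟨fun b hb => ?_, indPath_singleton x'⟩ ?_
        · obtain rfl := List.mem_singleton.1 hb
          have k2' : G.Adj b z := k2
          exact ⟨k2'.symm.ne, by simp [k2'.symm]⟩
        · intro u hu v hv
          obtain rfl := List.mem_singleton.1 hv
          have hu' : u ∈ c' :: m₁ :: m := by rw [hm₀]; exact List.mem_append_left _ hu
          refine ⟨fun e => by have := hc'S' u hu'; rw [e] at this; omega, fun e => ?_⟩
          have := hzD u hu' v k1 e
          have hnd := g1.nodup
          rw [hm₀, List.nodup_append] at hnd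
          exact hnd.2.2 u hu z (by simp) this
      have hlowl : ∀ a, (a ∈ α ∨ a ∈ β) → a ∈ S ∧ lev a < l := by
        rintro a (ha | ha)
        · exact ⟨(hαl a ha).1, (hαl a ha).2.2⟩
        · exact ⟨(hβl a ha).1, (hβl a ha).2.2⟩
      have hbelev : ∀ b ∈ m₁ :: m ++ [x'], b ∈ S ∧ l < lev b := by
        intro b hb
        rcases List.mem_append.1 hb with hb | hb
        · have := g7 b hb
          exact ⟨this.1, by omega⟩
        · obtain rfl := List.mem_singleton.1 hb
          exact ⟨(hDS k1).1, by omega⟩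
      obtain ⟨st, s, ar, t, be, hb⟩ := K.exists_block_end h (j := j) (be := m₁ :: m ++ [x']) hs hst
        hbe (by rw [← List.cons_append, List.getLast?_append]; rfl)
        (fun b hb => ⟨(hbelev b hb).1, (hbelev b hb).2.le⟩)
        (fun b hb => by
          have h1 := hbelev b hb
          refine ⟨fun e => by rw [← e] at h1; omega, fun e => ?_⟩
          have h2 := h.lev_le c hcS b h1.1 e
          rcases List.mem_append.1 hb with hb | hb
          · have h3 := g9 b hb (by omega)
            exact not_closed_three hG e h3.symm hcc'.symm
          · obtain rfl := List.mem_singleton.1 hb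
            omega)
        (fun b hb a ha e => by
          have h1 := hbelev b hb
          have h2 := hlowl a ha
          have := h.lev_le a h2.1 b h1.1 e
          omega) hlj (k3.trans hDC) (fun v hv => (hDS (k3 hv)).2) k5 k6
        (by
          rintro v (rfl | hv) hvx
          · refine ⟨fun hv => by have := (hDS (k3 hv)).2; omega, fun w hw e => ?_⟩
            have := hadjlow v hcS w (k3 hw) e
            omega
          · rw [← List.cons_append] at hv
            rcases List.mem_append.1 hv with hv | hv
            · refine ⟨fun hvC => ?_, fun w hw e => ?_⟩
              · have := (hDS (k3 hvC)).2
                have := hc'S' v hv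
                omega
              · obtain rfl := hzD v hv w (k3 hw) e
                exact k4 w hw e.symm
            · exact absurd (List.mem_singleton.1 hv) hvx)
        (fun v hv w hw e => by
          have h2 := hlowl v hv
          have := hadjlow v h2.1 w (k3 hw) e
          omega)
      exact ⟨st, s, ar, t, be, x', C', hb⟩
  · -- the edge lies in the last level
    have hc'D : c' ∈ D := hUj c' hc'U (by omega)
    have hcD : c ∈ D := hDcomp c' hc'D c ⟨hcS, by omega⟩ hcc'.symm
    obtain ⟨β', v', hβe, -, hv'c', hβ'c'⟩ := K.right_split
    obtain ⟨α', v, hαe, -, hvc, hα'c⟩ := K.symm.right_split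
    have hvα : ∀ a ∈ α, G.Adj a c → a = v := by
      intro a ha hac
      rw [hαe] at ha
      rcases List.mem_append.1 ha with ha | ha
      · exact absurd hac (hα'c a ha)
      · exact List.mem_singleton.1 ha
    have hvβ : ∀ a ∈ β, G.Adj a c' → a = v' := by
      intro a ha hac
      rw [hβe] at ha
      rcases List.mem_append.1 ha with ha | ha
      · exact absurd hac (hβ'c' a ha)
      · exact List.mem_singleton.1 ha
    -- The vertices `v` and `c'` are joined by a path of length two, so an edge between their
    -- neighbourhoods would close a walk of length five. Thus the four neighbourhoods to be deleted
    -- cost only two colours.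
    have hE1 : StableOn G {z | G.Adj z v ∨ G.Adj z c'} := by
      rintro a (ha | ha) b (hb | hb) hab
      · exact hnb v a ha b hb hab
      · exact not_closed_five hG ha hvc hcc' (G.adj_symm hb) hab.symm
      · exact not_closed_five hG hb hvc hcc' (G.adj_symm ha) hab
      · exact hnb c' a ha b hb hab
    have hE2 : StableOn G {z | G.Adj z c ∨ G.Adj z v'} := by
      rintro a (ha | ha) b (hb | hb) hab
      · exact hnb c a ha b hb hab
      · exact not_closed_five hG ha hcc' hv'c'.symm (G.adj_symm hb) hab.symm
      · exact not_closed_five hG hb hcc' hv'c'.symm (G.adj_symm ha) hab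
      · exact hnb v' a ha b hb hab
    have hE : ColOn G (D ∩ ({z | G.Adj z v ∨ G.Adj z c'} ∪ {z | G.Adj z c ∨ G.Adj z v'})) 2 :=
      hE1.colOn.of_cover hE2.colOn (fun v hv => hv.2) le_rfl
    obtain ⟨x', C', k1, k2, k3, k4, k5, k6⟩ := hD.exists_attached
      ⟨c, hcD, .inl (.inr hcc')⟩ hE hDcol
    have hx' : x' ∈ S ∧ lev x' = l := by
      have := hDS k1
      exact ⟨this.1, by rw [this.2]; omega⟩
    have hC'l : ∀ w ∈ C', lev w = l := fun w hw => by rw [(hDS (k3 hw)).2]; omega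
    have t1 : ∀ w ∈ C', ¬ G.Adj v w := fun w hw e => k4 w hw (.inl (.inl e.symm))
    have t2 : ∀ w ∈ C', ¬ G.Adj c' w := fun w hw e => k4 w hw (.inl (.inr e.symm))
    have t3 : ∀ w ∈ C', ¬ G.Adj c w := fun w hw e => k4 w hw (.inr (.inl e.symm))
    have t4 : ∀ w ∈ C', ¬ G.Adj v' w := fun w hw e => k4 w hw (.inr (.inr e.symm))
    have htop : ∀ a, (a ∈ α ∧ G.Adj a c) ∨ (a ∈ β ∧ G.Adj a c') → ∀ w ∈ C', ¬ G.Adj a w := by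
      rintro a (ha | ha)
      · rw [hvα a ha.1 ha.2]; exact t1
      · rw [hvβ a ha.1 ha.2]; exact t4
    have hvmem : v ∈ α := by rw [hαe]; simp
    have hv'mem : v' ∈ β := by rw [hβe]; simp
    by_cases a1 : G.Adj x' c'
    · obtain ⟨st, s, ar, t, be, hb⟩ := K.exists_block_top hG h hs hst hx' (k3.trans hDC) hC'l k5 k6
        t3 t2 htop (.inl a1)
      exact ⟨st, s, ar, t, be, x', C', hb⟩
    by_cases a2 : G.Adj x' c
    · obtain ⟨st, s, ar, t, be, hb⟩ := K.symm.exists_block_top hG h hs hst hx' (k3.trans hDC) hC'l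
        k5 k6 t2 t3 (fun a ha => htop a ha.symm) (.inl a2)
      exact ⟨st, s, ar, t, be, x', C', hb⟩
    by_cases a3 : G.Adj x' v'
    · obtain ⟨st, s, ar, t, be, hb⟩ := K.exists_block_top hG h hs hst hx' (k3.trans hDC) hC'l k5 k6
        t3 t2 htop (.inr ⟨a2, a1, v', hv'mem, hv'c', a3⟩)
      exact ⟨st, s, ar, t, be, x', C', hb⟩
    by_cases a4 : G.Adj x' v
    · obtain ⟨st, s, ar, t, be, hb⟩ := K.symm.exists_block_top hG h hs hst hx' (k3.trans hDC) hC'l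
        k5 k6 t2 t3 (fun a ha => htop a ha.symm) (.inr ⟨a1, a2, v, hvmem, hvc, a4⟩)
      exact ⟨st, s, ar, t, be, x', C', hb⟩
    rcases k2 with (k2 | k2) | (k2 | k2)
    · exact absurd k2 a4
    · exact absurd k2 a1
    · exact absurd k2 a2
    · exact absurd k2 a3

/-! ### A long induced path with free choices of parity -/

/-- An induced path `l ++ [y]` that starts at `x`, runs through `C` and is attached to `C' ⊆ C` by its
last vertex only. -/
structure Trail (G : SimpleGraph V) (x : V) (C : Set V) (l : List V) (y : V) (C' : Set V) :
    Prop where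
  path : IndPath G (l ++ [y])
  head : (l ++ [y]).head? = some x
  mem : ∀ v ∈ l ++ [y], v ≠ x → v ∈ C
  subset : C' ⊆ C
  att : Att G y C'
  anti : ∀ v ∈ l, v ∉ C' ∧ ∀ c ∈ C', ¬ G.Adj v c

/-- The two trails share just `y`. The vertices of `l` are outside `C'` and have no neighbour in it,
while the second trail runs in `C'` after `y`. -/
theorem Trail.trans {x y z : V} {C C' C'' : Set V} {l l' : List V} (h : Trail G x C l y C')
    (h' : Trail G y C' l' z C'') : Trail G x C (l ++ l') z C'' := by
  obtain ⟨u, hu⟩ : ∃ u, l' ++ [z] = y :: u := by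
    have := h'.head
    rcases hl : l' ++ [z] with _ | ⟨a, u⟩
    · simp at hl
    · rw [hl] at this
      exact ⟨u, by simpa using this⟩
  have hp := h'.path
  rw [hu] at hp
  have huC : ∀ v ∈ u, v ∈ C' := fun v hv =>
    h'.mem v (hu ▸ List.mem_cons_of_mem _ hv) fun e => (hp.1 v hv).1 e.symm
  have heq : l ++ l' ++ [z] = l ++ y :: u := by rw [List.append_assoc, hu]
  refine ⟨?_, ?_, ?_, h'.subset.trans h.subset, h'.att, ?_⟩
  · rw [heq]
    exact indPath_glue h.path hp fun a ha b hb =>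
      ⟨fun e => (h.anti a ha).1 (e ▸ huC b hb), (h.anti a ha).2 b (huC b hb)⟩
  · have := h.head
    rw [heq]
    rcases l with _ | ⟨a, l⟩
    · simpa using this
    · simpa using this
  · intro v hv hvx
    rw [heq] at hv
    rcases List.mem_append.1 hv with hv | hv
    · exact h.mem v (List.mem_append_left _ hv) hvx
    · rcases List.mem_cons.1 hv with rfl | hv
      · exact h.mem v (by simp) hvx
      · exact h.subset (huC v hv)
  · intro v hv
    rcases List.mem_append.1 hv with hv | hv
    · exact ⟨fun hc => (h.anti v hv).1 (h'.subset hc),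
        fun c hc => (h.anti v hv).2 c (h'.subset hc)⟩
    · exact h'.anti v hv

theorem Att.trail {x : V} {C : Set V} (h : Att G x C) : Trail G x C [] x C :=
  ⟨indPath_singleton x, rfl, fun v hv hvx => absurd (List.mem_singleton.1 hv) hvx, subset_rfl, h,
    by simp⟩

theorem Att.exists_trail {x : V} {C : Set V} (h : Att G x C) {Bd : Set V} {N β : ℕ}
    (hBd : ColOn G Bd β) (hcol : ¬ ColOn G C (N + β)) :
    ∃ l y C', Trail G x C l y C' ∧ (∀ v ∈ C', v ∉ Bd) ∧ ¬ ColOn G C' N := by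
  obtain ⟨l, y, C', h1, h2, h3, h4, h5, h6, h7, h8⟩ := h.extend hBd hcol
  exact ⟨l, y, C', ⟨h1, h2, h3, h4, h7, h8⟩, h5, h6⟩

theorem Att.exists_trail_step (hG : 11 ≤ G.oddGirth) {x : V} {C : Set V} (h : Att G x C) {N : ℕ}
    (hcol : ¬ ColOn G C (N + 1)) :
    ∃ y C', y ∈ C ∧ Trail G x C [x] y C' ∧ ¬ ColOn G C' N := by
  obtain ⟨y, C', h1, h2, h3, h4, h5, h6⟩ := h.step hG hcol
  refine ⟨y, C', h1, ⟨⟨?_, indPath_singleton y⟩, rfl, ?_, h3, h6, ?_⟩, h5⟩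
  · intro b hb
    obtain rfl := List.mem_singleton.1 hb
    exact ⟨h2.ne, by simp [h2]⟩
  · intro v hv hvx
    simp only [List.cons_append, List.nil_append, List.mem_cons, List.not_mem_nil, or_false] at hv
    exact hv.resolve_left hvx ▸ h1
  · intro v hv
    obtain rfl := List.mem_singleton.1 hv
    exact ⟨fun hc => h.1 (h3 hc), h4⟩

/-- From a vertex `x` the path can be continued to a vertex `w` at odd distance whose letter is far
from that of `x`, and on to a connected set all of whose letters are far from both. -/
theorem Att.exists_trail_mark (hG : 11 ≤ G.oddGirth) {x : V} {C : Set V} (h : Att G x C) {q : V → V}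
    (hq : ∀ v ∈ C, G.Adj v (q v)) {N : ℕ} (hcol : ¬ ColOn G C (N + 8)) :
    ∃ mid w post l y C', x :: (mid ++ w :: post) = l ++ [y] ∧ Trail G x C l y C' ∧
      Even mid.length ∧ w ∈ C ∧ Far G (q x) (q w) ∧ ¬ ColOn G C' N ∧
      ∀ v ∈ C', Far G (q x) (q v) ∧ Far G (q w) (q v) := by
  -- The 8 colours: 2 for the vertices near the letter of `x`, 1 for each of two single steps, and 2
  -- for the vertices near each of the letters of `y₂` and `y₃`.
  obtain ⟨l₁, y₁, C₁, t1, n1, c1⟩ := h.exists_trail (N := N + 6) (colOn_near hG (q x)) hcol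
  obtain ⟨y₂, C₂, m2, t2, c2⟩ := t1.att.exists_trail_step hG (N := N + 5) c1
  obtain ⟨y₃, C₃, m3, t3, c3⟩ := t2.att.exists_trail_step hG (N := N + 4) c2
  obtain ⟨l₄, y₄, C₄, t4, n4, c4⟩ := t3.att.exists_trail (N := N)
    ((colOn_near hG (q y₂)).union (colOn_near hG (q y₃))) c3
  have hfar : ∀ v ∈ C₁, Far G (q x) (q v) := fun v hv => by
    by_contra hc
    exact n1 v hv ⟨_, hq v (t1.subset hv), hc⟩
  have h21 : C₂ ⊆ C₁ := t2.subset
  have h41 : C₄ ⊆ C₁ := (t4.subset.trans t3.subset).trans h21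
  have hfar4 : ∀ v ∈ C₄, Far G (q y₂) (q v) ∧ Far G (q y₃) (q v) := fun v hv => by
    have hv' := hq v (t1.subset (h41 hv))
    constructor
    · by_contra hc
      exact n4 v hv (.inl ⟨_, hv', hc⟩)
    · by_contra hc
      exact n4 v hv (.inr ⟨_, hv', hc⟩)
  have T := ((t1.trans t2).trans t3).trans t4
  obtain ⟨u, hu⟩ : ∃ u, l₁ ++ [y₁] = x :: u := by
    have := t1.head
    rcases hl : l₁ ++ [y₁] with _ | ⟨a, u⟩
    · simp at hl
    · rw [hl] at this
      exact ⟨u, by simpa using this⟩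
  obtain ⟨r, hr⟩ : ∃ r, l₄ ++ [y₄] = y₃ :: r := by
    have := t4.head
    rcases hl : l₄ ++ [y₄] with _ | ⟨a, u⟩
    · simp at hl
    · rw [hl] at this
      exact ⟨u, by simpa using this⟩
  have heq : l₁ ++ [y₁] ++ [y₂] ++ l₄ ++ [y₄] = x :: (u ++ y₂ :: y₃ :: r) := by
    rw [hu, List.append_assoc _ l₄, hr]
    simp
  -- The vertices `y₂` and `y₃` are consecutive, so exactly one of them is at odd distance from `x`
  -- along the path.
  rcases Nat.even_or_odd u.length with hue | huo
  · exact ⟨u, y₂, y₃ :: r, _, y₄, C₄, heq.symm, T, hue, t1.subset m2, hfar _ m2, c4,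
      fun v hv => ⟨hfar v (h41 hv), (hfar4 v hv).1⟩⟩
  · exact ⟨u ++ [y₂], y₃, r, _, y₄, C₄, by rw [heq]; simp, T, by simpa using huo.add_one,
      t1.subset (h21 m3), hfar _ (h21 m3), c4, fun v hv => ⟨hfar v (h41 hv), (hfar4 v hv).2⟩⟩

/-- One of two arcs of a hole, followed by a stem with two marked vertices. -/
structure Seg (V : Type u) where
  /-- the two arcs -/
  arc : Bool → List V
  /-- the stem before the first mark -/
  pre : List V
  /-- the first mark -/
  mk₁ : V
  /-- the stem between the marks -/
  mid : List V
  /-- the second mark -/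
  mk₂ : V
  /-- the stem after the second mark -/
  post : List V

/-- The stem of a segment. -/
def Seg.stem (g : Seg V) : List V := g.pre ++ g.mk₁ :: (g.mid ++ g.mk₂ :: g.post)

/-- The path through the segments, given the choice of the arcs. -/
def segPath : List (Seg V) → (ℕ → Bool) → List V
  | [], _ => []
  | g :: R, e => g.arc (e 0) ++ (g.stem ++ segPath R fun i => e (i + 1))

/-- The conditions on a single segment: `D` contains its hole. -/
structure Seg.IsGood (G : SimpleGraph V) (D : Set V) (g : Seg V) : Prop where
  even_mid : Even g.mid.length
  parity : (g.arc true).length % 2 ≠ (g.arc false).length % 2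
  hole : ∃ s t, IndCyc G (s :: g.arc true ++ t :: (g.arc false).reverse) ∧
    ∀ v ∈ s :: g.arc true ++ t :: (g.arc false).reverse, v ∈ D

/-- The marked vertices of a list of segments. -/
def segMarks (R : List (Seg V)) : List V := R.flatMap fun g => [g.mk₁, g.mk₂]

/-- An induced path from `x` through `C` which is attached to `E ⊆ C` by its last vertex, runs through
the segments `R`, and whose marks have pairwise far letters. -/
structure Rope (G : SimpleGraph V) (q : V → V) (x : V) (C : Set V) (s₀ : List V) (R : List (Seg V))
    (y : V) (E : Set V) : Prop where
  trail : ∀ e, ∃ l, s₀ ++ segPath R e = l ++ [y] ∧ Trail G x C l y E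
  head : s₀.head? = some x
  good : ∀ g ∈ R, g.IsGood G {v | (v = x ∨ v ∈ C) ∧ v ∉ E ∧ ∀ c ∈ E, ¬ G.Adj v c}
  marks_mem : ∀ v ∈ segMarks R, v ∈ C
  marks_far : (segMarks R).Pairwise fun a b => Far G (q a) (q b)

/-- A block takes `M` colours from `2 * (M + 2)`, and the second mark takes 8 off `M`. So the bound
satisfies `f (n + 1) = 2 * (f n + 10)` with `f 0 = N`, which the given expression solves. The first
mark of a segment is the end of its block. -/
theorem Att.exists_rope (hG : 11 ≤ G.oddGirth) {q : V → V} {N : ℕ} : ∀ (n : ℕ) {x : V} {C : Set V},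
    Att G x C → (∀ v ∈ C, G.Adj v (q v)) → ¬ ColOn G C (2 ^ n * (N + 20) - 20) →
    ∃ s₀ R y E, R.length = n ∧ Rope G q x C s₀ R y E ∧ ¬ ColOn G E N
  | 0, x, C, h, _, hcol => by
    refine ⟨[x], [], x, C, rfl, ⟨fun e => ⟨[], rfl, h.trail⟩, rfl, by simp, by simp [segMarks],
      by simp [segMarks]⟩, fun hc => hcol (hc.mono subset_rfl (by simp))⟩
  | n + 1, x, C, h, hq, hcol => by
    have hpow : 2 ^ (n + 1) * (N + 20) - 20 = 2 * ((2 ^ n * (N + 20) - 20 + 8) + 2) := by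
      have : 1 ≤ 2 ^ n := Nat.one_le_two_pow
      have : 1 * (N + 20) ≤ 2 ^ n * (N + 20) := Nat.mul_le_mul_right _ this
      rw [pow_succ, mul_comm (2 ^ n) 2, mul_assoc]
      omega
    rw [hpow] at hcol
    obtain ⟨st, s, ar, t, be, x', C₁, B⟩ := h.exists_block hG hcol
    obtain ⟨pre, hpre⟩ : ∃ pre, t :: be = pre ++ [x'] := by
      refine ⟨(t :: be).dropLast, ?_⟩
      rw [← List.dropLast_append_getLast (l := t :: be) (by simp)]
      have := B.last
      rw [List.getLast?_eq_some_getLast (by simp)] at this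
      simp only [Option.some_inj] at this
      rw [this]
      simp
    have hBl : ∀ e, st ++ s :: (ar e ++ t :: be) = (st ++ s :: (ar e ++ pre)) ++ [x'] := by
      intro e
      rw [hpre]
      simp
    have T1 : ∀ e, Trail G x C (st ++ s :: (ar e ++ pre)) x' C₁ := by
      intro e
      refine ⟨hBl e ▸ B.path e, ?_, hBl e ▸ B.mem e, B.subset, B.att, ?_⟩
      · have := B.head
        rcases st with _ | ⟨a, st⟩ <;> simpa using this
      · intro v hv
        refine B.anti e v (hBl e ▸ List.mem_append_left _ hv) ?_
        rintro rfl
        have := hBl e ▸ (B.path e).nodup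
        exact (List.nodup_append.1 this).2.2 _ hv _ (by simp) rfl
    have hx'C : x' ∈ C := by
      refine (T1 true).mem x' (by simp) ?_
      rintro rfl
      have hx : x' ∈ st ++ s :: (ar true ++ pre) := by
        have := List.mem_of_mem_head? B.head
        rcases List.mem_append.1 this with h' | h'
        · exact List.mem_append_left _ h'
        · obtain rfl := List.mem_singleton.1 h'
          simp
      have := (T1 true).path.nodup
      exact (List.nodup_append.1 this).2.2 _ hx _ (by simp) rfl
    obtain ⟨mid, w, post, l, y, C₂, hl, T2, hmid, hw, hfar, hcol2, hfar2⟩ :=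
      B.att.exists_trail_mark hG (fun v hv => hq v (B.subset hv)) B.col
    obtain ⟨s₀, R, z, E, hR, P, hE⟩ := exists_rope hG n T2.att
      (fun v hv => hq v (B.subset (T2.subset hv))) hcol2
    -- The trail with the marks already ends in `y`, so only the rest `u` of the next initial stem
    -- is appended to it.
    obtain ⟨u, rfl⟩ : ∃ u, s₀ = y :: u := by
      have := P.head
      rcases s₀ with _ | ⟨a, u⟩
      · simp at this
      · exact ⟨u, by simpa using this⟩
    have hEC₂ : E ⊆ C₂ := by
      obtain ⟨l', -, T3⟩ := P.trail fun _ => true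
      exact T3.subset
    have hC₂C : C₂ ⊆ C := T2.subset.trans B.subset
    refine ⟨st ++ [s], ⟨ar, pre, x', mid, w, post ++ u⟩ :: R, z, E, by simp [hR],
      ⟨?_, B.head, ?_, ?_, ?_⟩, hE⟩
    · intro e
      obtain ⟨l', hl', T3⟩ := P.trail fun i => e (i + 1)
      refine ⟨_, ?_, ((T1 (e 0)).trans T2).trans T3⟩
      have h4 : l ++ (l' ++ [z]) = x' :: (mid ++ w :: post) ++ (u ++ segPath R fun i => e (i + 1)) := by
        rw [← hl', hl]
        simp
      rw [List.append_assoc _ l, List.append_assoc _ (l ++ l'), List.append_assoc l, h4]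
      simp [segPath, Seg.stem]
    · intro g hg
      rcases List.mem_cons.1 hg with rfl | hg
      · refine ⟨hmid, B.parity, s, t, B.hole, ?_⟩
        intro v hv
        have hvB : ∃ e, v ∈ st ++ s :: (ar e ++ t :: be) := by
          simp only [List.cons_append, List.mem_cons, List.mem_append, List.mem_reverse] at hv
          rcases hv with rfl | hv | rfl | hv
          · exact ⟨true, by simp⟩
          · exact ⟨true, by simp [hv]⟩
          · exact ⟨true, by simp⟩
          · exact ⟨false, by simp [hv]⟩
        obtain ⟨e, hve⟩ := hvB
        refine ⟨or_iff_not_imp_left.2 (B.mem e v hve), ?_⟩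
        by_cases hvx : v = x'
        · subst hvx
          have hvl : v ∈ l := by
            rcases l with _ | ⟨a, l⟩
            · simp at hl
            · simp only [List.cons_append, List.cons.injEq] at hl
              simp [hl.1]
          exact ⟨fun hc => (T2.anti v hvl).1 (hEC₂ hc), fun c hc => (T2.anti v hvl).2 c (hEC₂ hc)⟩
        · have := B.anti e v hve hvx
          exact ⟨fun hc => this.1 (T2.subset (hEC₂ hc)),
            fun c hc => this.2 c (T2.subset (hEC₂ hc))⟩
      · obtain ⟨h1, h2, s', t', h3, h4⟩ := P.good g hg
        refine ⟨h1, h2, s', t', h3, fun v hv => ⟨?_, (h4 v hv).2⟩⟩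
        rcases (h4 v hv).1 with rfl | hv
        · right
          rcases eq_or_ne v x' with rfl | hne
          · exact hx'C
          · exact B.subset (T2.mem v (by simp) hne)
        · exact .inr (hC₂C hv)
    · intro v hv
      simp only [segMarks, List.flatMap_cons, List.cons_append, List.nil_append,
        List.mem_cons] at hv
      rcases hv with rfl | rfl | hv
      · exact hx'C
      · exact B.subset hw
      · exact hC₂C (P.marks_mem v hv)
    · simp only [segMarks, List.flatMap_cons, List.cons_append, List.nil_append,
        List.pairwise_cons, List.mem_cons]
      refine ⟨?_, fun v hv => (hfar2 v (P.marks_mem v hv)).2, P.marks_far⟩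
      rintro v (rfl | hv)
      · exact hfar
      · exact (hfar2 v (P.marks_mem v hv)).1

/-! ### Odd wheels from five marks on a rim with free arcs -/

/-- Used with five letters and the two classes of a link. -/
theorem exists_three_same (c : Fin 5 → Bool) : ∃ i j k, i < j ∧ j < k ∧ c i = c j ∧ c j = c k := by
  revert c
  decide

/-- The vector holds the parities of the positions of five marks, counted from the first. The second
and third are at odd distance, as are the fourth and fifth; `f` and `g` are set by the choice of
arcs. -/
theorem exists_alternating (i j k : Fin 5) (hij : i < j) (hjk : j < k) :
    ∃ f g : Bool, (![false, f, !f, g, !g] : Fin 5 → Bool) i ≠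
      (![false, f, !f, g, !g] : Fin 5 → Bool) j ∧
      (![false, f, !f, g, !g] : Fin 5 → Bool) j ≠ (![false, f, !f, g, !g] : Fin 5 → Bool) k := by
  revert i j k
  decide

theorem exists_length_parity {X : Bool → List V}
    (hX : (X true).length % 2 ≠ (X false).length % 2) (n : ℕ) (f : Bool) :
    ∃ a, decide ((n + (X a).length) % 2 = 1) = f := by
  by_cases h : decide ((n + (X true).length) % 2 = 1) = f
  · exact ⟨true, h⟩
  · refine ⟨false, ?_⟩
    cases f <;> simp at h ⊢ <;> omega

/-- A rim in a level `m + 1` with five marks whose letters are pairwise far, where three of the five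
arcs can be chosen of either parity and the other two are odd. -/
theorem Levelling.hasOddWheel_of_marks [Finite V] (hG : 11 ≤ G.oddGirth) {S : Set V} {r : V}
    {lev : V → ℕ} {par : V → V} (h : Levelling G S r lev par) {m : ℕ} (hm : 0 < m)
    {X Y Z : Bool → List V} (hX : (X true).length % 2 ≠ (X false).length % 2)
    (hY : (Y true).length % 2 ≠ (Y false).length % 2)
    (hZ : (Z true).length % 2 ≠ (Z false).length % 2) {M₁ M₂ : List V} (hM₁ : Even M₁.length)
    (hM₂ : Even M₂.length) {w₀ w₁ w₂ w₃ w₄ : V}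
    (hfar : [w₀, w₁, w₂, w₃, w₄].Pairwise fun a b => Far G (par a) (par b))
    (hcyc : ∀ a b c, IndCyc G
      (w₀ :: (X a ++ w₁ :: (M₁ ++ w₂ :: (Y b ++ w₃ :: (M₂ ++ w₄ :: Z c))))))
    (hlev : ∀ a b c, ∀ v ∈ w₀ :: (X a ++ w₁ :: (M₁ ++ w₂ :: (Y b ++ w₃ :: (M₂ ++ w₄ :: Z c)))),
      v ∈ S ∧ lev v = m + 1) : HasOddWheel G := by
  set w : Fin 5 → V := ![w₀, w₁, w₂, w₃, w₄] with hw
  have hwS : ∀ i, w i ∈ S ∧ lev (w i) = m + 1 := by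
    intro i
    apply hlev true true true
    fin_cases i <;> simp [hw]
  have hwfar : ∀ i j, i ≠ j → Far G (par (w i)) (par (w j)) := by
    have key : ∀ i j, i < j → Far G (par (w i)) (par (w j)) := by
      intro i j hij
      have := List.pairwise_iff_getElem.1 hfar i j (by simp) (by simp) hij
      fin_cases i <;> fin_cases j <;> exact this
    intro i j hij
    rcases lt_or_gt_of_ne hij with h1 | h1
    · exact key i j h1
    · exact (key j i h1).symm
  have hmem : ∀ v ∈ [w₀, w₁, w₂, w₃, w₄], ∃ i, w i = v := by
    intro v hv
    simp only [List.mem_cons, List.not_mem_nil, or_false] at hv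
    rcases hv with rfl | rfl | rfl | rfl | rfl
    exacts [⟨0, rfl⟩, ⟨1, rfl⟩, ⟨2, rfl⟩, ⟨3, rfl⟩, ⟨4, rfl⟩]
  obtain ⟨A, B, hAB, hA, hB, hc, hlow, hps⟩ := h.exists_link hG hm
    (ps := [w₀, w₁, w₂, w₃, w₄].map par) (by simp) (by
      intro p hp
      obtain ⟨v, hv, rfl⟩ := List.mem_map.1 hp
      obtain ⟨i, rfl⟩ := hmem v hv
      exact (h.letter (hwS i)).1) (by
      intro p hp p' hp' hne
      obtain ⟨v, hv, rfl⟩ := List.mem_map.1 hp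
      obtain ⟨v', hv', rfl⟩ := List.mem_map.1 hp'
      obtain ⟨i, rfl⟩ := hmem v hv
      obtain ⟨j, rfl⟩ := hmem v' hv'
      exact hwfar i j (by rintro rfl; exact hne rfl))
  have hps' : ∀ i, par (par (w i)) ∈ A ∪ B ∧ G.Adj (par (w i)) (par (par (w i))) ∧
      ∀ u ∈ A ∪ B, G.Adj (par (w i)) u → u = par (par (w i)) := by
    intro i
    apply hps
    fin_cases i <;> simp [hw]
  -- three of the letters see the same class of the link
  obtain ⟨A, B, hAB, hA, hB, hc, hlow, hps', i, j, k, hij, hjk, hi, hj, hk⟩ :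
      ∃ A B : Set V, (∀ v ∈ A, v ∉ B) ∧ StableOn G A ∧ StableOn G B ∧ ConnOn G (A ∪ B) ∧
        (∀ v ∈ A ∪ B, v ∈ S ∧ lev v < m) ∧ (∀ i, par (par (w i)) ∈ A ∪ B ∧
          G.Adj (par (w i)) (par (par (w i))) ∧
          ∀ u ∈ A ∪ B, G.Adj (par (w i)) u → u = par (par (w i))) ∧
        ∃ i j k : Fin 5, i < j ∧ j < k ∧ par (par (w i)) ∈ A ∧ par (par (w j)) ∈ A ∧
          par (par (w k)) ∈ A := by
    classical
    obtain ⟨i, j, k, hij, hjk, h1, h2⟩ := exists_three_same fun i => decide (par (par (w i)) ∈ A)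
    simp only [decide_eq_decide] at h1 h2
    by_cases hi : par (par (w i)) ∈ A
    · exact ⟨A, B, hAB, hA, hB, hc, hlow, hps', i, j, k, hij, hjk, hi, h1.1 hi, h2.1 (h1.1 hi)⟩
    · refine ⟨B, A, fun v hv hv' => hAB v hv' hv, hB, hA, Set.union_comm A B ▸ hc,
        Set.union_comm A B ▸ hlow, Set.union_comm A B ▸ hps', i, j, k, hij, hjk, ?_, ?_, ?_⟩
      · exact (hps' i).1.resolve_left hi
      · exact (hps' j).1.resolve_left fun h => hi (h1.2 h)
      · exact (hps' k).1.resolve_left fun h => hi (h1.2 (h2.2 h))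
  -- The arcs `X` and `Y` realise `f` and `g`; the remaining choice of `Z` makes the whole rim odd.
  obtain ⟨f, g, hf, hg⟩ := exists_alternating i j k hij hjk
  obtain ⟨a, ha⟩ := exists_length_parity hX 1 f
  obtain ⟨b, hb⟩ := exists_length_parity hY (1 + (X a).length + 1 + M₁.length + 1) g
  obtain ⟨c, hc'⟩ := exists_length_parity hZ
    (1 + (X a).length + 1 + M₁.length + 1 + (Y b).length + 1 + M₂.length + 1) true
  set L := w₀ :: (X a ++ w₁ :: (M₁ ++ w₂ :: (Y b ++ w₃ :: (M₂ ++ w₄ :: Z c)))) with hL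
  have hLlen : L.length =
      1 + (X a).length + 1 + M₁.length + 1 + (Y b).length + 1 + M₂.length + 1 + (Z c).length := by
    simp [hL]
    omega
  set pos : Fin 5 → ℕ := ![0, 1 + (X a).length, 1 + (X a).length + 1 + M₁.length,
    1 + (X a).length + 1 + M₁.length + 1 + (Y b).length,
    1 + (X a).length + 1 + M₁.length + 1 + (Y b).length + 1 + M₂.length] with hpos
  have hmono : StrictMono pos := by
    refine Fin.strictMono_iff_lt_succ.2 fun i => ?_
    fin_cases i <;> simp [hpos] <;> omega
  have hget : ∀ i, L[pos i]? = some (w i) := by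
    have key : ∀ (l₁ l₂ : List V) (v : V) (n : ℕ), n = l₁.length → L = l₁ ++ v :: l₂ →
        L[n]? = some v := by
      rintro l₁ l₂ v n rfl h
      rw [h]
      simp
    intro i
    fin_cases i
    · rfl
    · exact key (w₀ :: X a) _ w₁ _ (by simp [hpos]; omega) rfl
    · exact key (w₀ :: (X a ++ w₁ :: M₁)) (Y b ++ w₃ :: (M₂ ++ w₄ :: Z c)) w₂ _
        (by simp [hpos]; omega) (by simp [hL])
    · exact key (w₀ :: (X a ++ w₁ :: (M₁ ++ w₂ :: Y b))) (M₂ ++ w₄ :: Z c) w₃ _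
        (by simp [hpos]; omega) (by simp [hL])
    · exact key (w₀ :: (X a ++ w₁ :: (M₁ ++ w₂ :: (Y b ++ w₃ :: M₂)))) (Z c) w₄ _
        (by simp [hpos]; omega) (by simp [hL])
  have hpar : ∀ i, decide (pos i % 2 = 1) = (![false, f, !f, g, !g] : Fin 5 → Bool) i := by
    rw [Nat.even_iff] at hM₁ hM₂
    intro i
    fin_cases i
    · rfl
    · exact ha
    · change _ = !f
      rw [← ha, ← decide_not, decide_eq_decide]
      simp only [hpos]
      simp
      omega
    · exact hb
    · change _ = !g
      rw [← hb, ← decide_not, decide_eq_decide]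
      simp only [hpos]
      simp
      omega
  have hodd : ∀ i j, i < j → (![false, f, !f, g, !g] : Fin 5 → Bool) i ≠
      (![false, f, !f, g, !g] : Fin 5 → Bool) j → Odd (pos j - pos i) := by
    intro i j hij h1
    rw [← hpar, ← hpar] at h1
    have := hmono hij
    rw [Nat.odd_iff]
    simp only [ne_eq, decide_eq_decide] at h1
    omega
  have hcontact : ∀ (B' : Set V) (i : Fin 5), par (w i) ∈ B' → ∀ hh : pos i < L.length,
      ∃ x ∈ B', G.Adj L[pos i] x := by
    intro B' i hi hh
    have := hget i
    rw [List.getElem?_eq_getElem hh, Option.some_inj] at this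
    exact ⟨_, hi, this ▸ (h.letter (hwS i)).2⟩
  have hLodd : Odd L.length := by
    rw [Nat.odd_iff, hLlen]
    simpa using hc'
  have hlen : ∀ i, pos i < L.length := by
    intro i
    exact (List.getElem?_eq_some_iff.1 (hget i)).1
  -- The parents of the three letters lie in `A`, so the letters can join `B`. The link itself lies
  -- too high to see the rim; all contacts are at the letters.
  refine hasOddWheel_of_hub (hcyc a b c) hLodd (A := A)
    (B := B ∪ {v | v = par (w i) ∨ v = par (w j) ∨ v = par (w k)})
    ?_ ?_ hA ?_ ?_ (hodd i j hij hf) le_rfl (hodd j k hjk hg) (hlen k)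
    (hcontact _ i (.inr (.inl rfl)) _) (hcontact _ j (.inr (.inr (.inl rfl))) _)
    (hcontact _ j (.inr (.inr (.inl rfl))) _) (hcontact _ k (.inr (.inr (.inr rfl))) _)
  · have key : ∀ t, par (w t) ∉ A := fun t ht => by
      have := (hlow _ (.inl ht)).2
      have := (h.letter (hwS t)).1.2
      omega
    rintro v hv (hv' | rfl | rfl | rfl)
    · exact hAB v hv hv'
    · exact key _ hv
    · exact key _ hv
    · exact key _ hv
  · have key : ∀ t, par (par (w t)) ∈ A → ∀ T : Set V, A ∪ B ⊆ T → ConnOn G T →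
        ConnOn G (T ∪ {par (w t)}) := fun t ht T hT hTc =>
      hTc.union (ConnOn.singleton _) ⟨_, hT (.inl ht), _, rfl, .inr (hps' t).2.1.symm⟩
    have h3 := key k hk _ (Set.subset_union_left.trans Set.subset_union_left)
      (key j hj _ Set.subset_union_left (key i hi _ subset_rfl hc))
    convert h3 using 1
    ext v
    simp only [Set.mem_union, Set.mem_ofPred_eq, Set.mem_singleton_iff]
    tauto
  · have key : ∀ t, par (par (w t)) ∈ A → ∀ v ∈ B, ¬ G.Adj (par (w t)) v := fun t ht v hv hadj =>
      hAB _ ht ((hps' t).2.2 v (.inr hv) hadj ▸ hv)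
    have key' : ∀ s t, ¬ G.Adj (par (w s)) (par (w t)) := by
      intro s t
      rcases eq_or_ne s t with rfl | hst
      · exact G.irrefl
      · exact (hwfar s t hst).2.1
    rintro u (hu | hu) v (hv | hv)
    · exact hB u hu v hv
    · rcases hv with rfl | rfl | rfl
      · exact fun e => key _ hi u hu e.symm
      · exact fun e => key _ hj u hu e.symm
      · exact fun e => key _ hk u hu e.symm
    · rcases hu with rfl | rfl | rfl
      · exact key _ hi v hv
      · exact key _ hj v hv
      · exact key _ hk v hv
    · rcases hu with rfl | rfl | rfl <;> rcases hv with rfl | rfl | rfl <;> apply key'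
  · intro v hv
    obtain ⟨hvS, hvl⟩ := hlev a b c v hv
    have hlow' : ∀ x ∈ A ∪ B, v ≠ x ∧ ¬ G.Adj v x := by
      intro x hx
      obtain ⟨h1, h2⟩ := hlow x hx
      refine ⟨by rintro rfl; omega, fun hadj => ?_⟩
      have := h.lev_le x h1 v hvS hadj.symm
      omega
    refine ⟨fun h' => (hlow' v (.inl h')).1 rfl, ?_, fun x hx => (hlow' x (.inl hx)).2⟩
    rintro (hv' | hv')
    · exact (hlow' v (.inr hv')).1 rfl
    · rcases hv' with rfl | rfl | rfl
      · have := (h.letter (hwS i)).1.2; omega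
      · have := (h.letter (hwS j)).1.2; omega
      · have := (h.letter (hwS k)).1.2; omega

/-! ### Closing the rim -/

theorem exists_split_first {Q : V → Prop} : ∀ {l : List V}, (∃ v ∈ l, Q v) →
    ∃ l₁ t l₂, l = l₁ ++ t :: l₂ ∧ Q t ∧ ∀ v ∈ l₁, ¬ Q v
  | [], h => by simp at h
  | a :: l, h => by
    by_cases ha : Q a
    · exact ⟨[], a, l, rfl, ha, by simp⟩
    · obtain ⟨v, hv, hQ⟩ := h
      obtain ⟨l₁, t, l₂, rfl, h1, h2⟩ := exists_split_first (l := l)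
        ⟨v, (List.mem_cons.1 hv).resolve_left fun e => ha (e ▸ hQ), hQ⟩
      exact ⟨a :: l₁, t, l₂, rfl, h1, by simpa [ha] using h2⟩

theorem exists_split_last {Q : V → Prop} {l : List V} (h : ∃ v ∈ l, Q v) :
    ∃ l₁ t l₂, l = l₁ ++ t :: l₂ ∧ Q t ∧ ∀ v ∈ l₂, ¬ Q v := by
  obtain ⟨l₁, t, l₂, h1, h2, h3⟩ := exists_split_first (l := l.reverse) (by simpa using h)
  refine ⟨l₂.reverse, t, l₁.reverse, ?_, h2, by simpa using h3⟩
  rw [← List.reverse_reverse l, h1]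
  simp

/-- Trails with a common end can be cut off, or continued through `E`, so that they end in the first
neighbour of `p` after their variable part. -/
theorem exists_close {ι : Type*} [Nonempty ι] {x p y : V} {C E : Set V} {A : ι → List V}
    {B : List V} (hB : B ≠ []) (ht : ∀ i, ∃ l, A i ++ B = l ++ [y] ∧ Trail G x C l y E)
    (hp : ∃ z ∈ E, G.Adj p z) :
    ∃ T t, (∀ i, IndPath G (A i ++ (T ++ [t]))) ∧ G.Adj p t ∧ (∀ v ∈ T, ¬ G.Adj p v) ∧
      (∀ v ∈ T ++ [t], v ∈ B ∨ v ∈ E) ∧ ((∀ v ∈ B, ¬ G.Adj p v) → B <+: T) := by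
  obtain ⟨B, y', rfl⟩ : ∃ B' y', B = B' ++ [y'] :=
    ⟨B.dropLast, B.getLast hB, (List.dropLast_append_getLast hB).symm⟩
  have ht' : ∀ i, y' = y ∧ Trail G x C (A i ++ B) y E := by
    intro i
    obtain ⟨l, h1, h2⟩ := ht i
    rw [← List.append_assoc] at h1
    obtain ⟨rfl, h3⟩ := List.append_inj' h1 rfl
    exact ⟨by simpa using h3, h2⟩
  obtain ⟨i₀⟩ := ‹Nonempty ι›
  obtain rfl := (ht' i₀).1
  have hatt := (ht' i₀).2.att
  obtain ⟨z, hz, hpz⟩ := hp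
  obtain ⟨l, z', h1, h2, h3, -, h5⟩ := hatt.connOn_insert.exists_indPath (Q := fun v => G.Adj p v)
    (.inl rfl) ⟨z, .inr hz, hpz⟩
  obtain ⟨W, hW⟩ : ∃ W, l ++ [z'] = y' :: W := by
    rcases hl : l ++ [z'] with _ | ⟨a, u⟩
    · simp at hl
    · rw [hl] at h2
      exact ⟨u, by simpa using h2⟩
  have hz'W : z' ∈ y' :: W := hW ▸ by simp
  rw [hW] at h1 h5
  have hWE : ∀ v ∈ W, v ∈ E := fun v hv =>
    (h5 v (List.mem_cons_of_mem _ hv)).resolve_left fun e => (h1.1 v hv).1 (by simpa using e.symm)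
  obtain ⟨T, t, T₂, hT, hpt, hTm⟩ := exists_split_first (l := B ++ y' :: W) (Q := fun v => G.Adj p v)
    ⟨z', List.mem_append_right _ hz'W, h3⟩
  refine ⟨T, t, fun i => ?_, hpt, hTm, fun v hv => ?_, fun hBm => ?_⟩
  · have := indPath_glue (ht' i).2.path h1 fun a ha b hb =>
      ⟨fun e => ((ht' i).2.anti a ha).1 (e ▸ hWE b hb), ((ht' i).2.anti a ha).2 b (hWE b hb)⟩
    rw [List.append_assoc, hT, show A i ++ (T ++ t :: T₂) = (A i ++ (T ++ [t])) ++ T₂ by simp] at this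
    exact this.of_append_left
  · have : v ∈ B ++ y' :: W := by
      rw [hT]
      simp only [List.mem_append, List.mem_cons, List.not_mem_nil, or_false] at hv ⊢
      tauto
    rcases List.mem_append.1 this with hv | hv
    · exact .inl (List.mem_append_left _ hv)
    · rcases List.mem_cons.1 hv with rfl | hv
      · exact .inl (by simp)
      · exact .inr (hWE v hv)
  · rw [show B ++ y' :: W = (B ++ [y']) ++ W by simp, List.append_eq_append_iff] at hT
    rcases hT with ⟨a, h6, -⟩ | ⟨c, h6, h7⟩
    · exact ⟨a, h6.symm⟩
    · rcases c with _ | ⟨c, cs⟩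
      · rw [List.append_nil] at h6
        exact h6 ▸ List.prefix_rfl
      · simp only [List.cons_append, List.cons.injEq] at h7
        refine absurd hpt (hBm t ?_)
        rw [h6, h7.1]
        simp

section Outer

variable {S : Set V} {r : V} {lev : V → ℕ} {par : V → V} {m : ℕ}

/-- The choice of arcs which starts with three given ones. -/
def chooseArcs (i : Bool × Bool × Bool) : ℕ → Bool
  | 0 => i.1
  | 1 => i.2.1
  | 2 => i.2.2
  | _ => true

/-- The rim is closed by a vertex `p` with neighbours in `s₀` and in `E` but on no later stem or
arc. -/
theorem Levelling.hasOddWheel_of_hit [Finite V] (hG : 11 ≤ G.oddGirth)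
    (h : Levelling G S r lev par) (hm : 0 < m) {x y p : V} {C E D : Set V} {U s₀ : List V}
    {g₁ g₂ g₃ : Seg V} {R : List (Seg V)}
    (ht : ∀ e, ∃ l, U ++ (s₀ ++ segPath (g₁ :: g₂ :: g₃ :: R) e) = l ++ [y] ∧ Trail G x C l y E)
    (hs₀ : ∃ v ∈ s₀, G.Adj p v) (hE : ∃ z ∈ E, G.Adj p z)
    (hmiss : ∀ e, ∀ v ∈ segPath (g₁ :: g₂ :: g₃ :: R) e, ¬ G.Adj p v)
    (hC : ∀ e, ∀ v ∈ s₀ ++ segPath (g₁ :: g₂ :: g₃ :: R) e, v ∈ C) (hpC : p ∉ C)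
    (hCS : ∀ v ∈ C, v ∈ S ∧ lev v = m + 1) (hpS : p ∈ S ∧ lev p = m + 1)
    (hg : ∀ g ∈ [g₁, g₂, g₃], g.IsGood G D)
    (hfar : (segMarks [g₁, g₂, g₃]).Pairwise fun a b => Far G (par a) (par b)) :
    HasOddWheel G := by
  obtain ⟨T, t, hT1, hT2, hT3, hT4, hT5⟩ := exists_close
    (A := fun i : Bool × Bool × Bool => U ++ (s₀ ++ (g₁.arc i.1 ++ (g₁.stem ++ (g₂.arc i.2.1 ++
      (g₂.stem ++ g₃.arc i.2.2)))))) (B := g₃.stem ++ segPath R fun _ => true)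
    (by simp [Seg.stem]) (x := x) (y := y) (C := C) (E := E) (fun i => by
      obtain ⟨l, hl, hl'⟩ := ht (chooseArcs i)
      refine ⟨l, ?_, hl'⟩
      rw [← hl]
      simp [segPath, chooseArcs]) hE
  have hBm : ∀ v ∈ g₃.stem ++ segPath R fun _ => true, ¬ G.Adj p v := by
    intro v hv
    refine hmiss (fun _ => true) v ?_
    simp only [segPath, List.mem_append] at hv ⊢
    tauto
  obtain ⟨T', hT'⟩ := hT5 hBm
  obtain ⟨T₁, rfl⟩ : ∃ T₁, T = g₃.pre ++ g₃.mk₁ :: T₁ := by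
    rw [← hT']
    exact ⟨g₃.mid ++ g₃.mk₂ :: g₃.post ++ (segPath R fun _ => true) ++ T', by simp [Seg.stem]⟩
  -- The rim leaves `p` at its last neighbour on `s₀` and returns at `t`; in between nothing sees
  -- `p`.
  obtain ⟨s₁, w, s₂, rfl, hw, hs₂⟩ := exists_split_last hs₀
  have hmem : ∀ a b c, ∀ v ∈ g₁.arc a ++ (g₁.stem ++ (g₂.arc b ++ (g₂.stem ++ g₃.arc c))),
      v ∈ C ∧ ¬ G.Adj p v := by
    intro a b c v hv
    have hv' : v ∈ segPath (g₁ :: g₂ :: g₃ :: R) (chooseArcs (a, b, c)) := by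
      simp only [segPath, chooseArcs, List.mem_append] at hv ⊢
      tauto
    exact ⟨hC _ v (List.mem_append_right _ hv'), hmiss _ v hv'⟩
  have hEC : E ⊆ C := by
    obtain ⟨l, -, hl⟩ := ht fun _ => true
    exact hl.subset
  have hTC : ∀ v ∈ g₃.pre ++ g₃.mk₁ :: T₁ ++ [t], v ∈ C := by
    intro v hv
    rcases hT4 v hv with hv | hv
    · refine hC (fun _ => true) v ?_
      simp only [segPath, List.mem_append] at hv ⊢
      tauto
    · exact hEC hv
  have hs₀C : ∀ v ∈ s₁ ++ w :: s₂, v ∈ C := fun v hv =>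
    hC (fun _ => true) v (List.mem_append_left _ hv)
  have hallC : ∀ a b c, ∀ v ∈ w :: (s₂ ++ (g₁.arc a ++ (g₁.stem ++ (g₂.arc b ++
      (g₂.stem ++ g₃.arc c)))) ++ (g₃.pre ++ g₃.mk₁ :: T₁) ++ [t]), v ∈ C := by
    intro a b c v hv
    rcases List.mem_cons.1 hv with rfl | hv
    · exact hs₀C v (by simp)
    · rw [List.append_assoc, List.append_assoc] at hv
      rcases List.mem_append.1 hv with hv | hv
      · exact hs₀C v (by simp [hv])
      · rcases List.mem_append.1 hv with hv | hv
        · exact (hmem a b c v hv).1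
        · exact hTC v hv
  have hcyc : ∀ a b c, IndCyc G (p :: w :: (s₂ ++ (g₁.arc a ++ (g₁.stem ++ (g₂.arc b ++
      (g₂.stem ++ g₃.arc c)))) ++ (g₃.pre ++ g₃.mk₁ :: T₁) ++ [t])) := by
    intro a b c
    refine indCyc_cons ?_ (fun hp => hpC (hallC a b c p hp)) hw hT2 ?_
    · have := hT1 (a, b, c)
      refine IndPath.of_append_right (l₁ := U ++ s₁) ?_
      simpa using this
    · intro v hv
      rcases List.mem_append.1 hv with hv | hv
      · rcases List.mem_append.1 hv with hv | hv
        · exact hs₂ v hv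
        · exact (hmem a b c v hv).2
      · exact hT3 v hv
  -- The rim is read from `g₃.mk₁` on, so that the closing part through `p` falls into the first
  -- free arc and the marks of `g₁` and `g₂` follow.
  have hrot : ∀ a b c, g₃.mk₁ :: ((T₁ ++ t :: p :: w :: s₂ ++ g₁.arc a ++ g₁.pre) ++ g₁.mk₁ ::
      (g₁.mid ++ g₁.mk₂ :: ((g₁.post ++ g₂.arc b ++ g₂.pre) ++ g₂.mk₁ :: (g₂.mid ++ g₂.mk₂ ::
      (g₂.post ++ g₃.arc c ++ g₃.pre))))) = (g₃.mk₁ :: (T₁ ++ [t])) ++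
      (p :: w :: (s₂ ++ (g₁.arc a ++ (g₁.stem ++ (g₂.arc b ++
      (g₂.stem ++ g₃.arc c)))) ++ g₃.pre)) := by
    intro a b c
    simp [Seg.stem]
  have hunrot : ∀ a b c, p :: w :: (s₂ ++ (g₁.arc a ++ (g₁.stem ++ (g₂.arc b ++
      (g₂.stem ++ g₃.arc c)))) ++ (g₃.pre ++ g₃.mk₁ :: T₁) ++ [t]) =
      (p :: w :: (s₂ ++ (g₁.arc a ++ (g₁.stem ++ (g₂.arc b ++
      (g₂.stem ++ g₃.arc c)))) ++ g₃.pre)) ++ (g₃.mk₁ :: (T₁ ++ [t])) := by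
    intro a b c
    simp
  refine h.hasOddWheel_of_marks hG hm (X := fun a => T₁ ++ t :: p :: w :: s₂ ++ g₁.arc a ++ g₁.pre)
    (Y := fun b => g₁.post ++ g₂.arc b ++ g₂.pre) (Z := fun c => g₂.post ++ g₃.arc c ++ g₃.pre)
    (w₀ := g₃.mk₁) (w₁ := g₁.mk₁) (w₂ := g₁.mk₂) (w₃ := g₂.mk₁) (w₄ := g₂.mk₂)
    ?_ ?_ ?_ (hg g₁ (by simp)).even_mid (hg g₂ (by simp)).even_mid ?_ ?_ ?_
  · have := (hg g₁ (by simp)).parity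
    simp only [List.length_append]
    omega
  · have := (hg g₂ (by simp)).parity
    simp only [List.length_append]
    omega
  · have := (hg g₃ (by simp)).parity
    simp only [List.length_append]
    omega
  · have hh : ([g₁.mk₁, g₁.mk₂, g₂.mk₁, g₂.mk₂] ++ [g₃.mk₁]).Pairwise
        fun a b => Far G (par a) (par b) := hfar.sublist (by simp [segMarks])
    rw [List.pairwise_append] at hh
    exact List.pairwise_cons.2 ⟨fun b hb => (hh.2.2 b hb _ (by simp)).symm, hh.1⟩
  · intro a b c
    rw [hrot]
    refine IndCyc.rotate ?_
    rw [← hunrot]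
    exact hcyc a b c
  · intro a b c v hv
    rw [hrot, List.mem_append, or_comm, ← List.mem_append, ← hunrot] at hv
    rcases List.mem_cons.1 hv with rfl | hv
    · exact hpS
    · exact hCS v (hallC a b c v hv)

/-- The rim is closed by a vertex `p`, with a neighbour in `E` but none on the first stems and arcs,
and a path `K` from a neighbour of `p` to a neighbour of the start `x`. -/
theorem Levelling.hasOddWheel_of_miss [Finite V] (hG : 11 ≤ G.oddGirth)
    (h : Levelling G S r lev par) (hm : 0 < m) {x y p : V} {C E D : Set V} {s₀ K : List V}
    {g₁ g₂ g₃ : Seg V} {R : List (Seg V)}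
    (ht : ∀ e, ∃ l, x :: (s₀ ++ segPath (g₁ :: g₂ :: g₃ :: R) e) = l ++ [y] ∧ Trail G x C l y E)
    (hE : ∃ z ∈ E, G.Adj p z)
    (hmiss : ∀ a b c, ∀ v ∈ x :: (s₀ ++ (g₁.arc a ++ (g₁.stem ++ (g₂.arc b ++
      (g₂.stem ++ g₃.arc c))))), ¬ G.Adj p v)
    (hpC : p ∉ C) (hpx : p ≠ x)
    (hK : IndPath G K) (hKne : K ≠ []) (hKC : ∀ v ∈ K, v ≠ x ∧ v ≠ p ∧ ∀ c ∈ C, v ≠ c ∧ ¬ G.Adj c v)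
    (hKp : ∀ v ∈ K, G.Adj p v ↔ K.head? = some v) (hKx : ∀ v ∈ K, G.Adj x v ↔ K.getLast? = some v)
    (hCS : ∀ v ∈ C, v ∈ S ∧ lev v = m + 1) (hpS : p ∈ S ∧ lev p = m + 1)
    (hxS : x ∈ S ∧ lev x = m + 1) (hKS : ∀ v ∈ K, v ∈ S ∧ lev v = m + 1)
    (hg : ∀ g ∈ [g₁, g₂, g₃], g.IsGood G D)
    (hfar : (x :: segMarks [g₁, g₂, g₃]).Pairwise fun a b => Far G (par a) (par b)) :
    HasOddWheel G := by
  obtain ⟨T, t, hT1, hT2, hT3, hT4, -⟩ := exists_close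
    (A := fun i : Bool × Bool × Bool => x :: (s₀ ++ (g₁.arc i.1 ++ (g₁.stem ++ (g₂.arc i.2.1 ++
      (g₂.stem ++ g₃.arc i.2.2)))))) (B := g₃.stem ++ segPath R fun _ => true)
    (by simp [Seg.stem]) (x := x) (y := y) (C := C) (E := E) (fun i => by
      obtain ⟨l, hl, hl'⟩ := ht (chooseArcs i)
      refine ⟨l, ?_, hl'⟩
      rw [← hl]
      simp [segPath, chooseArcs]) hE
  set A : Bool → Bool → Bool → List V := fun a b c => s₀ ++ (g₁.arc a ++ (g₁.stem ++ (g₂.arc b ++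
      (g₂.stem ++ g₃.arc c)))) with hA
  have hpath : ∀ a b c, IndPath G (x :: (A a b c ++ T ++ [t])) := by
    intro a b c
    have := hT1 (a, b, c)
    simpa [hA] using this
  have hallC : ∀ a b c, ∀ v ∈ A a b c ++ T ++ [t], v ∈ C := by
    intro a b c v hv
    have hvx : v ≠ x := fun e => ((hpath a b c).1 v hv).1 e.symm
    have hmemC : ∀ e, ∀ v ∈ x :: (s₀ ++ segPath (g₁ :: g₂ :: g₃ :: R) e), v ≠ x → v ∈ C := by
      intro e v hv hvx
      obtain ⟨l, hl, hl'⟩ := ht e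
      exact hl'.mem v (hl ▸ hv) hvx
    rw [List.append_assoc] at hv
    rcases List.mem_append.1 hv with hv | hv
    · refine hmemC (chooseArcs (a, b, c)) v ?_ hvx
      simp only [hA, segPath, chooseArcs, List.mem_append, List.mem_cons] at hv ⊢
      tauto
    · rcases hT4 v hv with hv | hv
      · refine hmemC (fun _ => true) v ?_ hvx
        simp only [segPath, List.mem_append, List.mem_cons] at hv ⊢
        tauto
      · obtain ⟨l, -, hl⟩ := ht fun _ => true
        exact hl.subset hv
  have hpath' : ∀ a b c, IndPath G ((x :: (A a b c ++ T ++ [t])) ++ [p]) := by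
    intro a b c
    refine indPath_append.2 ⟨hpath a b c, indPath_singleton p, ?_⟩
    intro u hu v hv
    obtain rfl := List.mem_singleton.1 hv
    refine ⟨?_, ?_⟩
    · rintro rfl
      rcases List.mem_cons.1 hu with rfl | hu
      · exact hpx rfl
      · exact hpC (hallC a b c _ hu)
    · have hlast : (x :: (A a b c ++ T ++ [t])).getLast? = some t := by
        rw [← List.cons_append]
        exact List.getLast?_concat
      simp only [hlast, List.head?_cons, and_true, Option.some_inj]
      constructor
      · intro hadj
        rw [← List.cons_append] at hu
        rcases List.mem_append.1 hu with hu | hu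
        · rw [← List.cons_append] at hu
          rcases List.mem_append.1 hu with hu | hu
          · exact absurd hadj.symm (hmiss a b c u hu)
          · exact absurd hadj.symm (hT3 u hu)
        · exact (List.mem_singleton.1 hu).symm
      · rintro rfl
        exact hT2.symm
  have hcyc : ∀ a b c, IndCyc G (((x :: (A a b c ++ T ++ [t])) ++ [p]) ++ K) := by
    intro a b c
    refine (indCyc_append (by simp) hKne).2 ⟨?_, hpath' a b c, hK, ?_⟩
    · simp
      omega
    · intro u hu v hv
      have h1 : ((x :: (A a b c ++ T ++ [t])) ++ [p]).getLast? = some p :=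
        List.getLast?_concat
      have h2 : ((x :: (A a b c ++ T ++ [t])) ++ [p]).head? = some x := rfl
      rw [h1, h2]
      simp only [Option.some_inj]
      obtain ⟨k1, k2, k3⟩ := hKC v hv
      rcases List.mem_append.1 hu with hu | hu
      · rcases List.mem_cons.1 hu with rfl | hu
        · refine ⟨k1.symm, ?_⟩
          rw [hKx v hv]
          constructor
          · exact fun h => .inr ⟨rfl, h⟩
          · rintro (⟨rfl, -⟩ | ⟨-, h⟩)
            · exact absurd rfl hpx
            · exact h
        · have huC := hallC a b c u hu
          refine ⟨(k3 u huC).1.symm, iff_of_false (k3 u huC).2 ?_⟩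
          rintro (⟨rfl, -⟩ | ⟨rfl, -⟩)
          · exact hpC huC
          · exact ((hpath a b c).1 _ hu).1 rfl
      · obtain rfl := List.mem_singleton.1 hu
        refine ⟨k2.symm, ?_⟩
        rw [hKp v hv]
        constructor
        · exact fun h => .inl ⟨rfl, h⟩
        · rintro (⟨-, h⟩ | ⟨rfl, -⟩)
          · exact h
          · exact absurd rfl hpx
  have heq : ∀ a b c, x :: ((s₀ ++ g₁.arc a ++ g₁.pre) ++ g₁.mk₁ ::
      (g₁.mid ++ g₁.mk₂ :: ((g₁.post ++ g₂.arc b ++ g₂.pre) ++ g₂.mk₁ :: (g₂.mid ++ g₂.mk₂ ::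
      (g₂.post ++ g₃.arc c ++ T ++ t :: p :: K))))) =
      ((x :: (A a b c ++ T ++ [t])) ++ [p]) ++ K := by
    intro a b c
    simp [hA, Seg.stem]
  -- Here `x` is the fifth mark. The closing part through `p` and `K` belongs to the third free arc
  -- and does not affect the freedom of parity.
  refine h.hasOddWheel_of_marks hG hm (X := fun a => s₀ ++ g₁.arc a ++ g₁.pre)
    (Y := fun b => g₁.post ++ g₂.arc b ++ g₂.pre)
    (Z := fun c => g₂.post ++ g₃.arc c ++ T ++ t :: p :: K)
    (w₀ := x) (w₁ := g₁.mk₁) (w₂ := g₁.mk₂) (w₃ := g₂.mk₁) (w₄ := g₂.mk₂)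
    ?_ ?_ ?_ (hg g₁ (by simp)).even_mid (hg g₂ (by simp)).even_mid ?_ ?_ ?_
  · have := (hg g₁ (by simp)).parity
    simp only [List.length_append]
    omega
  · have := (hg g₂ (by simp)).parity
    simp only [List.length_append]
    omega
  · have := (hg g₃ (by simp)).parity
    simp only [List.length_append]
    omega
  · exact hfar.sublist (by simp [segMarks])
  · intro a b c
    rw [heq]
    exact hcyc a b c
  · intro a b c v hv
    rw [heq] at hv
    rcases List.mem_append.1 hv with hv | hv
    · rcases List.mem_append.1 hv with hv | hv
      · rcases List.mem_cons.1 hv with rfl | hv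
        · exact hxS
        · exact hCS v (hallC a b c v hv)
      · obtain rfl := List.mem_singleton.1 hv
        exact hpS
    · exact hKS v hv

end Outer

/-! ### The bound -/

theorem mem_segPath {v : V} : ∀ {R : List (Seg V)} {e : ℕ → Bool}, v ∈ segPath R e →
    (∃ g ∈ R, ∃ b, v ∈ g.arc b) ∨ ∃ g ∈ R, v ∈ g.stem
  | [], _, h => by simp [segPath] at h
  | g :: R, e, h => by
    simp only [segPath, List.mem_append] at h
    rcases h with h | h | h
    · exact .inl ⟨g, by simp, _, h⟩
    · exact .inr ⟨g, by simp, h⟩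
    · rcases mem_segPath h with ⟨g', h1, h2⟩ | ⟨g', h1, h2⟩
      · exact .inl ⟨g', List.mem_cons_of_mem _ h1, h2⟩
      · exact .inr ⟨g', List.mem_cons_of_mem _ h1, h2⟩

theorem mem_segPath_of_stem {v : V} {g : Seg V} (hv : v ∈ g.stem) : ∀ {R : List (Seg V)}
    (e : ℕ → Bool), g ∈ R → v ∈ segPath R e
  | g' :: R, e, h => by
    simp only [segPath, List.mem_append]
    rcases List.mem_cons.1 h with rfl | h
    · exact .inr (.inl hv)
    · exact .inr (.inr (mem_segPath_of_stem hv _ h))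

theorem Seg.IsGood.mono {g : Seg V} {D D' : Set V} (h : g.IsGood G D) (hD : D ⊆ D') :
    g.IsGood G D' := by
  obtain ⟨h1, h2, s, t, h3, h4⟩ := h
  exact ⟨h1, h2, s, t, h3, fun v hv => hD (h4 v hv)⟩

section Inner

variable {H : Set V} {r : V} {lev : V → ℕ} {par : V → V} {k : ℕ}

theorem Levelling.colOn_holes [Finite V] (hG : 11 ≤ G.oddGirth) (hno : ¬ HasOddWheel G)
    (h : Levelling G H r lev par) (hk : 0 < k) {E D : Set V} (hE : ∀ z ∈ E, z ∈ H ∧ lev z = k + 1)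
    (hD : ∀ v ∈ D, (v ∈ H ∧ lev v = k + 1) ∧ v ∉ E ∧ ∀ c ∈ E, ¬ G.Adj v c) :
    ∀ {R : List (Seg V)}, (∀ g ∈ R, g.IsGood G D) →
      ColOn G {z | z ∈ E ∧ ∃ g ∈ R, ∃ b, ∃ v ∈ g.arc b, G.Adj (par z) v} (29 * R.length)
  | [], _ => (colOn_empty 0).mono (by rintro z ⟨-, g, hg, -⟩; simp at hg) le_rfl
  | g :: R, hR => by
    have ih := h.colOn_holes hG hno hk hE hD (R := R) fun g hg => hR g (List.mem_cons_of_mem _ hg)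
    obtain ⟨-, hpar, s, t, hO, hOD⟩ := hR g (by simp)
    have hh := h.colOn_hole hG hno hk hO (by
      rw [Nat.odd_iff]
      simp only [List.length_append, List.length_cons, List.length_reverse]
      omega) (fun v hv => (hD v (hOD v hv)).1) hE
      (fun z hz => ⟨fun hzO => (hD z (hOD z hzO)).2.1 hz,
        fun v hv hadj => (hD v (hOD v hv)).2.2 z hz hadj.symm⟩)
    refine ih.of_cover hh ?_ (by simp only [List.length_cons]; omega)
    rintro z ⟨hz, g', hg', b, v, hv, hadj⟩
    rcases List.mem_cons.1 hg' with rfl | hg'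
    · refine .inr ⟨hz, v, ?_, hadj⟩
      cases b <;> simp [hv]
    · exact .inl ⟨hz, g', hg', b, v, hv, hadj⟩

/-- `colOn_dense` applied with the left side reversed, as first hits are counted outwards from the
hole. The start `x` is left out because a trail does not place it in `C`. -/
theorem Levelling.colOn_both_sides [Finite V] (hG : 11 ≤ G.oddGirth) (hno : ¬ HasOddWheel G)
    (h : Levelling G H r lev par) (hk : 0 < k) {C E : Set V} (hC : ∀ z ∈ C, z ∈ H ∧ lev z = k + 1)
    {x y : V} {Lf Rt : List V} {ar : Bool → List V}
    (har : (ar true).length % 2 ≠ (ar false).length % 2) (hRt : Rt ≠ [])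
    (ht : ∀ b, ∃ l, x :: (Lf ++ ar b ++ Rt) = l ++ [y] ∧ Trail G x C l y E) :
    ColOn G {z | z ∈ E ∧ (∃ v ∈ Lf, G.Adj (par z) v) ∧ (∃ v ∈ Rt, G.Adj (par z) v) ∧
      ∀ b, ∀ v ∈ ar b, ¬ G.Adj (par z) v} 48 := by
  have hEC : E ⊆ C := by
    obtain ⟨l, -, hl⟩ := ht true
    exact hl.subset
  have := h.colOn_dense hG hno hk (Lf := Lf.reverse) (Rt := Rt) (Md := ar) (F := E)
    (fun b => by
      obtain ⟨l, hl, hl'⟩ := ht b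
      have := hl ▸ hl'.path
      rw [List.reverse_reverse]
      exact this.2) har
    (fun v b hv => by
      obtain ⟨l, hl, hl'⟩ := ht b
      have hp := hl ▸ hl'.path
      have hv' : v ∈ Lf ++ ar b ++ Rt := by
        simpa [or_assoc] using hv
      exact hC v (hl'.mem v (hl ▸ List.mem_cons_of_mem _ hv') fun e => (hp.1 v hv').1 e.symm))
    (fun z hz => hC z (hEC hz))
    (fun z hz => by
      obtain ⟨l, hl, hl'⟩ := ht true
      have hLl : ∀ v ∈ Lf, v ∈ l := by
        intro v hv
        obtain ⟨Rt', w, rfl⟩ : ∃ R' w, Rt = R' ++ [w] :=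
          ⟨Rt.dropLast, Rt.getLast hRt, (List.dropLast_append_getLast hRt).symm⟩
        rw [show x :: (Lf ++ ar true ++ (Rt' ++ [w])) = (x :: (Lf ++ ar true ++ Rt')) ++ [w] by
          simp] at hl
        rw [← (List.append_inj' hl rfl).1]
        simp [hv]
      constructor
      · intro hzL
        exact (hl'.anti z (hLl z (List.mem_reverse.1 hzL))).1 hz
      · intro v hv hadj
        exact (hl'.anti v (hLl v (List.mem_reverse.1 hv))).2 z hz hadj.symm)
  exact this.mono (by rintro z ⟨h1, h2, h3, h4⟩; exact ⟨h1, by simpa using h2, h3, h4⟩) le_rfl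

/-- A connected set of large chromatic number has a levelling with a level that contains a connected
set of half the chromatic number. -/
theorem ConnOn.exists_level_component (hG : 11 ≤ G.oddGirth) {S : Set V} (hS : ConnOn G S) {N : ℕ}
    (hN : 1 ≤ N) (hcol : ¬ ColOn G S (2 * N)) :
    ∃ r lev par m C, Levelling G S r lev par ∧ 0 < m ∧ (∀ v ∈ C, v ∈ S ∧ lev v = m + 1) ∧
      ConnOn G C ∧ ¬ ColOn G C N := by
  obtain ⟨r, hr⟩ := nonempty_of_not_colOn hcol
  obtain ⟨lev, par, h⟩ := hS.exists_levelling hr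
  obtain ⟨k, hk⟩ := h.exists_level hcol
  obtain ⟨C, hC, hCc, hCcol, -⟩ := exists_component hk
  -- Levels 0 and 1 are stable sets, so the level found is at least 2 and its letters have parents.
  rcases k with _ | _ | m
  · refine absurd (StableOn.colOn ?_ |>.mono (T := {v | v = r}) ?_ hN) hk
    · rintro u rfl v rfl
      exact G.irrefl
    · exact fun v hv => h.eq_root hv.1 hv.2
  · refine absurd ((stableOn_neighbor hG r).colOn.mono ?_ hN) hk
    intro v hv
    have h1 := h.letter (m := 0) hv
    have := h.eq_root h1.1.1 h1.1.2
    exact this ▸ h1.2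
  · exact ⟨r, lev, par, m + 1, C, h, by omega, fun v hv => hC hv, hCc, hCcol⟩

end Inner

/-- Of the five extra colours, 1 pays for a step into `C`, so that the rope after `x` and its holes
lie in `C`. The vertices near `q x` cost 2, which lets `x` serve as a further mark. The vertices
near `x` cost 2 as well; in an inner levelling this makes the letters of `E` far from `x`. -/
theorem Att.exists_long_rope (hG : 11 ≤ G.oddGirth) {q : V → V} {x : V} {C : Set V} (h : Att G x C)
    (hq : ∀ v ∈ C, G.Adj v (q v)) {N n : ℕ} (hcol : ¬ ColOn G C (2 ^ n * (N + 20) - 20 + 5)) :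
    ∃ s₀ R y E, R.length = n ∧
      (∀ e, ∃ l, x :: (s₀ ++ segPath R e) = l ++ [y] ∧ Trail G x C l y E) ∧
      (∀ g ∈ R, g.IsGood G {v | v ∈ C ∧ v ∉ E ∧ ∀ c ∈ E, ¬ G.Adj v c}) ∧
      (x :: segMarks R).Pairwise (fun a b => Far G (q a) (q b)) ∧ ¬ ColOn G E N ∧
      ∀ v ∈ E, ∀ b, G.Adj v b → Far G x b := by
  obtain ⟨y₁, C₁, h1, t1, c1⟩ := h.exists_trail_step hG
    (N := 2 ^ n * (N + 20) - 20 + 4) hcol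
  obtain ⟨l₂, y₂, C₂, t2, n2, c2⟩ := t1.att.exists_trail (N := 2 ^ n * (N + 20) - 20)
    ((colOn_near hG x).union (colOn_near hG (q x))) c1
  have hC₂ : C₂ ⊆ C := t2.subset.trans t1.subset
  obtain ⟨s₀, R, y, E, hR, P, hE⟩ := t2.att.exists_rope hG n (fun v hv => hq v (hC₂ hv)) c2
  have hEC₂ : E ⊆ C₂ := by
    obtain ⟨l, -, hl⟩ := P.trail fun _ => true
    exact hl.subset
  have hy₂ : y₂ ∈ C := by
    by_cases he : y₂ = y₁
    · exact he ▸ h1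
    · exact t1.subset (t2.mem y₂ (by simp) he)
  refine ⟨l₂ ++ s₀, R, y, E, hR, fun e => ?_, fun g hg => (P.good g hg).mono ?_, ?_, hE, ?_⟩
  · obtain ⟨l, hl, hl'⟩ := P.trail e
    refine ⟨_, ?_, (t1.trans t2).trans hl'⟩
    rw [List.append_assoc l₂, hl]
    simp
  · rintro v ⟨hv, hv'⟩
    refine ⟨?_, hv'⟩
    rcases hv with rfl | hv
    · exact hy₂
    · exact hC₂ hv
  · refine List.pairwise_cons.2 ⟨fun v hv => ?_, P.marks_far⟩
    have hv := P.marks_mem v hv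
    by_contra hc
    exact n2 v hv (.inr ⟨_, hq v (hC₂ hv), hc⟩)
  · intro v hv b hb
    by_contra hc
    exact n2 v (hEC₂ hv) (.inl ⟨b, hb, hc⟩)

/-- A letter of the last part of the rope which sees no arc, and of the first three stems and all
that follows each of them only one side. -/
theorem Levelling.exists_letter [Finite V] (hG : 11 ≤ G.oddGirth) (hno : ¬ HasOddWheel G)
    {H : Set V} {r : V} {lev : V → ℕ} {par : V → V} {k : ℕ}
    (h : Levelling G H r lev par) (hk : 0 < k) {C E : Set V}
    (hC : ∀ z ∈ C, z ∈ H ∧ lev z = k + 1) {x y : V} {s₀ : List V} {g₁ g₂ g₃ : Seg V}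
    {R : List (Seg V)} (hR : R.length = 2)
    (ht : ∀ e, ∃ l, x :: (s₀ ++ segPath (g₁ :: g₂ :: g₃ :: R) e) = l ++ [y] ∧ Trail G x C l y E)
    (hg : ∀ g ∈ g₁ :: g₂ :: g₃ :: R, g.IsGood G {v | v ∈ C ∧ v ∉ E ∧ ∀ c ∈ E, ¬ G.Adj v c})
    (hcol : ¬ ColOn G E 289) :
    ∃ z ∈ E, (∀ g ∈ g₁ :: g₂ :: g₃ :: R, ∀ b, ∀ v ∈ g.arc b, ¬ G.Adj (par z) v) ∧
      ((∃ v ∈ s₀, G.Adj (par z) v) → ∀ g ∈ g₁ :: g₂ :: g₃ :: R, ∀ v ∈ g.stem,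
        ¬ G.Adj (par z) v) ∧
      ((∃ v ∈ g₁.stem, G.Adj (par z) v) → ∀ g ∈ g₂ :: g₃ :: R, ∀ v ∈ g.stem,
        ¬ G.Adj (par z) v) ∧
      ((∃ v ∈ g₂.stem, G.Adj (par z) v) → ∀ g ∈ g₃ :: R, ∀ v ∈ g.stem, ¬ G.Adj (par z) v) := by
  have hEC : E ⊆ C := by
    obtain ⟨l, -, hl⟩ := ht fun _ => true
    exact hl.subset
  have b0 := h.colOn_holes hG hno hk (E := E) (fun z hz => hC z (hEC hz))
    (D := {v | v ∈ C ∧ v ∉ E ∧ ∀ c ∈ E, ¬ G.Adj v c}) (fun v hv => ⟨hC v hv.1, hv.2⟩) hg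
  have b1 := h.colOn_both_sides hG hno hk hC (x := x) (y := y) (E := E) (Lf := s₀) (ar := g₁.arc)
    (Rt := g₁.stem ++ segPath (g₂ :: g₃ :: R) fun _ => true) (hg g₁ (by simp)).parity
    (by simp [Seg.stem]) (fun b => by
      obtain ⟨l, hl, hl'⟩ := ht (chooseArcs (b, true, true))
      exact ⟨l, by rw [← hl]; simp [segPath, chooseArcs], hl'⟩)
  have b2 := h.colOn_both_sides hG hno hk hC (x := x) (y := y) (E := E)
    (Lf := s₀ ++ g₁.arc true ++ g₁.stem) (ar := g₂.arc)
    (Rt := g₂.stem ++ segPath (g₃ :: R) fun _ => true) (hg g₂ (by simp)).parity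
    (by simp [Seg.stem]) (fun b => by
      obtain ⟨l, hl, hl'⟩ := ht (chooseArcs (true, b, true))
      exact ⟨l, by rw [← hl]; simp [segPath, chooseArcs], hl'⟩)
  have b3 := h.colOn_both_sides hG hno hk hC (x := x) (y := y) (E := E)
    (Lf := s₀ ++ g₁.arc true ++ g₁.stem ++ g₂.arc true ++ g₂.stem) (ar := g₃.arc)
    (Rt := g₃.stem ++ segPath R fun _ => true) (hg g₃ (by simp)).parity
    (by simp [Seg.stem]) (fun b => by
      obtain ⟨l, hl, hl'⟩ := ht (chooseArcs (true, true, b))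
      exact ⟨l, by rw [← hl]; simp [segPath, chooseArcs], hl'⟩)
  by_contra hcon
  push Not at hcon
  -- The count is `289 = 29 * 5 + 3 * 48`: five holes, and both sides of three of them.
  refine hcol ((b0.union (b1.union (b2.union b3))).mono ?_ (by simp [hR]))
  intro z hz
  by_cases h0 : ∃ g ∈ g₁ :: g₂ :: g₃ :: R, ∃ b, ∃ v ∈ g.arc b, G.Adj (par z) v
  · exact .inl ⟨hz, h0⟩
  right
  push Not at h0
  have key : ∀ (Lf : List V) (g : Seg V) (R' : List (Seg V)),
      (∀ g' ∈ g :: R', g' ∈ g₁ :: g₂ :: g₃ :: R) →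
      ¬ (z ∈ E ∧ (∃ v ∈ Lf, G.Adj (par z) v) ∧
        (∃ v ∈ g.stem ++ segPath R' fun _ => true, G.Adj (par z) v) ∧
        ∀ b, ∀ v ∈ g.arc b, ¬ G.Adj (par z) v) →
      (∃ v ∈ Lf, G.Adj (par z) v) → ∀ g' ∈ g :: R', ∀ v ∈ g'.stem, ¬ G.Adj (par z) v := by
    intro Lf g R' hR' hn hL g' hg' v hv hadj
    refine hn ⟨hz, hL, ⟨v, ?_, hadj⟩, h0 g (hR' g (by simp))⟩
    rcases List.mem_cons.1 hg' with rfl | hg'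
    · exact List.mem_append_left _ hv
    · exact List.mem_append_right _ (mem_segPath_of_stem hv _ hg')
  by_contra hn
  simp only [Set.mem_union, Set.mem_ofPred_eq, not_or] at hn
  obtain ⟨n1, n2, n3⟩ := hn
  obtain ⟨hs, g, hg, v, hv, hadj⟩ := hcon z hz h0 (key _ _ _ (fun _ h => h) n1)
    (fun ⟨v, hv, hadj⟩ => key _ _ _ (fun _ h => List.mem_cons_of_mem _ h) n2
      ⟨v, by simp [hv], hadj⟩)
  exact key _ _ _ (fun _ h => List.mem_cons_of_mem _ (List.mem_cons_of_mem _ h)) n3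
    (hs.imp fun v hv => ⟨by simp [hv.1], hv.2⟩) g hg v hv hadj

/-- The choice of arcs that puts one more arc in front. -/
def consArc (e : ℕ → Bool) : ℕ → Bool
  | 0 => true
  | n + 1 => e n

/-- A rope through five segments yields an odd wheel. The marks have far letters in the levelling of
`S`, and the rope lies in a level of a levelling of a part `H` of a level of `S`. -/
theorem Levelling.hasOddWheel_of_rope [Finite V] (hG : 11 ≤ G.oddGirth) {S H C E : Set V}
    {r r' : V} {lev lev' : V → ℕ} {q par : V → V} {m k : ℕ} (h : Levelling G S r lev q)
    (hm : 0 < m) (hH : ∀ v ∈ H, v ∈ S ∧ lev v = m + 1) (h' : Levelling G H r' lev' par)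
    (hk : 0 < k) (hC : ∀ v ∈ C, v ∈ H ∧ lev' v = k + 1) {x y : V} (hx : x ∈ H ∧ lev' x = k)
    {s₀ : List V} {g₁ g₂ g₃ g₄ g₅ : Seg V}
    (ht : ∀ e, ∃ l, x :: (s₀ ++ segPath [g₁, g₂, g₃, g₄, g₅] e) = l ++ [y] ∧ Trail G x C l y E)
    (hg : ∀ g ∈ [g₁, g₂, g₃, g₄, g₅], g.IsGood G {v | v ∈ C ∧ v ∉ E ∧ ∀ c ∈ E, ¬ G.Adj v c})
    (hfar : (x :: segMarks [g₁, g₂, g₃, g₄, g₅]).Pairwise fun a b => Far G (q a) (q b))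
    (hcol : ¬ ColOn G E 289) (hEx : ∀ v ∈ E, ∀ b, G.Adj v b → Far G x b) : HasOddWheel G := by
  by_contra hno
  refine hno ?_
  have hCS : ∀ v ∈ C, v ∈ S ∧ lev v = m + 1 := fun v hv => hH v (hC v hv).1
  have hlevC : ∀ v, lev' v = k → v ∉ C := fun v hv hvC => by
    have := (hC v hvC).2
    omega
  have hEC : E ⊆ C := by
    obtain ⟨l, -, hl⟩ := ht fun _ => true
    exact hl.subset
  have hpathC : ∀ e, ∀ v ∈ s₀ ++ segPath [g₁, g₂, g₃, g₄, g₅] e, v ∈ C := by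
    intro e v hv
    obtain ⟨l, hl, hl'⟩ := ht e
    have hp := hl ▸ hl'.path
    exact hl'.mem v (hl ▸ List.mem_cons_of_mem _ hv) fun e => (hp.1 v hv).1 e.symm
  -- If the letter of `z` sees `s₀` or one of the first two stems, the rim starts there and uses the
  -- next three segments. Five segments suffice for every case.
  obtain ⟨z, hz, harc, hit₀, hit₁, hit₂⟩ := h'.exists_letter hG hno hk hC rfl ht hg hcol
  obtain ⟨hp, hzp⟩ := h'.letter (hC z (hEC hz))
  set p := par z
  have hpC := hlevC p hp.2
  have hpS := hH p hp.1
  have hpE : ∃ z ∈ E, G.Adj p z := ⟨z, hz, hzp.symm⟩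
  have hmiss : ∀ R' : List (Seg V), (∀ g ∈ R', g ∈ [g₁, g₂, g₃, g₄, g₅]) →
      (∀ g ∈ R', ∀ v ∈ g.stem, ¬ G.Adj p v) → ∀ e, ∀ v ∈ segPath R' e, ¬ G.Adj p v := by
    intro R' hR' hst e v hv
    rcases mem_segPath hv with ⟨g, hgR, b, hb⟩ | ⟨g, hgR, hb⟩
    · exact harc g (hR' g hgR) b v hb
    · exact hst g hgR v hb
  by_cases c₂ : ∃ v ∈ g₂.stem, G.Adj p v
  · refine h.hasOddWheel_of_hit hG hm (x := x) (y := y)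
      (U := x :: (s₀ ++ (g₁.arc true ++ (g₁.stem ++ g₂.arc true)))) (s₀ := g₂.stem)
      (g₁ := g₃) (g₂ := g₄) (g₃ := g₅) (R := []) (fun e => ?_) c₂ hpE
      (hmiss _ (by simp) (hit₂ c₂)) (fun e v hv => ?_) hpC hCS hpS
      (fun g hg' => hg g (List.IsInfix.subset ⟨[g₁, g₂], [], rfl⟩ hg'))
      (hfar.sublist (List.IsInfix.sublist ⟨x :: segMarks [g₁, g₂], [], rfl⟩))
    · obtain ⟨l, hl, hl'⟩ := ht (consArc (consArc e))
      exact ⟨l, by rw [← hl]; simp [segPath, consArc], hl'⟩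
    · refine hpathC (consArc (consArc e)) v ?_
      rw [show s₀ ++ segPath [g₁, g₂, g₃, g₄, g₅] (consArc (consArc e)) = (s₀ ++ (g₁.arc true ++
        (g₁.stem ++ g₂.arc true))) ++ (g₂.stem ++ segPath [g₃, g₄, g₅] e) by simp [segPath, consArc]]
      exact List.mem_append_right _ hv
  by_cases c₁ : ∃ v ∈ g₁.stem, G.Adj p v
  · refine h.hasOddWheel_of_hit hG hm (x := x) (y := y) (U := x :: (s₀ ++ g₁.arc true)) (s₀ := g₁.stem)
      (g₁ := g₂) (g₂ := g₃) (g₃ := g₄) (R := [g₅]) (fun e => ?_) c₁ hpE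
      (hmiss _ (by simp) (hit₁ c₁)) (fun e v hv => ?_) hpC hCS hpS
      (fun g hg' => hg g (List.IsInfix.subset ⟨[g₁], [g₅], rfl⟩ hg'))
      (hfar.sublist (List.IsInfix.sublist ⟨x :: segMarks [g₁], segMarks [g₅], rfl⟩))
    · obtain ⟨l, hl, hl'⟩ := ht (consArc e)
      exact ⟨l, by rw [← hl]; simp [segPath, consArc], hl'⟩
    · refine hpathC (consArc e) v ?_
      rw [show s₀ ++ segPath [g₁, g₂, g₃, g₄, g₅] (consArc e) = (s₀ ++ g₁.arc true) ++
        (g₁.stem ++ segPath [g₂, g₃, g₄, g₅] e) by simp [segPath, consArc]]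
      exact List.mem_append_right _ hv
  by_cases c₀ : ∃ v ∈ s₀, G.Adj p v
  · exact h.hasOddWheel_of_hit hG hm (x := x) (y := y) (U := [x]) (s₀ := s₀)
      (g₁ := g₁) (g₂ := g₂) (g₃ := g₃) (R := [g₄, g₅]) ht c₀ hpE
      (hmiss _ (by simp) (hit₀ c₀)) hpathC hpC hCS hpS
      (fun g hg' => hg g (List.IsInfix.subset ⟨[], [g₄, g₅], rfl⟩ hg'))
      (hfar.sublist (List.IsInfix.sublist ⟨[x], segMarks [g₄, g₅], rfl⟩))
  -- the rim is closed through the lower levels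
  push Not at c₀ c₁ c₂
  have hxp := hEx z hz p hzp
  -- This link serves as part of the rim, so its bipartition is irrelevant. What counts is that `p`
  -- and `x`, being far, see just their parents in it, and that it lies too high to see `C`.
  obtain ⟨A, B, -, -, -, hAB, hlow, hpar⟩ := h'.exists_link hG hk (ps := [p, x]) (by simp)
    (by simp [hp, hx]) (by
      intro a ha b hb hne
      simp only [List.mem_cons, List.not_mem_nil, or_false] at ha hb
      rcases ha with rfl | rfl <;> rcases hb with rfl | rfl
      exacts [absurd rfl hne, hxp.symm, hxp, absurd rfl hne])
  obtain ⟨hp1, hp2, hp3⟩ := hpar p (by simp)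
  obtain ⟨hx1, hx2, hx3⟩ := hpar x (by simp)
  obtain ⟨K, w, hK1, hK2, rfl, -, hK3⟩ := hAB.exists_indPath (Q := fun v => v = par x) hp1
    ⟨_, hx1, rfl⟩
  refine h.hasOddWheel_of_miss hG hm (K := K ++ [par x]) (R := [g₄, g₅]) ht hpE ?_ hpC hxp.1.symm
    hK1 (by simp) ?_ ?_ ?_ hCS hpS (hH x hx.1) (fun v hv => hH v (hlow v (hK3 v hv)).1)
    (fun g hg' => hg g (List.IsInfix.subset ⟨[], [g₄, g₅], rfl⟩ hg'))
    (hfar.sublist (List.IsInfix.sublist ⟨[], segMarks [g₄, g₅], rfl⟩))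
  · intro a b c v hv
    simp only [List.mem_cons, List.mem_append] at hv
    rcases hv with rfl | hv | hv | hv | hv | hv | hv
    · exact hxp.symm.2.1
    · exact c₀ v hv
    · exact harc g₁ (by simp) _ v hv
    · exact c₁ v hv
    · exact harc g₂ (by simp) _ v hv
    · exact c₂ v hv
    · exact harc g₃ (by simp) _ v hv
  · intro v hv
    obtain ⟨h1, h2⟩ := hlow v (hK3 v hv)
    refine ⟨by rintro rfl; omega, by rintro rfl; omega, fun c hc => ?_⟩
    obtain ⟨h3, h4⟩ := hC c hc
    refine ⟨by rintro rfl; omega, fun hadj => ?_⟩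
    have := h'.lev_le v h1 c h3 hadj.symm
    omega
  · intro v hv
    rw [hK2, Option.some_inj]
    exact ⟨fun hadj => (hp3 v (hK3 v hv) hadj).symm, fun e => e ▸ hp2⟩
  · intro v hv
    rw [List.getLast?_concat, Option.some_inj]
    exact ⟨fun hadj => (hx3 v (hK3 v hv) hadj).symm, fun e => e ▸ hx2⟩

/-- A finite graph with odd girth at least `11` and without odd wheel t-minor is
`199049`-colourable. -/
theorem colorable_of_not_hasOddWheel [Finite V] (hG : 11 ≤ G.oddGirth) (hno : ¬ HasOddWheel G) :
    G.Colorable 199049 := by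
  refine colorable_of_colOn (by_contra fun hcol => hno ?_)
  obtain ⟨S₀, -, hS₀, hS₀col, -⟩ := exists_component hcol
  -- Each of the two levellings halves the bound. The rope needs only `2 ^ 5 * (289 + 20) - 20 + 5 =
  -- 9873`, so 49762 leaves slack.
  obtain ⟨r, lev, q, m, H, h, hm, hH, hHc, hHcol⟩ := hS₀.exists_level_component hG (N := 99524)
    (by norm_num) (fun hc => hS₀col (hc.mono subset_rfl (by norm_num)))
  obtain ⟨r', lev', par, k, C, h', hk, hC, hCc, hCcol⟩ := hHc.exists_level_component hG (N := 49762)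
    (by norm_num) (fun hc => hHcol (hc.mono subset_rfl (by norm_num)))
  have hCS : ∀ v ∈ C, v ∈ S₀ ∧ lev v = m + 1 := fun v hv => hH v (hC v hv).1
  obtain ⟨z₀, hz₀⟩ := nonempty_of_not_colOn hCcol
  obtain ⟨hx, hzx⟩ := h'.letter (hC z₀ hz₀)
  set x := par z₀
  have hatt : Att G x C := ⟨fun hxC => by have := (hC x hxC).2; omega, hCc, z₀, hz₀, hzx.symm⟩
  obtain ⟨s₀, R, y, E, hR, ht, hg, hfar, hcol', hEx⟩ := hatt.exists_long_rope hG (q := q) (N := 289)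
    (n := 5) (fun v hv => (h.letter (hCS v hv)).2) (fun hc => hCcol (hc.mono subset_rfl (by norm_num)))
  obtain ⟨g₁, g₂, g₃, g₄, g₅, rfl⟩ : ∃ g₁ g₂ g₃ g₄ g₅, R = [g₁, g₂, g₃, g₄, g₅] := by
    rcases R with _ | ⟨a, _ | ⟨b, _ | ⟨c, _ | ⟨d, _ | ⟨e, _ | ⟨f, R⟩⟩⟩⟩⟩⟩ <;> simp at hR
    exact ⟨a, b, c, d, e, rfl⟩
  exact h.hasOddWheel_of_rope hG hm hH h' hk hC hx ht hg hfar hcol' hEx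

end SimpleGraph

theorem theorem3p1 {V : Type u} [Finite V] (G : SimpleGraph V) (hgirth : 11 ≤ G.oddGirth)
    (hwheel : ∀ (W : Type u) (H : SimpleGraph W), H.IsOddWheel → ¬ H.IsTMinor G) :
    G.Colorable 199049 :=
  SimpleGraph.colorable_of_not_hasOddWheel hgirth fun ⟨W, H, h1, h2⟩ => hwheel W H h1 h2
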